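/- Let $\Sigma$ be a closed connected locally Euclidean surface with conical singularities of positive angles (with its intrinsic metric), and let $S\subset\Sigma$ be a nonempty finite set of marked points containing all the singular points. An adapted triangulation of $(\Sigma,S)$ is a geodesic triangulation by nondegenerate Euclidean triangles whose set of vertices is exactly $S$ (sides or vertices of one triangle may be identified). For $\tau\in\mathbb R^S$ and an adapted triangulation $\mathcal T$, let $\widetilde\tau_{\tau,\mathcal T}:\Sigma\to\mathbb R$ be the extension of $\tau$ which on each triangle $T$ of $\mathcal T$, developed in the Euclidean plane, has the form $x\mapsto t_0-d(x,\omega)^2$ for some $t_0\in\mathbb R$ and some point $\omega$ of the plane. A function $f:\Sigma\to\mathbb R$ is Q-convex if, along every geodesic segment of $\Sigma\setminus S$ parametrized by arc length, it is continuous and piecewise $\mathscr C^1$, and the left limit of its derivative is at most the right limit at every interior point. The domain of admissible times $\mathcal P\subset\mathbb R^S$ is the set of $\tau\in\mathbb R_+^S$, where $\mathbb R_+=[0,\infty)$, for which there is an adapted triangulation $\mathcal T$ such that $\widetilde\tau_{\tau,\mathcal T}$ is Q-convex. The 2-cells of the Delaunay cellulation of $(\Sigma,S)$ are obtained as follows: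 take an isometric immersion into $\Sigma\setminus S$ of an open Euclidean disc whose continuous extension $\varphi$ to the closed disc sends at least three points of the boundary circle to $S$; the cell is the image under $\varphi$ of the convex hull of the points of the circle sent to $S$. An adapted triangulation refines the Delaunay cellulation if each of its triangles lies in such a polygon. Then the constant function $\mathbf 1_S$ lies in the interior of $\mathcal P$ in $\mathbb R^S$. Moreover, for every constant $t\ge 0$ there is a neighbourhood $U$ of $t\mathbf 1_S$ in $\mathbb R^S$ such that for every $\tau\in U\cap\mathbb R_+^S$ there is an adapted triangulation $\mathcal T$ refining the Delaunay cellulation of $(\Sigma,S)$ for which $\widetilde\tau_{\tau,\mathcal T}$ is Q-convex. -/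

import Mathlib

open Set Filter Topology

noncomputable section

namespace FlatCone

/-- The Euclidean plane. -/
abbrev Plane : Type := EuclideanSpace ℝ (Fin 2)

/-- The distance, in the Euclidean cone of total angle `θ`, between the points with polar
coordinates `(r, a)` and `(r', a')`; the norm on `AddCircle θ = ℝ / θℤ` is the angular distance. -/
def coneDist (θ : ℝ) (r : ℝ) (a : AddCircle θ) (r' : ℝ) (a' : AddCircle θ) : ℝ :=
  Real.sqrt (r ^ 2 + r' ^ 2 - 2 * r * r' * Real.cos (min Real.pi ‖a - a'‖))

/-- Some open ball around `p` is isometric to a ball around the apex of the Euclidean cone of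
angle `θ > 0`, the apex corresponding to `p`; `ψ` gives polar coordinates around `p`. -/
def IsConePoint {X : Type*} [MetricSpace X] (p : X) (θ : ℝ) : Prop :=
  0 < θ ∧ ∃ ε > 0, ∃ ψ : ℝ → AddCircle θ → X,
    (∀ a, ψ 0 a = p) ∧
    (∀ r ∈ Ico 0 ε, ∀ r' ∈ Ico 0 ε, ∀ a a', dist (ψ r a) (ψ r' a') = coneDist θ r a r' a') ∧
    (∀ x ∈ Metric.ball p ε, ∃ r ∈ Ico 0 ε, ∃ a, ψ r a = x)

/-- A closed Euclidean surface with conical singularities, given by its intrinsic metric, with a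
nonempty finite set `S` of marked points containing all the singular points. On a compact space,
the existence of midpoints says that the distance is the infimum of the lengths of paths. -/
structure IsMarkedSurface {X : Type*} [MetricSpace X] (S : Set X) : Prop where
  compact : CompactSpace X
  finite : S.Finite
  nonempty : S.Nonempty
  midpoint : ∀ x y : X, ∃ m, dist x m = dist x y / 2 ∧ dist m y = dist x y / 2
  conical : ∀ p : X, ∃ θ, IsConePoint p θ
  regular : ∀ p ∉ S, IsConePoint p (2 * Real.pi)

/-- `φ` preserves distances on a neighbourhood of `x` in `D`. -/
def IsometricNear {Y X : Type*} [MetricSpace Y] [MetricSpace X] (D : Set Y) (φ : Y → X) (x : Y) :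
    Prop :=
  ∃ ε > 0, ∀ y ∈ D ∩ Metric.ball x ε, ∀ z ∈ D ∩ Metric.ball x ε, dist (φ y) (φ z) = dist y z

/-- The open face, spanned by the vertices with index in `F`, of the triangle with vertices `v`. -/
def openFace (v : Fin 3 → Plane) (F : Finset (Fin 3)) : Set Plane :=
  {x | ∃ w : Fin 3 → ℝ, (∀ k ∈ F, 0 < w k) ∧ (∀ k ∉ F, w k = 0) ∧ ∑ k, w k = 1 ∧
    x = ∑ k, w k • v k}

/-- A geodesic triangulation of the surface with vertex set exactly `S`: finitely many
nondegenerate triangles of the plane with characteristic maps `chart i` (only their values on the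
triangles matter) which are isometric away from the vertices and whose open faces are the cells of
a cell decomposition. Two edges or vertices of one triangle may be identified, and two
triangles may share several faces. -/
structure AdaptedTriangulation {X : Type*} [MetricSpace X] (S : Set X) where
  n : ℕ
  vertex : Fin n → Fin 3 → Plane
  chart : Fin n → Plane → X
  affineIndependent : ∀ i, AffineIndependent ℝ (vertex i)
  continuousOn : ∀ i, ContinuousOn (chart i) (convexHull ℝ (range (vertex i)))
  isometric : ∀ i, ∀ x ∈ convexHull ℝ (range (vertex i)), x ∉ range (vertex i) →
    IsometricNear (convexHull ℝ (range (vertex i))) (chart i) x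
  covers : ⋃ i, chart i '' convexHull ℝ (range (vertex i)) = univ
  vertices : ⋃ i, chart i '' range (vertex i) = S
  injOn : ∀ i F, InjOn (chart i) (openFace (vertex i) F)
  faces : ∀ i j F G,
    (chart i '' openFace (vertex i) F ∩ chart j '' openFace (vertex j) G).Nonempty →
      chart i '' openFace (vertex i) F = chart j '' openFace (vertex j) G ∧ F.card = G.card ∧
        (F = Finset.univ → i = j)

/-- The closed planar triangle of index `i`. -/
def AdaptedTriangulation.triangle {X : Type*} [MetricSpace X] {S : Set X}
    (T : AdaptedTriangulation S) (i : Fin T.n) : Set Plane :=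
  convexHull ℝ (range (T.vertex i))

/-- `f` is the distance-like extension of `τ` to the surface for which `T` is adapted: on each
triangle of `T` it has the form `x ↦ t₀ - d(x, ω)²`. -/
def AdaptedTriangulation.IsDistanceLikeExtension {X : Type*} [MetricSpace X] {S : Set X}
    (T : AdaptedTriangulation S) (τ : S → ℝ) (f : X → ℝ) : Prop :=
  (∀ s : S, f s = τ s) ∧
    ∀ i, ∃ (ω : Plane) (t₀ : ℝ), ∀ x ∈ T.triangle i, f (T.chart i x) = t₀ - dist x ω ^ 2

/-- `f` is `C¹` on each of the closed intervals into which finitely many points cut `[a, b]`. -/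
def PiecewiseC1 (f : ℝ → ℝ) (a b : ℝ) : Prop :=
  ∃ D : Finset ℝ, ∀ u v, a ≤ u → u < v → v ≤ b → (∀ x ∈ D, x ∉ Ioo u v) →
    ContDiffOn ℝ 1 f (Icc u v)

/-- Q-convexity of a function on `[a, b]`: it is continuous, piecewise `C¹`, and its derivative
can only jump upwards. -/
def QConvexOn (f : ℝ → ℝ) (a b : ℝ) : Prop :=
  ContinuousOn f (Icc a b) ∧ PiecewiseC1 f a b ∧
    ∀ t ∈ Ioo a b, ∃ l r, Tendsto (deriv f) (𝓝[<] t) (𝓝 l) ∧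
      Tendsto (deriv f) (𝓝[>] t) (𝓝 r) ∧ l ≤ r

/-- `c` is a geodesic of the surface minus `S`, parametrized by arc length on `[a, b]`. -/
def IsGeodesicOff {X : Type*} [MetricSpace X] (S : Set X) (c : ℝ → X) (a b : ℝ) : Prop :=
  ∀ t ∈ Icc a b, c t ∉ S ∧ IsometricNear (Icc a b) c t

/-- Q-convexity of a function on the surface: Q-convexity along all geodesics avoiding `S`. -/
def QConvex {X : Type*} [MetricSpace X] (S : Set X) (f : X → ℝ) : Prop :=
  ∀ (c : ℝ → X) (a b : ℝ), a < b → IsGeodesicOff S c a b → QConvexOn (f ∘ c) a b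

/-- The adapted triangulation `T` induces a Q-convex distance-like extension of `τ`. -/
def AdaptedTriangulation.IsDelaunayFor {X : Type*} [MetricSpace X] {S : Set X}
    (T : AdaptedTriangulation S) (τ : S → ℝ) : Prop :=
  ∃ f : X → ℝ, T.IsDistanceLikeExtension τ f ∧ QConvex S f

/-- The domain of admissible times. -/
def admissibleTimes {X : Type*} [MetricSpace X] (S : Set X) : Set (S → ℝ) :=
  {τ | (∀ s, 0 ≤ τ s) ∧ ∃ T : AdaptedTriangulation S, T.IsDelaunayFor τ}

/-- The points of the closed disc of centre `ω` and radius `R` sent to `S` by `φ`. -/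
def markedPoints {X : Type*} (S : Set X) (ω : Plane) (R : ℝ) (φ : Plane → X) : Set Plane :=
  {x ∈ Metric.closedBall ω R | φ x ∈ S}

/-- `φ` is an isometric immersion of the open disc of centre `ω` and radius `R` into the surface
minus `S`, extended continuously to the closed disc, and at least three points of the boundary
circle are sent to `S`. The Delaunay 2-cells of `(X, S)` are the images under such `φ` of the
inscribed polygons `convexHull ℝ (markedPoints S ω R φ)`; the points `φ ω` are the vertices of the
Voronoi cellulation. -/
def IsDelaunayDisc {X : Type*} [MetricSpace X] (S : Set X) (ω : Plane) (R : ℝ) (φ : Plane → X) :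
    Prop :=
  0 < R ∧ ContinuousOn φ (Metric.closedBall ω R) ∧
    (∀ x ∈ Metric.ball ω R, φ x ∉ S ∧ IsometricNear (Metric.ball ω R) φ x) ∧
    3 ≤ (markedPoints S ω R φ).encard

/-- `T` refines the Delaunay cellulation: each triangle of `T` lies in a Delaunay 2-cell, and its
characteristic map is the restriction of the one of the cell. -/
def AdaptedTriangulation.RefinesDelaunay {X : Type*} [MetricSpace X] {S : Set X}
    (T : AdaptedTriangulation S) : Prop :=
  ∀ i, ∃ (ω : Plane) (R : ℝ) (φ : Plane → X), IsDelaunayDisc S ω R φ ∧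
    T.triangle i ⊆ convexHull ℝ (markedPoints S ω R φ) ∧ EqOn (T.chart i) φ (T.triangle i)

end FlatCone

end

noncomputable section

namespace FlatCone

/-! ### Isometries of the plane -/

/-! Adding a constant to `τ` adds it to the extension and preserves Q-convexity, so it suffices to
treat `τ` near `0`. Each Delaunay polygon is triangulated by the lower convex hull of the heights
`τ` at its vertices. On a triangle inscribed in a disc of radius `R` centred at the origin, the
extension is then `R² - |y|² + A(y)`, where `A` interpolates `τ` affinely.

Consider two triangles of the triangulation through a common point off `S`, developed in one plane.
The difference of their two formulas is affine, so on the first triangle its sign can be read at the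
three vertices. If a vertex lies on the circle of the second triangle, the second formula is at most
`τ` there by the lower hull property. If it lies strictly outside, the second formula is close to
`R² - |y|² < 0` and stays below `τ` when `τ` is small; only finitely many configurations occur, so
one neighbourhood of `0` serves for all. No marked point can lie strictly inside, since the discs
are empty. Hence on each triangle its own formula is the largest
(`IsMarkedSurface.height_le_height`). By symmetry the formulas agree on common points, so the
extension is well defined, and near a point off `S` it is a maximum of finitely many functions `t₀ -
d(·, ω)²`. Along a unit speed geodesic, adding `x²` turns these into affine functions of `x`, and
the slope of a maximum of affine functions only jumps upwards (`qConvexOn_of_max`).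

The rest shows that the Delaunay polygons decompose the surface. A flat chart at a point off `S` is
developed along rays until they hit `S` (`devDomain`, `visible`). Among the developed discs
containing the origin, one for which the power of the origin is extremal has the origin in the
convex hull of its marked points, and a second extremal choice provides three of them
(`IsMarkedSurface.exists_maximal_disc`); so the polygons cover. Endpoints are isolated
(`IsMarkedSurface.exists_nhds_inter_visible_subset`), which makes the vertices of each polygon
finite in number and the centres discrete, hence finite in number by compactness
(`IsMarkedSurface.finite_centers`). Two overlapping polygons are separated by the radical axis of
their circles, and distinct circles share at most two points, so triangles from different cells can
meet off `S` only along a common edge (`IsMarkedSurface.image_eq_of_overlap`). -/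

theorem inner_eq_of_dist_eq {f : Plane → Plane} {x y z : Plane} (h1 : dist (f y) (f x) = dist y x)
    (h2 : dist (f z) (f x) = dist z x) (h3 : dist (f y) (f z) = dist y z) :
    inner ℝ (f y - f x) (f z - f x) = inner ℝ (y - x) (z - x) := by
  rw [real_inner_eq_norm_mul_self_add_norm_mul_self_sub_norm_sub_mul_self_div_two,
    real_inner_eq_norm_mul_self_add_norm_mul_self_sub_norm_sub_mul_self_div_two,
    sub_sub_sub_cancel_right, sub_sub_sub_cancel_right, ← dist_eq_norm, ← dist_eq_norm,
    ← dist_eq_norm, ← dist_eq_norm, ← dist_eq_norm, ← dist_eq_norm, h1, h2, h3]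

/-- A distance preserving map from a disc to the plane is the restriction of an isometry. -/
theorem exists_affineIsometryEquiv_eqOn_ball {f : Plane → Plane} {x : Plane} {r : ℝ} (hr : 0 < r)
    (hf : ∀ y ∈ Metric.ball x r, ∀ z ∈ Metric.ball x r, dist (f y) (f z) = dist y z) :
    ∃ g : Plane ≃ᵃⁱ[ℝ] Plane, EqOn f g (Metric.ball x r) := by
  have hx : x ∈ Metric.ball x r := Metric.mem_ball_self hr
  have hin : ∀ y ∈ Metric.ball x r, ∀ z ∈ Metric.ball x r,
      inner ℝ (f y - f x) (f z - f x) = inner ℝ (y - x) (z - x) := fun y hy z hz =>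
    inner_eq_of_dist_eq (hf y hy x hx) (hf z hz x hx) (hf y hy z hz)
  let b := EuclideanSpace.basisFun (Fin 2) ℝ
  have hb : ∀ i, x + (r / 2) • b i ∈ Metric.ball x r := by
    intro i
    rw [Metric.mem_ball, dist_eq_norm, add_sub_cancel_left, norm_smul, b.norm_eq_one,
      Real.norm_of_nonneg (by positivity)]
    linarith
  let c : Fin 2 → Plane := fun i => (r / 2)⁻¹ • (f (x + (r / 2) • b i) - f x)
  have hc : ∀ y ∈ Metric.ball x r, ∀ i, inner ℝ (f y - f x) (c i) = inner ℝ (y - x) (b i) := by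
    intro y hy i
    simp only [c]
    rw [real_inner_smul_right, hin y hy _ (hb i), add_sub_cancel_left, real_inner_smul_right]
    field_simp
  have hon : Orthonormal ℝ c := by
    rw [orthonormal_iff_ite]
    intro i j
    have h1 := hc _ (hb i) j
    have h2 := orthonormal_iff_ite.1 b.orthonormal i j
    rw [add_sub_cancel_left, real_inner_smul_left, h2] at h1
    simp only [c] at h1 ⊢
    rw [real_inner_smul_left, h1]
    field_simp
  have hcard : Fintype.card (Fin 2) = Module.finrank ℝ Plane := by simp
  let c' : OrthonormalBasis (Fin 2) ℝ Plane :=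
    OrthonormalBasis.mk hon (by
      rw [hon.linearIndependent.span_eq_top_of_card_eq_finrank' hcard])
  have hc' : ∀ i, c' i = c i := fun i => by simp [c']
  let L : Plane ≃ₗᵢ[ℝ] Plane := b.equiv c' (Equiv.refl _)
  have hL : ∀ i, L (b i) = c i := fun i => by simp [L, hc']
  refine ⟨AffineIsometryEquiv.mk' (fun y => L (y - x) + f x) L x (by intro y; simp), ?_⟩
  intro y hy
  have key : f y - f x = L (y - x) := by
    refine c'.toBasis.ext_elem fun i => ?_
    simp only [OrthonormalBasis.coe_toBasis_repr_apply, OrthonormalBasis.repr_apply_apply]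
    rw [real_inner_comm, hc', hc y hy, real_inner_comm (L (y - x)), ← hL, L.inner_map_map]
  rw [sub_eq_iff_eq_add] at key
  exact key

/-- An affine map is determined on the line through `x` and `y` by its values at `x` and at one
other point, which can be taken close to `x`. -/
theorem affineIsometryEquiv_eq_of_eventuallyEq {g g' : Plane ≃ᵃⁱ[ℝ] Plane} {x : Plane}
    (h : ∀ᶠ y in 𝓝 x, g y = g' y) : g = g' := by
  ext1 y
  have hx : g x = g' x := h.self_of_nhds
  have hc : ContinuousAt (fun t : ℝ => AffineMap.lineMap x y t) 0 := by fun_prop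
  have h0 : Tendsto (fun t : ℝ => AffineMap.lineMap x y t) (𝓝[>] 0) (𝓝 x) := by
    have := hc.tendsto.mono_left (nhdsWithin_le_nhds (s := Ioi 0))
    simpa using this
  obtain ⟨t, ht, ht0⟩ := ((h0.eventually h).and self_mem_nhdsWithin).exists
  have e1 : ∀ k : Plane ≃ᵃⁱ[ℝ] Plane, k (AffineMap.lineMap x y t) =
      AffineMap.lineMap (k x) (k y) t := fun k => by
    exact k.toAffineEquiv.toAffineMap.apply_lineMap x y t
  rw [e1, e1, hx, AffineMap.lineMap_apply, AffineMap.lineMap_apply] at ht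
  have ht0' : t ≠ 0 := ne_of_gt ht0
  simpa [ht0'] using ht

/-- The equality case of the Cauchy-Schwarz inequality: the three distances determine an inner
product, and the squared norm of the difference of the two sides comes out as zero. -/
theorem eq_line_of_dist_eq {u : ℝ → Plane} {t₀ t₁ t : ℝ} (h : t₀ ≠ t₁)
    (h01 : dist (u t₁) (u t₀) = |t₁ - t₀|) (h0 : dist (u t) (u t₀) = |t - t₀|)
    (h1 : dist (u t) (u t₁) = |t - t₁|) :
    u t = u t₀ + (t - t₀) • (t₁ - t₀)⁻¹ • (u t₁ - u t₀) := by
  have h' : t₁ - t₀ ≠ 0 := sub_ne_zero.2 h.symm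
  have hin : inner ℝ (u t - u t₀) (u t₁ - u t₀) = (t - t₀) * (t₁ - t₀) := by
    rw [real_inner_eq_norm_mul_self_add_norm_mul_self_sub_norm_sub_mul_self_div_two,
      sub_sub_sub_cancel_right, ← dist_eq_norm, ← dist_eq_norm, ← dist_eq_norm, h01, h0, h1,
      abs_mul_abs_self, abs_mul_abs_self, abs_mul_abs_self]
    ring
  rw [← sub_eq_zero, ← sub_sub, ← norm_eq_zero, ← sq_eq_zero_iff, norm_sub_sq_real, norm_smul,
    norm_smul, real_inner_smul_right, real_inner_smul_right, hin, ← dist_eq_norm (u t),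
    ← dist_eq_norm (u t₁), h01, h0, norm_inv, Real.norm_eq_abs, Real.norm_eq_abs,
    inv_mul_cancel₀ (abs_ne_zero.2 h'), mul_one, sq_abs]
  field_simp
  ring

/-! ### Polar coordinates -/

/-- The point of the plane with polar coordinates `(r, α)`. -/
def polar (r α : ℝ) : Plane := !₂[r * Real.cos α, r * Real.sin α]

theorem dist_polar (r α r' α' : ℝ) : dist (polar r α) (polar r' α') =
    Real.sqrt (r ^ 2 + r' ^ 2 - 2 * r * r' * Real.cos (α - α')) := by
  rw [EuclideanSpace.dist_eq, Fin.sum_univ_two]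
  congr 1
  simp only [polar, Real.dist_eq, sq_abs, Real.cos_sub]
  simp only [Matrix.cons_val_zero, Matrix.cons_val_one]
  nlinarith [Real.sin_sq_add_cos_sq α, Real.sin_sq_add_cos_sq α']

theorem norm_polar {r : ℝ} (hr : 0 ≤ r) (α : ℝ) : ‖polar r α‖ = r := by
  have h0 : polar 0 0 = 0 := by ext i; fin_cases i <;> simp [polar]
  rw [← dist_zero_right, ← h0, dist_polar]
  simp [Real.sqrt_sq hr]

theorem exists_polar (y : Plane) : ∃ α, y = polar ‖y‖ α := by
  let z : ℂ := ⟨y 0, y 1⟩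
  have hz : ‖z‖ = ‖y‖ := by
    rw [EuclideanSpace.norm_eq, Fin.sum_univ_two, Complex.norm_eq_sqrt_sq_add_sq]
    simp [z]
  refine ⟨z.arg, ?_⟩
  have h1 := Complex.norm_mul_cos_arg z
  have h2 := Complex.norm_mul_sin_arg z
  rw [hz] at h1 h2
  ext i
  fin_cases i
  · simpa [polar] using h1.symm
  · simpa [polar] using h2.symm

/-! ### Local structure of the surface -/

theorem coneDist_zero_right {θ : ℝ} {r : ℝ} (hr : 0 ≤ r) (a a' : AddCircle θ) :
    coneDist θ r a 0 a' = r := by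
  simp [coneDist, Real.sqrt_sq hr]

theorem exists_real_rep_abs_eq_norm {θ : ℝ} (a : AddCircle θ) :
    ∃ α : ℝ, (α : AddCircle θ) = a ∧ |α| = ‖a‖ := by
  obtain ⟨x, rfl⟩ := QuotientAddGroup.mk_surjective a
  refine ⟨x - round (θ⁻¹ * x) * θ, ?_, ?_⟩
  · rw [AddCircle.coe_sub]
    have : ((round (θ⁻¹ * x) * θ : ℝ) : AddCircle θ) = 0 := by
      rw [← zsmul_eq_mul, AddCircle.coe_zsmul, AddCircle.coe_period, smul_zero]
    rw [this, sub_zero]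
  · exact (AddCircle.norm_eq θ).symm

theorem cos_norm_coe (x : ℝ) : Real.cos ‖(x : AddCircle (2 * Real.pi))‖ = Real.cos x := by
  rw [AddCircle.norm_eq, Real.cos_abs, Real.cos_sub_int_mul_two_pi]

theorem norm_addCircle_le_pi (a : AddCircle (2 * Real.pi)) : ‖a‖ ≤ Real.pi := by
  have h := AddCircle.norm_le_half_period (p := 2 * Real.pi) (x := a) (by positivity)
  rwa [abs_of_pos (by positivity), mul_div_cancel_left₀ _ (by norm_num)] at h

/-- For total angle `2π` the angular distance never exceeds `π`, so the truncation in `coneDist` is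
void and the formula is the planar law of cosines. -/
theorem exists_flat_chart {X : Type*} [MetricSpace X] {p : X} (h : IsConePoint p (2 * Real.pi)) :
    ∃ ε > 0, ∃ e : Plane → X, e 0 = p ∧
      (∀ y ∈ Metric.ball (0 : Plane) ε, ∀ z ∈ Metric.ball (0 : Plane) ε,
        dist (e y) (e z) = dist y z) ∧
      ∀ x ∈ Metric.ball p ε, ∃ y ∈ Metric.ball (0 : Plane) ε, e y = x := by
  obtain ⟨_, ε, hε, ψ, h0, hd, hs⟩ := h
  choose arg harg using exists_polar
  refine ⟨ε, hε, fun y => ψ ‖y‖ (arg y : ℝ), by simp [h0], ?_, ?_⟩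
  · intro y hy z hz
    rw [mem_ball_zero_iff] at hy hz
    rw [hd _ ⟨norm_nonneg _, hy⟩ _ ⟨norm_nonneg _, hz⟩]
    conv_rhs => rw [harg y, harg z, dist_polar]
    rw [coneDist, min_eq_right (norm_addCircle_le_pi _), ← AddCircle.coe_sub, cos_norm_coe]
  · intro x hx
    obtain ⟨r, hr, a, rfl⟩ := hs x hx
    obtain ⟨α, rfl, -⟩ := exists_real_rep_abs_eq_norm a
    have hn := norm_polar hr.1 α
    refine ⟨polar r α, by rw [mem_ball_zero_iff, hn]; exact hr.2, ?_⟩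
    rw [← dist_eq_zero]
    simp only
    rw [hn, hd _ hr _ hr, coneDist, min_eq_right (norm_addCircle_le_pi _), ← AddCircle.coe_sub,
      cos_norm_coe]
    have h2 := harg (polar r α)
    rw [hn] at h2
    have h3 := dist_polar r (arg (polar r α)) r α
    rw [← h2, dist_self] at h3
    exact h3.symm

section Cone

variable {X : Type*} [MetricSpace X] {s : X} {θ ε : ℝ} {ψ : ℝ → AddCircle θ → X}

theorem dist_apex_of_polar (h0 : ∀ a, ψ 0 a = s)
    (hd : ∀ r ∈ Ico 0 ε, ∀ r' ∈ Ico 0 ε, ∀ a a', dist (ψ r a) (ψ r' a') = coneDist θ r a r' a')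
    {r : ℝ} (hr : r ∈ Ico 0 ε) (a : AddCircle θ) : dist (ψ r a) s = r := by
  rw [← h0 a, hd r hr 0 ⟨le_rfl, hr.1.trans_lt hr.2⟩, coneDist_zero_right hr.1]

/-- Completing the square, `r² + r'² - 2rr' cos κ = (r' - r cos κ)² + r² sin² κ`. This is used
backwards: a point near `ψ r a` has an angle close to `a`. -/
theorem coneDist_sq_ge {θ r r' κ : ℝ} {a a' : AddCircle θ} (hr : 0 ≤ r) (hr' : 0 ≤ r')
    (hκ0 : 0 ≤ κ) (hκ : κ ≤ Real.pi) (h : κ ≤ ‖a - a'‖) :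
    r * Real.sin κ ≤ coneDist θ r a r' a' := by
  apply Real.le_sqrt_of_sq_le
  have h1 : Real.cos (min Real.pi ‖a - a'‖) ≤ Real.cos κ :=
    Real.cos_le_cos_of_nonneg_of_le_pi hκ0 (min_le_left _ _) (le_min hκ h)
  have h2 := mul_le_mul_of_nonneg_left h1 (mul_nonneg hr hr')
  nlinarith [Real.sin_sq_add_cos_sq κ, sq_nonneg (r' - r * Real.cos κ)]

end Cone

/-- Near each point `s` the distance to `s` is, in local isometric coordinates, the distance to
the origin. -/
theorem exists_radial_chart {X : Type*} [MetricSpace X] {s : X} {θ : ℝ} (h : IsConePoint s θ) :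
    ∃ ε > 0, ∀ x ∈ Metric.ball s ε, x ≠ s → ∃ δ > 0, ∃ u : X → Plane,
      ∀ y ∈ Metric.ball x δ, ‖u y‖ = dist y s ∧
        ∀ z ∈ Metric.ball x δ, dist (u y) (u z) = dist y z := by
  obtain ⟨hθ, ε, hε, ψ, h0, hd, hs⟩ := h
  refine ⟨ε, hε, fun x hx hxs => ?_⟩
  obtain ⟨r, hr, a, rfl⟩ := hs x hx
  have hr0 : 0 < r := hr.1.lt_of_ne fun h => hxs (by rw [← h, h0])
  have hpi := Real.pi_pos
  -- Two angles within `κ` of `a` differ by at most `2κ`, hence by at most half the period `θ` and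
  -- at most `π`. So the angular distance is the absolute difference of real representatives and the
  -- truncation at `π` is inactive: the sector unrolls isometrically.
  set κ := min (θ / 4) (Real.pi / 2) with hκ
  have hκ0 : 0 < κ := by positivity
  have hκθ : κ ≤ θ / 4 := min_le_left _ _
  have hκpi : κ ≤ Real.pi / 2 := min_le_right _ _
  have hsin : 0 < Real.sin κ := Real.sin_pos_of_pos_of_lt_pi hκ0 (by linarith)
  have key : ∀ y ∈ Metric.ball (ψ r a) (min (ε - r) (r * Real.sin κ)),
      ∃ r' ∈ Ico 0 ε, ∃ α : ℝ, |α| ≤ κ ∧ y = ψ r' (a + α) := by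
    intro y hy
    have hy1 := (Metric.mem_ball.1 hy).trans_le (min_le_left _ _)
    have hy2 := (Metric.mem_ball.1 hy).trans_le (min_le_right _ _)
    have hra := dist_apex_of_polar h0 hd hr a
    obtain ⟨r', hr', a', rfl⟩ := hs y (by
      rw [Metric.mem_ball]
      linarith [dist_triangle y (ψ r a) s])
    obtain ⟨α, hα, hα'⟩ := exists_real_rep_abs_eq_norm (a' - a)
    refine ⟨r', hr', α, ?_, by rw [hα, add_sub_cancel]⟩
    by_contra! hlt
    rw [hα', norm_sub_rev] at hlt
    rw [dist_comm, hd r hr r' hr'] at hy2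
    exact absurd hy2 (not_lt.2 (coneDist_sq_ge hr.1 hr'.1 hκ0.le (by linarith) hlt.le))
  choose! R hR A hA hRA using key
  refine ⟨min (ε - r) (r * Real.sin κ), lt_min (by linarith [hr.2]) (by positivity),
    fun y => polar (R y) (A y), fun y hy => ⟨?_, fun z hz => ?_⟩⟩
  · rw [norm_polar (hR y hy).1]
    conv_rhs => rw [hRA y hy, dist_apex_of_polar h0 hd (hR y hy)]
  · conv_rhs => rw [hRA y hy, hRA z hz]
    rw [hd _ (hR y hy) _ (hR z hz), dist_polar, coneDist, add_sub_add_left_eq_sub,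
      ← AddCircle.coe_sub]
    have h1 : |A y - A z| ≤ 2 * κ :=
      (abs_sub _ _).trans (by linarith [hA y hy, hA z hz])
    rw [(AddCircle.norm_coe_eq_abs_iff θ hθ.ne').2 (by rw [abs_of_pos hθ]; linarith),
      min_eq_right (by linarith), Real.cos_abs]

/-- Near each point `s`, a point at given distance on a shortest path to `s` is unique. -/
theorem exists_unique_radial {X : Type*} [MetricSpace X] {s : X} {θ : ℝ} (h : IsConePoint s θ) :
    ∃ ε > 0, ∀ x ∈ Metric.ball s ε, ∀ y z, dist x y + dist y s = dist x s →
      dist x z + dist z s = dist x s → dist x y = dist x z → y = z := by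
  obtain ⟨hθ, ε, hε, ψ, h0, hd, hs⟩ := h
  refine ⟨ε, hε, fun x hx y z hy hz hyz => ?_⟩
  have hx' := Metric.mem_ball.1 hx
  obtain ⟨r, hr, a, rfl⟩ := hs x hx
  obtain ⟨r₁, hr₁, a₁, rfl⟩ := hs y (by
    rw [Metric.mem_ball]; linarith [dist_nonneg (x := ψ r a) (y := y)])
  obtain ⟨r₂, hr₂, a₂, rfl⟩ := hs z (by
    rw [Metric.mem_ball]; linarith [dist_nonneg (x := ψ r a) (y := z)])
  have e := dist_apex_of_polar h0 hd hr a
  have e₁ := dist_apex_of_polar h0 hd hr₁ a₁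
  have e₂ := dist_apex_of_polar h0 hd hr₂ a₂
  have h12 : r₁ = r₂ := by linarith
  subst h12
  rcases hr₁.1.eq_or_lt with h | hr₁0
  · rw [← h, h0, h0]
  have hr0 : 0 < r := by
    have := dist_nonneg (x := ψ r a) (y := ψ r₁ a₁)
    linarith
  have main : ∀ b, dist (ψ r a) (ψ r₁ b) = r - r₁ → a = b := by
    intro b hb
    have hle : 0 ≤ r - r₁ := hb ▸ dist_nonneg
    rw [hd r hr r₁ hr₁, coneDist] at hb
    set m := min Real.pi ‖a - b‖ with hm
    have hm0 : 0 ≤ m := le_min Real.pi_pos.le (norm_nonneg _)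
    have hrr : 0 < r * r₁ := mul_pos hr0 hr₁0
    have hQ : 0 ≤ r ^ 2 + r₁ ^ 2 - 2 * r * r₁ * Real.cos m := by
      nlinarith [Real.cos_le_one m, sq_nonneg (r - r₁)]
    have hsq := Real.sq_sqrt hQ
    rw [hb] at hsq
    have hc : Real.cos m = 1 := by
      apply mul_left_cancel₀ hrr.ne'
      linarith
    have hm1 : m = 0 :=
      Real.injOn_cos ⟨hm0, min_le_left _ _⟩ ⟨le_rfl, Real.pi_pos.le⟩ (by rw [hc, Real.cos_zero])
    have hn : ‖a - b‖ = 0 := by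
      by_contra hne
      exact (lt_min Real.pi_pos ((norm_nonneg _).lt_of_ne (Ne.symm hne))).ne' hm1
    exact sub_eq_zero.1 (norm_eq_zero.1 hn)
  rw [← main a₁ (by linarith), ← main a₂ (by linarith)]

/-! ### Local isometries of planar domains to the surface minus the marked points -/

section Dev

variable {X : Type*} [MetricSpace X] {S : Set X}

/-- `φ` is a local isometry of `D` to the surface minus `S`. -/
def Dev (S : Set X) (D : Set Plane) (φ : Plane → X) : Prop :=
  ∀ x ∈ D, φ x ∉ S ∧ IsometricNear D φ x

/-- `φ` preserves distances near `x`. -/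
def LocIso (φ : Plane → X) (x : Plane) : Prop :=
  ∃ ε > 0, ∀ y ∈ Metric.ball x ε, ∀ z ∈ Metric.ball x ε, dist (φ y) (φ z) = dist y z

theorem LocIso.continuousAt {φ : Plane → X} {x : Plane} (h : LocIso φ x) : ContinuousAt φ x := by
  obtain ⟨ε, hε, h⟩ := h
  rw [Metric.continuousAt_iff]
  refine fun η hη => ⟨min ε η, lt_min hε hη, fun y hy => ?_⟩
  rw [h y (hy.trans_le (min_le_left _ _)) x (Metric.mem_ball_self hε)]
  exact hy.trans_le (min_le_right _ _)

theorem LocIso.congr {φ φ' : Plane → X} {x : Plane} (h : LocIso φ x) (h' : φ =ᶠ[𝓝 x] φ') :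
    LocIso φ' x := by
  obtain ⟨ε, hε, h⟩ := h
  obtain ⟨η, hη, h'⟩ := Metric.eventually_nhds_iff_ball.1 h'
  refine ⟨min ε η, lt_min hε hη, fun y hy z hz => ?_⟩
  rw [← h' y (Metric.ball_subset_ball (min_le_right _ _) hy),
    ← h' z (Metric.ball_subset_ball (min_le_right _ _) hz)]
  exact h y (Metric.ball_subset_ball (min_le_left _ _) hy) z
    (Metric.ball_subset_ball (min_le_left _ _) hz)

theorem LocIso.comp {φ : Plane → X} (g : Plane ≃ᵃⁱ[ℝ] Plane) {x : Plane} (h : LocIso φ (g x)) :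
    LocIso (φ ∘ g) x := by
  obtain ⟨ε, hε, h⟩ := h
  refine ⟨ε, hε, fun y hy z hz => ?_⟩
  rw [Function.comp, Function.comp, h _ (by simpa using hy) _ (by simpa using hz), g.dist_map]

theorem LocIso.eventually {φ : Plane → X} {x : Plane} (h : LocIso φ x) :
    ∀ᶠ y in 𝓝 x, LocIso φ y := by
  obtain ⟨ε, hε, h⟩ := h
  filter_upwards [Metric.ball_mem_nhds x hε] with y hy
  obtain ⟨δ, hδ, hb⟩ := Metric.isOpen_iff.1 Metric.isOpen_ball y hy
  exact ⟨δ, hδ, fun z hz w hw => h z (hb hz) w (hb hw)⟩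

theorem IsometricNear.locIso {D : Set Plane} {φ : Plane → X} {x : Plane}
    (h : IsometricNear D φ x) (hD : D ∈ 𝓝 x) : LocIso φ x := by
  obtain ⟨ε, hε, h⟩ := h
  obtain ⟨η, hη, hD⟩ := Metric.mem_nhds_iff.1 hD
  refine ⟨min ε η, lt_min hε hη, fun y hy z hz => h y ⟨?_, ?_⟩ z ⟨?_, ?_⟩⟩
  · exact hD (Metric.ball_subset_ball (min_le_right _ _) hy)
  · exact Metric.ball_subset_ball (min_le_left _ _) hy
  · exact hD (Metric.ball_subset_ball (min_le_right _ _) hz)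
  · exact Metric.ball_subset_ball (min_le_left _ _) hz

theorem LocIso.isometricNear {φ : Plane → X} {x : Plane} (h : LocIso φ x) (D : Set Plane) :
    IsometricNear D φ x := by
  obtain ⟨ε, hε, h⟩ := h
  exact ⟨ε, hε, fun y hy z hz => h y hy.2 z hz.2⟩

theorem dev_iff {D : Set Plane} {φ : Plane → X} (hD : IsOpen D) :
    Dev S D φ ↔ ∀ x ∈ D, φ x ∉ S ∧ LocIso φ x :=
  ⟨fun h x hx => ⟨(h x hx).1, (h x hx).2.locIso (hD.mem_nhds hx)⟩,
    fun h x hx => ⟨(h x hx).1, (h x hx).2.isometricNear D⟩⟩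

theorem Dev.mono {D D' : Set Plane} {φ : Plane → X} (h : Dev S D φ) (hD : D' ⊆ D) :
    Dev S D' φ := fun x hx => ⟨(h x (hD hx)).1, by
  obtain ⟨ε, hε, h'⟩ := (h x (hD hx)).2
  exact ⟨ε, hε, fun y hy z hz => h' y ⟨hD hy.1, hy.2⟩ z ⟨hD hz.1, hz.2⟩⟩⟩

theorem Dev.locIso {D : Set Plane} {φ : Plane → X} (h : Dev S D φ) (hD : IsOpen D) {x : Plane}
    (hx : x ∈ D) : LocIso φ x := ((dev_iff hD).1 h x hx).2

theorem Dev.congr {D : Set Plane} {φ φ' : Plane → X} (h : Dev S D φ) (hD : IsOpen D)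
    (h' : EqOn φ φ' D) : Dev S D φ' := (dev_iff hD).2 fun x hx =>
  ⟨h' hx ▸ (h x hx).1, (h.locIso hD hx).congr (h'.eventuallyEq_of_mem (hD.mem_nhds hx))⟩

theorem Dev.comp {D : Set Plane} {φ : Plane → X} (h : Dev S D φ) (hD : IsOpen D)
    (g : Plane ≃ᵃⁱ[ℝ] Plane) : Dev S (g ⁻¹' D) (φ ∘ g) :=
  (dev_iff (hD.preimage g.continuous)).2 fun x hx =>
    ⟨(h (g x) hx).1, (h.locIso hD (x := g x) hx).comp g⟩

/-- `e` identifies the disc of radius `ε` around the origin with the ball of radius `ε` around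
`p`. -/
structure IsFlatChart (p : X) (ε : ℝ) (e : Plane → X) : Prop where
  pos : 0 < ε
  map_zero : e 0 = p
  dist_eq : ∀ y ∈ Metric.ball (0 : Plane) ε, ∀ z ∈ Metric.ball (0 : Plane) ε,
    dist (e y) (e z) = dist y z
  surj : ∀ x ∈ Metric.ball p ε, ∃ y ∈ Metric.ball (0 : Plane) ε, e y = x

theorem IsFlatChart.mono {p : X} {ε ε' : ℝ} {e : Plane → X} (h : IsFlatChart p ε e)
    (h0 : 0 < ε') (hε : ε' ≤ ε) : IsFlatChart p ε' e where
  pos := h0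
  map_zero := h.map_zero
  dist_eq y hy z hz := h.dist_eq y (Metric.ball_subset_ball hε hy) z
    (Metric.ball_subset_ball hε hz)
  surj x hx := by
    obtain ⟨y, hy, rfl⟩ := h.surj x (Metric.ball_subset_ball hε hx)
    refine ⟨y, ?_, rfl⟩
    rwa [Metric.mem_ball, ← h.dist_eq y hy 0 (Metric.mem_ball_self h.pos), h.map_zero]

theorem IsFlatChart.dist_center {p : X} {ε : ℝ} {e : Plane → X} (h : IsFlatChart p ε e)
    {y : Plane} (hy : y ∈ Metric.ball 0 ε) : dist (e y) p = ‖y‖ := by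
  rw [← h.map_zero, h.dist_eq y hy 0 (Metric.mem_ball_self h.pos), dist_zero_right]

theorem IsMarkedSurface.exists_flatChart (hS : IsMarkedSurface S) {p : X} (hp : p ∉ S) :
    ∃ ε e, IsFlatChart p ε e ∧ ∀ y ∈ Metric.ball (0 : Plane) ε, e y ∉ S := by
  obtain ⟨ε, hε, e, h0, h1, h2⟩ := exists_flat_chart (hS.regular p hp)
  have he : IsFlatChart p ε e := ⟨hε, h0, h1, h2⟩
  obtain ⟨δ, hδ, hb⟩ := Metric.isOpen_iff.1 hS.finite.isClosed.isOpen_compl p hp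
  have hm := he.mono (lt_min hε hδ) (min_le_left ε δ)
  refine ⟨min ε δ, e, hm, fun y hy => hb ?_⟩
  rw [Metric.mem_ball, hm.dist_center hy]
  exact (mem_ball_zero_iff.1 hy).trans_le (min_le_right _ _)

theorem IsFlatChart.locIso {p : X} {ε : ℝ} {e : Plane → X} (h : IsFlatChart p ε e) {y : Plane}
    (hy : y ∈ Metric.ball 0 ε) : LocIso e y := by
  obtain ⟨δ, hδ, hb⟩ := Metric.isOpen_iff.1 Metric.isOpen_ball y hy
  exact ⟨δ, hδ, fun z hz w hw => h.dist_eq z (hb hz) w (hb hw)⟩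

/-- Lifting `φ` through the chart gives a distance preserving map from a small disc to the plane,
which is the restriction of an isometry. -/
theorem IsFlatChart.exists_eventuallyEq {p : X} {ε : ℝ} {e : Plane → X} (h : IsFlatChart p ε e)
    {φ : Plane → X} {x y : Plane} (hφ : LocIso φ x) (hy : y ∈ Metric.ball 0 ε)
    (hxy : φ x = e y) : ∃ g : Plane ≃ᵃⁱ[ℝ] Plane, g x = y ∧ ∀ᶠ z in 𝓝 x, φ z = e (g z) := by
  obtain ⟨δ, hδ, hφ⟩ := hφ
  have h0 : (0 : Plane) ∈ Metric.ball 0 ε := Metric.mem_ball_self h.pos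
  have hy' : ‖y‖ < ε := by simpa using hy
  set η := min δ (ε - ‖y‖) with hη
  have hη0 : 0 < η := lt_min hδ (by linarith)
  have hsub : Metric.ball x η ⊆ Metric.ball x δ := Metric.ball_subset_ball (min_le_left _ _)
  have hmem : ∀ z ∈ Metric.ball x η, φ z ∈ Metric.ball p ε := by
    intro z hz
    have h1 : dist (φ z) (φ x) < ε - ‖y‖ := by
      rw [hφ z (hsub hz) x (Metric.mem_ball_self hδ)]
      exact (Metric.mem_ball.1 hz).trans_le (min_le_right _ _)
    have h2 : dist (e y) p = ‖y‖ := by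
      rw [← h.map_zero, h.dist_eq y hy 0 h0, dist_zero_right]
    rw [Metric.mem_ball]
    have := dist_triangle (φ z) (φ x) p
    rw [hxy, h2, ← hxy] at this
    linarith
  choose! F hF hFe using fun z hz => h.surj (φ z) (hmem z hz)
  obtain ⟨g, hg⟩ := exists_affineIsometryEquiv_eqOn_ball (f := F) hη0 fun z hz w hw => by
    rw [← h.dist_eq _ (hF z hz) _ (hF w hw), hFe z hz, hFe w hw, hφ z (hsub hz) w (hsub hw)]
  have hx : x ∈ Metric.ball x η := Metric.mem_ball_self hη0
  refine ⟨g, ?_, ?_⟩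
  · rw [← hg hx, ← dist_eq_zero, ← h.dist_eq _ (hF x hx) _ hy, hFe x hx, hxy, dist_self]
  · filter_upwards [Metric.ball_mem_nhds x hη0] with z hz
    rw [← hg hz, hFe z hz]

/-- Two local isometries with a common value differ locally by an isometry of the plane. -/
theorem IsMarkedSurface.exists_transition (hS : IsMarkedSurface S) {φ φ' : Plane → X}
    {x x' : Plane} (hφ : LocIso φ x) (hφ' : LocIso φ' x') (hxx' : φ x = φ' x') (hx : φ x ∉ S) :
    ∃ g : Plane ≃ᵃⁱ[ℝ] Plane, g x = x' ∧ ∀ᶠ z in 𝓝 x, φ z = φ' (g z) := by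
  obtain ⟨ε, e, he, -⟩ := hS.exists_flatChart hx
  have h0 : (0 : Plane) ∈ Metric.ball 0 ε := Metric.mem_ball_self he.pos
  obtain ⟨g, hg, hge⟩ := he.exists_eventuallyEq hφ h0 he.map_zero.symm
  obtain ⟨g', hg', hge'⟩ := he.exists_eventuallyEq hφ' h0 (by rw [he.map_zero, hxx'])
  refine ⟨g.trans g'.symm, by simp [hg, ← hg'], ?_⟩
  have hc : Tendsto (g.trans g'.symm) (𝓝 x) (𝓝 x') := by
    have := (g.trans g'.symm).continuous.tendsto x
    simpa [hg, ← hg'] using this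
  filter_upwards [hge, hc.eventually hge'] with z hz hz'
  rw [hz, hz']
  simp

/-- Rigidity: `φ` is injective near `x`, so `φ ∘ g = φ` near a single point close to the fixed point
`x` forces `g` to be the identity on an open set, hence everywhere. -/
theorem LocIso.eventuallyEq_id {φ : Plane → X} {x : Plane} (h : LocIso φ x)
    {g : Plane ≃ᵃⁱ[ℝ] Plane} (hgx : g x = x) (hg : ∃ᶠ a in 𝓝 x, ∀ᶠ z in 𝓝 a, φ (g z) = φ z) :
    ∀ z, g z = z := by
  obtain ⟨ε, hε, h⟩ := h
  have hb : ∀ᶠ a in 𝓝 x, ∀ᶠ z in 𝓝 a, z ∈ Metric.ball x ε ∧ g z ∈ Metric.ball x ε := by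
    rw [eventually_eventually_nhds]
    have hc : Tendsto g (𝓝 x) (𝓝 x) := by simpa [hgx] using g.continuous.tendsto x
    exact Filter.Eventually.and (Metric.ball_mem_nhds x hε) (hc (Metric.ball_mem_nhds x hε))
  obtain ⟨a, ha, hb⟩ := (hg.and_eventually hb).exists
  have : g = AffineIsometryEquiv.refl ℝ Plane := by
    apply affineIsometryEquiv_eq_of_eventuallyEq (x := a)
    filter_upwards [ha, hb] with z hz hz'
    rw [AffineIsometryEquiv.coe_refl, id, ← dist_eq_zero, ← h _ hz'.2 _ hz'.1, hz, dist_self]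
  intro z
  rw [this, AffineIsometryEquiv.coe_refl, id]

/-- The identity theorem for developments. The set where the germs agree is open; at a limit point
of it in `D`, the transition isometry fixes the point and is trivial by rigidity, so the set is also
closed in `D`. -/
theorem IsMarkedSurface.eqOn_of_dev (hS : IsMarkedSurface S) {D : Set Plane} (hD : IsOpen D)
    (hDc : IsPreconnected D) {φ φ' : Plane → X} (h : Dev S D φ) (h' : Dev S D φ') {x : Plane}
    (hx : x ∈ D) (hxe : φ =ᶠ[𝓝 x] φ') : EqOn φ φ' D := by
  have hsub : D ⊆ {z | φ =ᶠ[𝓝 z] φ'} := by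
    refine hDc.subset_of_closure_inter_subset isOpen_setOfPred_eventually_nhds ⟨x, hx, hxe⟩ ?_
    rintro z ⟨hz, hzD⟩
    have hf : ∃ᶠ a in 𝓝 z, φ =ᶠ[𝓝 a] φ' := mem_closure_iff_frequently.1 hz
    have hzz : φ z = φ' z := tendsto_nhds_unique_of_frequently_eq (h.locIso hD hzD).continuousAt
      (h'.locIso hD hzD).continuousAt (hf.mono fun a ha => ha.self_of_nhds)
    obtain ⟨g, hgz, hg⟩ := hS.exists_transition (h.locIso hD hzD) (h'.locIso hD hzD) hzz
      (h z hzD).1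
    have hid := (h'.locIso hD hzD).eventuallyEq_id hgz
      ((hf.and_eventually (eventually_eventually_nhds.2 hg)).mono fun a ha => by
        filter_upwards [ha.1, ha.2] with w hw hw'
        rw [← hw', hw])
    exact hg.mono fun w hw => by rw [hw, hid]
  exact fun z hz => (hsub hz).self_of_nhds

/-- A curve which is locally `L`-Lipschitz is `L`-Lipschitz. -/
theorem dist_le_of_locally_dist_le {c : ℝ → X} {a b L : ℝ} (hab : a ≤ b)
    (h : ∀ t ∈ Icc a b, ∃ ε > 0, ∀ t' ∈ Icc a b, |t' - t| < ε → dist (c t') (c t) ≤ L * |t' - t|) :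
    dist (c b) (c a) ≤ L * (b - a) := by
  have hc : ContinuousOn c (Icc a b) := by
    intro t ht
    obtain ⟨ε, hε, h⟩ := h t ht
    rw [ContinuousWithinAt, tendsto_iff_dist_tendsto_zero]
    have h0 : Tendsto (fun t' => L * |t' - t|) (𝓝[Icc a b] t) (𝓝 0) := by
      have : ContinuousAt (fun t' => L * |t' - t|) t := by fun_prop
      have := this.tendsto.mono_left (nhdsWithin_le_nhds (s := Icc a b))
      simpa using this
    refine squeeze_zero' (Eventually.of_forall fun _ => dist_nonneg) ?_ h0
    filter_upwards [self_mem_nhdsWithin, nhdsWithin_le_nhds (Metric.ball_mem_nhds t hε)] with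
      t' ht' hb
    exact h t' ht' hb
  have hcl : IsClosed ({t | dist (c t) (c a) ≤ L * (t - a)} ∩ Icc a b) := by
    have h1 : ContinuousOn (fun t => dist (c t) (c a)) (Icc a b) :=
      fun t ht =>
      Filter.Tendsto.dist (hc t ht) tendsto_const_nhds
    have h2 : ContinuousOn (fun t => L * (t - a)) (Icc a b) := by fun_prop
    rw [inter_comm]
    exact isClosed_Icc.isClosed_le h1 h2
  -- Continuous induction: the set of times satisfying the bound is closed, and the local estimate
  -- pushes it to the right.
  refine (hcl.Icc_subset_of_forall_mem_nhdsWithin (by simp) fun t ht => ?_) ⟨hab, le_rfl⟩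
  obtain ⟨ε, hε, h⟩ := h t ⟨ht.2.1, ht.2.2.le⟩
  have hm : Ioo t (min b (t + ε)) ∈ 𝓝[>] t :=
    Ioo_mem_nhdsGT (lt_min ht.2.2 (by linarith))
  filter_upwards [hm] with t' ht'
  have hb : t' < b := ht'.2.trans_le (min_le_left _ _)
  have he : t' < t + ε := ht'.2.trans_le (min_le_right _ _)
  have h1 := h t' ⟨ht.2.1.trans ht'.1.le, hb.le⟩ (by
    rw [abs_of_pos (by linarith [ht'.1])]; linarith)
  rw [abs_of_pos (by linarith [ht'.1])] at h1
  have h2 : dist (c t) (c a) ≤ L * (t - a) := ht.1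
  have := dist_triangle (c t') (c t) (c a)
  change dist (c t') (c a) ≤ L * (t' - a)
  linarith

theorem Dev.dist_le {D : Set Plane} {φ : Plane → X} (h : Dev S D φ) {x y : Plane}
    (hxy : segment ℝ x y ⊆ D) : dist (φ x) (φ y) ≤ dist x y := by
  have hmem : ∀ t ∈ Icc (0 : ℝ) 1, AffineMap.lineMap x y t ∈ D := fun t ht =>
    hxy (segment_eq_image_lineMap ℝ x y ▸ mem_image_of_mem _ ht)
  have := dist_le_of_locally_dist_le (c := fun t => φ (AffineMap.lineMap x y t)) (L := dist x y)
    zero_le_one fun t ht => by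
      obtain ⟨ε, hε, h1⟩ := (h _ (hmem t ht)).2
      refine ⟨ε / (dist x y + 1), by positivity, fun t' ht' htt' => ?_⟩
      have e1 : dist (AffineMap.lineMap x y t') (AffineMap.lineMap x y t) =
          dist x y * |t' - t| := by
        rw [dist_lineMap_lineMap, Real.dist_eq, mul_comm]
      have hlt : dist x y * |t' - t| < ε := by
        rw [lt_div_iff₀ (by positivity)] at htt'
        nlinarith [abs_nonneg (t' - t)]
      rw [h1 _ ⟨hmem t' ht', by rw [Metric.mem_ball, e1]; exact hlt⟩ _
        ⟨hmem t ht, Metric.mem_ball_self hε⟩, e1]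
  simpa [dist_comm] using this

theorem Dev.lipschitzOnWith {D : Set Plane} {φ : Plane → X} (h : Dev S D φ) (hD : Convex ℝ D) :
    LipschitzOnWith 1 φ D := LipschitzOnWith.of_dist_le_mul fun x hx y hy => by
  simpa using h.dist_le (hD.segment_subset hx hy)

/-- On a convex domain a development is 1-Lipschitz, so completeness of the target extends it to the
closure. -/
theorem Dev.continuousOn_extendFrom [CompleteSpace X] {D : Set Plane} {φ : Plane → X}
    (h : Dev S D φ) (hD : Convex ℝ D) : ContinuousOn (extendFrom D φ) (closure D) := by
  refine _root_.continuousOn_extendFrom le_rfl fun x hx => ?_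
  have := mem_closure_iff_nhdsWithin_neBot.1 hx
  exact cauchy_map_iff_exists_tendsto.1 (cauchy_nhds.mono nhdsWithin_le_nhds |>.map_of_le
    (h.lipschitzOnWith hD).uniformContinuousOn inf_le_right)

theorem Dev.eqOn_extendFrom {D : Set Plane} {φ : Plane → X} (h : Dev S D φ) (hD : IsOpen D) :
    EqOn (extendFrom D φ) φ D := fun _ hx =>
  extendFrom_eq (subset_closure hx) (h.locIso hD hx).continuousAt.continuousWithinAt

/-- Two developments which agree near one point agree on the intersection of the closures of
their convex domains. -/
theorem IsMarkedSurface.eq_of_dev_closure (hS : IsMarkedSurface S) {D D' : Set Plane}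
    (hD : IsOpen D) (hD' : IsOpen D') (hDc : Convex ℝ D) (hDc' : Convex ℝ D') {φ φ' : Plane → X}
    (h : Dev S D φ) (h' : Dev S D' φ') (hc : ContinuousOn φ (closure D))
    (hc' : ContinuousOn φ' (closure D')) {g : Plane ≃ᵃⁱ[ℝ] Plane} {x : Plane} (hx : x ∈ D)
    (hgx : g x ∈ D') (hxe : ∀ᶠ z in 𝓝 x, φ z = φ' (g z)) {v : Plane} (hv : v ∈ closure D)
    (hgv : g v ∈ closure D') : φ v = φ' (g v) := by
  have hDg : IsOpen (g ⁻¹' D') := hD'.preimage g.continuous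
  have hcg : Convex ℝ (g ⁻¹' D') := hDc'.affine_preimage g.toAffineEquiv.toAffineMap
  have hagree : EqOn φ (φ' ∘ g) (D ∩ g ⁻¹' D') :=
    hS.eqOn_of_dev (hD.inter hDg) (hDc.inter hcg).isPreconnected (h.mono inter_subset_left)
      ((h'.comp hD' g).mono inter_subset_right) ⟨hx, hgx⟩ hxe
  have hvcl : v ∈ closure (g ⁻¹' D') := by
    have := g.toHomeomorph.preimage_closure D'
    rw [AffineIsometryEquiv.coe_toHomeomorph] at this
    rw [← this]
    exact hgv
  -- The open segment from the boundary point `v` to the common interior point `x` stays in both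
  -- domains, where the maps agree; letting it tend to `v` gives the claim.
  have hseg : ∀ t ∈ Ioo (0 : ℝ) 1, AffineMap.lineMap v x t ∈ D ∩ g ⁻¹' D' := by
    intro t ht
    have hos : AffineMap.lineMap v x t ∈ openSegment ℝ v x := by
      rw [openSegment_eq_image_lineMap]
      exact mem_image_of_mem _ ht
    constructor
    · have := hDc.openSegment_closure_interior_subset_interior hv (hD.interior_eq.symm ▸ hx) hos
      rwa [hD.interior_eq] at this
    · have := hcg.openSegment_closure_interior_subset_interior hvcl
        (hDg.interior_eq.symm ▸ hgx) hos
      rwa [hDg.interior_eq] at this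
  have hlim : Tendsto (fun t : ℝ => AffineMap.lineMap v x t) (𝓝[>] 0) (𝓝 v) := by
    have hc : ContinuousAt (fun t : ℝ => AffineMap.lineMap v x t) 0 := by fun_prop
    simpa using hc.tendsto.mono_left (nhdsWithin_le_nhds (s := Ioi 0))
  have hev : ∀ᶠ t : ℝ in 𝓝[>] 0, AffineMap.lineMap v x t ∈ D ∩ g ⁻¹' D' := by
    filter_upwards [Ioo_mem_nhdsGT zero_lt_one] with t ht using hseg t ht
  have l1 : Tendsto (fun t : ℝ => φ (AffineMap.lineMap v x t)) (𝓝[>] 0) (𝓝 (φ v)) :=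
    (hc v hv).tendsto.comp (tendsto_nhdsWithin_iff.2 ⟨hlim, hev.mono fun t ht =>
      subset_closure ht.1⟩)
  have l2 : Tendsto (fun t : ℝ => φ' (g (AffineMap.lineMap v x t))) (𝓝[>] 0) (𝓝 (φ' (g v))) :=
    (hc' _ hgv).tendsto.comp (tendsto_nhdsWithin_iff.2 ⟨(g.continuous.tendsto v).comp hlim,
      hev.mono fun t ht => subset_closure ht.2⟩)
  exact tendsto_nhds_unique (l1.congr' (hev.mono fun t ht => hagree ht)) l2

end Dev

/-! ### The exponential map -/

section DevDomain

variable {X : Type*} [MetricSpace X] {S : Set X} {e : Plane → X}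

/-- The points `y` such that the local isometry `e` near the origin extends along the segment
from the origin to `y`. -/
def devDomain (S : Set X) (e : Plane → X) : Set Plane :=
  {y | ∃ U φ, IsOpen U ∧ Convex ℝ U ∧ 0 ∈ U ∧ y ∈ U ∧ Dev S U φ ∧ φ =ᶠ[𝓝 0] e}

open Classical in
/-- The extension of the local isometry `e` along segments from the origin. -/
def devMap (S : Set X) (e : Plane → X) (y : Plane) : X :=
  if h : y ∈ devDomain S e then h.choose_spec.choose y else e 0

/-- The endpoints of the segments from the origin along which `e` extends up to a marked point. -/
def visible (S : Set X) (e : Plane → X) : Set Plane :=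
  {z | z ∉ devDomain S e ∧ ∀ t ∈ Ico (0 : ℝ) 1, t • z ∈ devDomain S e}

/-- The value chosen in `devMap` does not depend on the choice: two convex domains around the origin
meet in a convex, hence connected, set. -/
theorem IsMarkedSurface.eqOn_devMap (hS : IsMarkedSurface S) {U : Set Plane} {φ : Plane → X}
    (hU : IsOpen U) (hUc : Convex ℝ U) (h0 : 0 ∈ U) (hφ : Dev S U φ) (he : φ =ᶠ[𝓝 0] e) :
    EqOn (devMap S e) φ U := by
  intro y hy
  have h : y ∈ devDomain S e := ⟨U, φ, hU, hUc, h0, hy, hφ, he⟩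
  rw [devMap, dif_pos h]
  obtain ⟨hU', hUc', h0', hy', hφ', he'⟩ := h.choose_spec.choose_spec
  exact hS.eqOn_of_dev (hU'.inter hU) (hUc'.inter hUc).isPreconnected
    (hφ'.mono inter_subset_left) (hφ.mono inter_subset_right) ⟨h0', h0⟩ (he'.trans he.symm)
    ⟨hy', hy⟩

theorem isOpen_devDomain : IsOpen (devDomain S e) := by
  rw [isOpen_iff_mem_nhds]
  rintro y ⟨U, φ, hU, hUc, h0, hy, hφ, he⟩
  filter_upwards [hU.mem_nhds hy] with z hz using ⟨U, φ, hU, hUc, h0, hz, hφ, he⟩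

theorem IsMarkedSurface.dev_devMap (hS : IsMarkedSurface S) :
    Dev S (devDomain S e) (devMap S e) := by
  rw [dev_iff isOpen_devDomain]
  rintro y ⟨U, φ, hU, hUc, h0, hy, hφ, he⟩
  have := hS.eqOn_devMap hU hUc h0 hφ he
  rw [this hy]
  exact ⟨(hφ y hy).1, (hφ.locIso hU hy).congr
    (this.symm.eventuallyEq_of_mem (hU.mem_nhds hy))⟩

theorem IsMarkedSurface.exists_dev_ball (hS : IsMarkedSurface S) {φ : Plane → X} {x : Plane}
    (he : LocIso φ x) (hx : φ x ∉ S) : ∃ δ > 0, Dev S (Metric.ball x δ) φ := by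
  have h := he.eventually.and (he.continuousAt.eventually (hS.finite.isClosed.isOpen_compl.mem_nhds
    hx))
  obtain ⟨δ, hδ, h⟩ := Metric.eventually_nhds_iff_ball.1 h
  exact ⟨δ, hδ, (dev_iff Metric.isOpen_ball).2 fun y hy => ⟨(h y hy).2, (h y hy).1⟩⟩

theorem IsMarkedSurface.zero_mem_devDomain (hS : IsMarkedSurface S) (he : LocIso e 0)
    (h0 : e 0 ∉ S) : 0 ∈ devDomain S e := by
  obtain ⟨δ, hδ, h⟩ := hS.exists_dev_ball he h0
  have hm : (0 : Plane) ∈ Metric.ball (0 : Plane) δ := Metric.mem_ball_self hδ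
  exact ⟨_, e, Metric.isOpen_ball, convex_ball _ _, hm, hm, h, EventuallyEq.rfl⟩

theorem IsMarkedSurface.devMap_eventuallyEq (hS : IsMarkedSurface S) (he : LocIso e 0)
    (h0 : e 0 ∉ S) : devMap S e =ᶠ[𝓝 0] e := by
  obtain ⟨δ, hδ, h⟩ := hS.exists_dev_ball he h0
  have hm : (0 : Plane) ∈ Metric.ball (0 : Plane) δ := Metric.mem_ball_self hδ
  exact (hS.eqOn_devMap Metric.isOpen_ball (convex_ball _ _) hm h
    EventuallyEq.rfl).eventuallyEq_of_mem (Metric.ball_mem_nhds 0 hδ)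

theorem exists_smul_mem_visible {y : Plane} (h0 : 0 ∈ devDomain S e) (hy : y ∉ devDomain S e) :
    ∃ t ∈ Ioc (0 : ℝ) 1, t • y ∈ visible S e := by
  have hc : IsCompact (Icc (0 : ℝ) 1 ∩ (fun t : ℝ => t • y) ⁻¹' (devDomain S e)ᶜ) :=
    isCompact_Icc.inter_right (isOpen_devDomain.isClosed_compl.preimage (by fun_prop))
  obtain ⟨T, ⟨hT, hTy⟩, hmin⟩ := hc.exists_isLeast ⟨1, by simp, by simpa using hy⟩
  have hT0 : T ≠ 0 := by
    rintro rfl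
    simp [h0] at hTy
  refine ⟨T, ⟨hT.1.lt_of_ne hT0.symm, hT.2⟩, hTy, fun t ht => ?_⟩
  by_contra h
  rw [smul_smul] at h
  have hTpos : 0 < T := hT.1.lt_of_ne hT0.symm
  have := hmin ⟨⟨mul_nonneg ht.1 hT.1, by nlinarith [ht.2, hT.2, ht.1]⟩, h⟩
  nlinarith [ht.2]

theorem zero_notMem_visible (h0 : 0 ∈ devDomain S e) : 0 ∉ visible S e := fun h => h.1 h0

/-- A ray leaving `devDomain` does so at a first point, which is visible. This is how a disc is
recognised as empty: it suffices to keep visible endpoints out of it. -/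
theorem subset_devDomain_of_disjoint {D : Set Plane} (h0 : 0 ∈ devDomain S e) (hD : Convex ℝ D)
    (hD0 : 0 ∈ D) (h : ∀ z ∈ visible S e, z ∉ D) : D ⊆ devDomain S e := by
  intro y hy
  by_contra hy'
  obtain ⟨t, ht, htz⟩ := exists_smul_mem_visible h0 hy'
  exact h _ htz (hD.smul_mem_of_zero_mem hD0 hy ⟨ht.1.le, ht.2⟩)

theorem IsMarkedSurface.dist_devMap_smul_le (hS : IsMarkedSurface S) {z : Plane}
    (hz : z ∈ visible S e) {t t' : ℝ} (ht : t ∈ Ico (0 : ℝ) 1) (ht' : t' ∈ Ico (0 : ℝ) 1) :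
    dist (devMap S e (t • z)) (devMap S e (t' • z)) ≤ |t - t'| * ‖z‖ := by
  refine (hS.dev_devMap.dist_le ?_).trans_eq ?_
  · have hc : Convex ℝ ((fun t : ℝ => t • z) '' Ico (0 : ℝ) 1) :=
      (convex_Ico 0 1).is_linear_image (IsLinearMap.isLinearMap_smul' z)
    refine (hc.segment_subset (mem_image_of_mem _ ht) (mem_image_of_mem _ ht')).trans ?_
    rintro _ ⟨u, hu, rfl⟩
    exact hz.2 u hu
  · rw [dist_eq_norm, ← sub_smul, norm_smul, Real.norm_eq_abs]

/-- The developed half-open ray is Lipschitz, so it has a limit. If the limit were off `S`, a flat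
chart around it could be glued to the development and would extend it across `z`. -/
theorem IsMarkedSurface.exists_tendsto_of_mem_visible (hS : IsMarkedSurface S) {z : Plane}
    (h0 : 0 ∈ devDomain S e) (hz : z ∈ visible S e) :
    ∃ s ∈ S, Tendsto (fun t : ℝ => devMap S e (t • z)) (𝓝[<] 1) (𝓝 s) := by
  have := hS.compact
  have hz0 : z ≠ 0 := by
    rintro rfl
    exact zero_notMem_visible h0 hz
  have hzn : 0 < ‖z‖ := norm_pos_iff.2 hz0
  have hlip : LipschitzOnWith ‖z‖₊ (fun t : ℝ => devMap S e (t • z)) (Ico 0 1) :=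
    LipschitzOnWith.of_dist_le_mul fun t ht t' ht' => by
      rw [coe_nnnorm, Real.dist_eq, mul_comm]
      exact hS.dist_devMap_smul_le hz ht ht'
  have hIco : Ico (0 : ℝ) 1 ∈ 𝓝[<] 1 := Ico_mem_nhdsLT zero_lt_one
  obtain ⟨q, hq⟩ := cauchy_map_iff_exists_tendsto.1 ((cauchy_nhds (a := (1 : ℝ))).mono
    (nhdsWithin_le_nhds (s := Iio 1)) |>.map_of_le hlip.uniformContinuousOn
      (le_principal_iff.2 hIco))
  refine ⟨q, ?_, hq⟩
  by_contra hqS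
  obtain ⟨ε, E, hE, hES⟩ := hS.exists_flatChart hqS
  have hε := hE.pos
  obtain ⟨t₀, ht₀, hdt, hzt⟩ : ∃ t₀ ∈ Ico (0 : ℝ) 1, dist (devMap S e (t₀ • z)) q < ε / 4 ∧
      (1 - t₀) * ‖z‖ < ε / 4 := by
    have h2 : Tendsto (fun t : ℝ => (1 - t) * ‖z‖) (𝓝[<] 1) (𝓝 0) := by
      have : ContinuousAt (fun t : ℝ => (1 - t) * ‖z‖) 1 := by fun_prop
      simpa using this.tendsto.mono_left (nhdsWithin_le_nhds (s := Iio 1))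
    have h3 := (hIco : ∀ᶠ t in 𝓝[<] (1 : ℝ), t ∈ Ico (0 : ℝ) 1)
    exact (Filter.Eventually.and h3 (Filter.Eventually.and (hq (Metric.ball_mem_nhds q (by positivity : 0 < ε / 4)))
      (h2.eventually_lt_const (by positivity : 0 < ε / 4)))).exists
  obtain ⟨U, φ, hU, hUc, hU0, hyU, hφ, hφe⟩ := hz.2 t₀ ht₀
  have hφD := hS.eqOn_devMap hU hUc hU0 hφ hφe
  set y := t₀ • z with hy
  obtain ⟨w, hw, hwy⟩ := hE.surj (φ y) (by
    rw [← hφD hyU, Metric.mem_ball]; linarith)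
  have hwn : ‖w‖ < ε / 4 := by rwa [← hE.dist_center hw, hwy, ← hφD hyU]
  obtain ⟨g, hgy, hg⟩ := hE.exists_eventuallyEq (hφ.locIso hU hyU) hw hwy.symm
  set B := Metric.ball y (ε / 2) with hB
  have hBE : Dev S B (E ∘ g) := by
    have : Dev S (Metric.ball 0 ε) E :=
      (dev_iff Metric.isOpen_ball).2 fun x hx => ⟨hES x hx, hE.locIso hx⟩
    refine (this.comp Metric.isOpen_ball g).mono fun x hx => ?_
    rw [mem_preimage, mem_ball_zero_iff]
    have h1 : ‖g x - w‖ < ε / 2 := by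
      rw [← dist_eq_norm, ← hgy, g.dist_map]; exact hx
    have := norm_sub_norm_le (g x) w
    linarith
  have hyB : y ∈ B := Metric.mem_ball_self (by positivity)
  have hagree : EqOn φ (E ∘ g) (U ∩ B) :=
    hS.eqOn_of_dev (hU.inter Metric.isOpen_ball) (hUc.inter (convex_ball _ _)).isPreconnected
      (hφ.mono inter_subset_left) (hBE.mono inter_subset_right) ⟨hyU, hyB⟩ hg
  have hsc : IsCompact (segment ℝ 0 y) := by
    rw [segment_eq_image_lineMap]
    exact isCompact_Icc.image (by fun_prop)
  obtain ⟨δ, hδ, hδU⟩ := hsc.exists_thickening_subset_open hU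
    (hUc.segment_subset hU0 hyU)
  -- A convex neighbourhood of the whole segment. Near the part up to `t₀` it lies in `U`; beyond,
  -- its points are within `ε / 4` of a point of the segment that is itself within `ε / 4` of `y`,
  -- hence in `B`.
  set V := Metric.thickening (min δ (ε / 4)) (segment ℝ 0 z) with hV
  have hV0 : 0 < min δ (ε / 4) := lt_min hδ (by positivity)
  have hVU : V ⊆ U ∪ B := by
    intro x hx
    obtain ⟨x', hx', hxx'⟩ := Metric.mem_thickening_iff.1 hx
    rw [segment_eq_image] at hx'
    obtain ⟨t, ht, rfl⟩ := hx'
    simp only [smul_zero, zero_add] at hxx'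
    rcases le_or_gt t t₀ with htt | htt
    · refine Or.inl (hδU (Metric.mem_thickening_iff.2 ⟨t • z, ?_,
        hxx'.trans_le (min_le_left _ _)⟩))
      rw [segment_eq_image]
      rcases ht₀.1.eq_or_lt with h | h
      · refine ⟨0, by simp, ?_⟩
        simp [le_antisymm (htt.trans h.symm.le) ht.1]
      · refine ⟨t / t₀, ⟨div_nonneg ht.1 h.le, (div_le_one h).2 htt⟩, ?_⟩
        simp only [smul_zero, zero_add, hy, smul_smul]
        rw [div_mul_cancel₀ _ h.ne']
    · refine Or.inr ?_
      have h1 : dist (t • z) y = (t - t₀) * ‖z‖ := by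
        rw [hy, dist_eq_norm, ← sub_smul, norm_smul, Real.norm_of_nonneg (by linarith)]
      have h2 : (t - t₀) * ‖z‖ ≤ (1 - t₀) * ‖z‖ :=
        mul_le_mul_of_nonneg_right (by linarith [ht.2]) hzn.le
      have h3 := hxx'.trans_le (min_le_right _ _)
      rw [hB, Metric.mem_ball]
      linarith [dist_triangle x (t • z) y]
  classical
  have hφ'U : EqOn φ (fun x => if x ∈ U then φ x else E (g x)) U := fun x hx => by simp [hx]
  have hφ'B : EqOn (E ∘ g) (fun x => if x ∈ U then φ x else E (g x)) B := fun x hx => by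
    by_cases h : x ∈ U
    · simp only [h, if_true]
      exact (hagree ⟨h, hx⟩).symm
    · simp [h]
  have hVo : IsOpen V := Metric.isOpen_thickening
  refine hz.1 ⟨V, fun x => if x ∈ U then φ x else E (g x), hVo, (convex_segment 0 z).thickening _,
    Metric.self_subset_thickening hV0 _ (left_mem_segment ℝ 0 z),
    Metric.self_subset_thickening hV0 _ (right_mem_segment ℝ 0 z), ?_, ?_⟩
  · rw [dev_iff hVo]
    intro x hx
    have h1 := (dev_iff hU).1 (hφ.congr hU hφ'U)
    have h2 := (dev_iff Metric.isOpen_ball).1 (hBE.congr Metric.isOpen_ball hφ'B)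
    exact (hVU hx).elim (h1 x) (h2 x)
  · exact (hφ'U.symm.eventuallyEq_of_mem (hU.mem_nhds hU0)).trans hφe

theorem smul_mem_of_mem_closure {D : Set Plane} (hDo : IsOpen D) (hD : Convex ℝ D) (hD0 : 0 ∈ D)
    {z : Plane} (hz : z ∈ closure D) {t : ℝ} (ht : t ∈ Ico (0 : ℝ) 1) : t • z ∈ D := by
  rcases ht.1.eq_or_lt with h | h
  · simpa [← h] using hD0
  have hos : t • z ∈ openSegment ℝ z 0 := by
    rw [openSegment_eq_image]
    exact ⟨1 - t, ⟨by linarith [ht.2], by linarith⟩, by simp⟩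
  have := hD.openSegment_closure_interior_subset_interior hz (hDo.interior_eq.symm ▸ hD0) hos
  rwa [hDo.interior_eq] at this

theorem mem_visible_of_mem_closure {D : Set Plane} (hDo : IsOpen D) (hD : Convex ℝ D)
    (hD0 : 0 ∈ D) (hDΩ : D ⊆ devDomain S e) {z : Plane} (hz : z ∈ closure D)
    (hz' : z ∉ devDomain S e) : z ∈ visible S e := by
  exact ⟨hz', fun t ht => hDΩ (smul_mem_of_mem_closure hDo hD hD0 hz ht)⟩

/-- A point of the closure is either developed, with value off `S`, or visible, and then the value
is the limit along its ray. So the marked points of a disc are the visible endpoints on its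
boundary. -/
theorem IsMarkedSurface.extendFrom_mem_iff (hS : IsMarkedSurface S) {D : Set Plane}
    (h0 : 0 ∈ devDomain S e) (hDo : IsOpen D) (hD : Convex ℝ D) (hD0 : 0 ∈ D)
    (hDΩ : D ⊆ devDomain S e) {z : Plane} (hz : z ∈ closure D) :
    extendFrom D (devMap S e) z ∈ S ↔ z ∈ visible S e := by
  have := hS.compact
  have hΦ : Dev S D (devMap S e) := hS.dev_devMap.mono hDΩ
  have hcont := hΦ.continuousOn_extendFrom hD
  constructor
  · intro h
    by_contra hv
    have hzΩ : z ∈ devDomain S e := by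
      by_contra hzΩ
      exact hv (mem_visible_of_mem_closure hDo hD hD0 hDΩ hz hzΩ)
    rw [extendFrom_eq hz
      (hS.dev_devMap.locIso isOpen_devDomain hzΩ).continuousAt.continuousWithinAt] at h
    exact (hS.dev_devMap z hzΩ).1 h
  · intro hv
    obtain ⟨s, hs, hlim⟩ := hS.exists_tendsto_of_mem_visible h0 hv
    have hmem : ∀ᶠ t : ℝ in 𝓝[<] 1, t • z ∈ D := by
      filter_upwards [Ioo_mem_nhdsLT zero_lt_one] with t ht
      exact smul_mem_of_mem_closure hDo hD hD0 hz ⟨ht.1.le, ht.2⟩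
    have hsm : Tendsto (fun t : ℝ => t • z) (𝓝[<] 1) (𝓝 z) := by
      have : ContinuousAt (fun t : ℝ => t • z) 1 := by fun_prop
      simpa using this.tendsto.mono_left (nhdsWithin_le_nhds (s := Iio 1))
    have l1 : Tendsto (fun t : ℝ => extendFrom D (devMap S e) (t • z)) (𝓝[<] 1)
        (𝓝 (extendFrom D (devMap S e) z)) :=
      (hcont z hz).tendsto.comp (tendsto_nhdsWithin_iff.2 ⟨hsm,
        hmem.mono fun t ht => subset_closure ht⟩)
    have l2 := l1.congr' (hmem.mono fun t ht => hΦ.eqOn_extendFrom hDo ht)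
    rw [tendsto_nhds_unique l2 hlim]
    exact hs

end DevDomain

/-! ### Segments ending at a marked point -/

section Endpoint

variable {X : Type*} [MetricSpace X] {S : Set X} {e : Plane → X}

/-- The coefficient of `t²` does not involve `ω`, which makes differences of such functions affine
in `t`. -/
theorem dist_sq_lineMap (y z ω : Plane) (t : ℝ) : dist (AffineMap.lineMap y z t) ω ^ 2 =
    dist y ω ^ 2 + t * (2 * inner ℝ (y - ω) (z - y)) + t ^ 2 * dist y z ^ 2 := by
  rw [AffineMap.lineMap_apply, vsub_eq_sub, vadd_eq_add, dist_eq_norm, dist_eq_norm,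
    dist_comm y z, dist_eq_norm, add_sub_assoc, add_comm, norm_add_sq_real, norm_smul,
    real_inner_smul_right, Real.norm_eq_abs, mul_pow, sq_abs]
  ring

theorem tendsto_lineMap_left (y z : Plane) :
    Tendsto (fun t : ℝ => AffineMap.lineMap y z t) (𝓝[<] 1) (𝓝 z) := by
  have : ContinuousAt (fun t : ℝ => AffineMap.lineMap y z t) 1 := by fun_prop
  simpa using this.tendsto.mono_left (nhdsWithin_le_nhds (s := Iio 1))

/-- Near each point `s`, a development of a half-open segment tending to `s` at its end runs
along a shortest path to `s`. -/
theorem exists_dist_eq_of_tendsto {s : X} (hs : ∃ θ, IsConePoint s θ) :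
    ∃ ρ > 0, ∀ (φ : Plane → X) (y z : Plane),
      (∀ t ∈ Ico (0 : ℝ) 1, LocIso φ (AffineMap.lineMap y z t) ∧ φ (AffineMap.lineMap y z t) ≠ s) →
      Tendsto (fun t : ℝ => φ (AffineMap.lineMap y z t)) (𝓝[<] 1) (𝓝 s) →
      dist y z < ρ → dist (φ y) s = dist y z := by
  obtain ⟨θ, hθ⟩ := hs
  obtain ⟨ρ, hρ, hrad⟩ := exists_radial_chart hθ
  refine ⟨ρ, hρ, fun φ y z hloc hlim hyz => ?_⟩
  set L := dist y z with hL
  have hL0 : 0 ≤ L := dist_nonneg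
  set f : ℝ → ℝ := fun t => dist (φ (AffineMap.lineMap y z t)) s with hf
  have hmul : ∀ t t' : ℝ, dist (AffineMap.lineMap y z t) (AffineMap.lineMap y z t') =
      L * |t - t'| := fun t t' => by rw [dist_lineMap_lineMap, Real.dist_eq, mul_comm]
  have hle : ∀ t ∈ Ico (0 : ℝ) 1, f t ≤ L * (1 - t) := by
    intro t ht
    have hev : ∀ᶠ t' in 𝓝[<] (1 : ℝ), dist (φ (AffineMap.lineMap y z t))
        (φ (AffineMap.lineMap y z t')) ≤ L * (1 - t) := by
      filter_upwards [Ioo_mem_nhdsLT ht.2] with t' ht'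
      rw [dist_comm]
      refine (dist_le_of_locally_dist_le (c := fun t => φ (AffineMap.lineMap y z t)) (L := L)
        ht'.1.le fun τ hτ => ?_).trans (mul_le_mul_of_nonneg_left (by linarith [ht'.2]) hL0)
      obtain ⟨ε, hε, h1⟩ := (hloc τ ⟨ht.1.trans hτ.1, hτ.2.trans_lt ht'.2⟩).1
      refine ⟨ε / (L + 1), by positivity, fun τ' _ hττ' => ?_⟩
      have hlt : L * |τ' - τ| < ε := by
        rw [lt_div_iff₀ (by positivity)] at hττ'
        nlinarith [abs_nonneg (τ' - τ)]
      rw [h1 _ (by rw [Metric.mem_ball, hmul]; exact hlt) _ (Metric.mem_ball_self hε), hmul]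
    exact le_of_tendsto (tendsto_const_nhds.dist hlim) hev
  -- In radial coordinates the squared distance to `s` is a squared planar distance, so the
  -- quadratic terms cancel and `k` is locally affine. Being analytic, it is then given by one
  -- affine function on all of `Ico 0 1`.
  set k : ℝ → ℝ := fun t => f t ^ 2 - L ^ 2 * (1 - t) ^ 2 with hk
  have haff : ∀ t ∈ Ico (0 : ℝ) 1, ∃ A B : ℝ, k =ᶠ[𝓝 t] fun t' => A + B * t' := by
    intro t ht
    obtain ⟨hl, hne⟩ := hloc t ht
    obtain ⟨δ, hδ, u, hu⟩ := hrad (φ (AffineMap.lineMap y z t)) (by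
      rw [Metric.mem_ball]
      refine (hle t ht).trans_lt (lt_of_le_of_lt ?_ hyz)
      nlinarith [ht.1]) hne
    have hcont := hl.continuousAt.eventually (Metric.ball_mem_nhds _ hδ)
    obtain ⟨ε, hε, h1⟩ := hl
    obtain ⟨η, hη, h2⟩ := Metric.eventually_nhds_iff_ball.1 hcont
    obtain ⟨g, hg⟩ := exists_affineIsometryEquiv_eqOn_ball (f := u ∘ φ) (lt_min hε hη)
      fun a ha b hb => by
        have ha1 := Metric.ball_subset_ball (min_le_left _ _) ha
        have hb1 := Metric.ball_subset_ball (min_le_left _ _) hb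
        have ha2 := Metric.ball_subset_ball (min_le_right _ _) ha
        have hb2 := Metric.ball_subset_ball (min_le_right _ _) hb
        rw [← h1 a ha1 b hb1]
        exact (hu _ (h2 a ha2)).2 _ (h2 b hb2)
    have hc : ContinuousAt (fun t : ℝ => AffineMap.lineMap y z t) t := by fun_prop
    have hev := hc.eventually (Metric.ball_mem_nhds _ (lt_min hε hη))
    set ω := g.symm 0 with hω
    refine ⟨dist y ω ^ 2 - L ^ 2, 2 * inner ℝ (y - ω) (z - y) + 2 * L ^ 2, ?_⟩
    filter_upwards [hev] with t' ht'
    have e1 : f t' = dist (AffineMap.lineMap y z t') ω := by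
      rw [hω, ← g.dist_map, g.apply_symm_apply, dist_zero_right, ← hg ht']
      exact (hu _ (h2 _ (Metric.ball_subset_ball (min_le_right _ _) ht'))).1.symm
    simp only [hk]
    rw [e1, dist_sq_lineMap]
    ring
  have han : AnalyticOnNhd ℝ k (Ico 0 1) := fun t ht => by
    obtain ⟨A, B, h⟩ := haff t ht
    exact (AnalyticAt.congr (by fun_prop) h.symm)
  obtain ⟨A, B, hAB⟩ := haff 0 (by simp)
  have hkAB : EqOn k (fun t => A + B * t) (Ico 0 1) :=
    han.eqOn_of_preconnected_of_eventuallyEq (fun t _ => by fun_prop) isPreconnected_Ico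
      (by simp) hAB
  -- An affine function that is `O((1 - t)²)` at `1` vanishes; at `t = 0` this is the desired
  -- equality.
  have hbound : ∀ t ∈ Ico (0 : ℝ) 1, |A + B * t| ≤ L ^ 2 * (1 - t) ^ 2 := by
    intro t ht
    rw [← show k t = A + B * t from hkAB ht]
    have h1 := hle t ht
    have h0 : 0 ≤ f t := dist_nonneg
    have h2 : f t ^ 2 ≤ (L * (1 - t)) ^ 2 := pow_le_pow_left₀ h0 h1 2
    simp only [hk]
    rw [abs_le]
    constructor <;> nlinarith [sq_nonneg (f t)]
  have hev1 : ∀ᶠ t in 𝓝[<] (1 : ℝ), t ∈ Ico (0 : ℝ) 1 := Ico_mem_nhdsLT zero_lt_one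
  have hsum : A + B = 0 := by
    have l1 : Tendsto (fun t : ℝ => |A + B * t|) (𝓝[<] 1) (𝓝 |A + B|) := by
      have : ContinuousAt (fun t : ℝ => |A + B * t|) 1 := by fun_prop
      simpa using this.tendsto.mono_left (nhdsWithin_le_nhds (s := Iio 1))
    have l2 : Tendsto (fun t : ℝ => L ^ 2 * (1 - t) ^ 2) (𝓝[<] 1) (𝓝 0) := by
      have : ContinuousAt (fun t : ℝ => L ^ 2 * (1 - t) ^ 2) 1 := by fun_prop
      simpa using this.tendsto.mono_left (nhdsWithin_le_nhds (s := Iio 1))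
    exact abs_eq_zero.1 (le_antisymm (le_of_tendsto_of_tendsto l1 l2 (hev1.mono hbound))
      (abs_nonneg _))
  have hB : B = 0 := by
    have l2 : Tendsto (fun t : ℝ => L ^ 2 * (1 - t)) (𝓝[<] 1) (𝓝 0) := by
      have : ContinuousAt (fun t : ℝ => L ^ 2 * (1 - t)) 1 := by fun_prop
      simpa using this.tendsto.mono_left (nhdsWithin_le_nhds (s := Iio 1))
    refine abs_eq_zero.1 (le_antisymm (ge_of_tendsto l2 (hev1.mono fun t ht => ?_))
      (abs_nonneg _))
    have h1 := hbound t ht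
    have h2 : A + B * t = -B * (1 - t) := by linarith
    rw [h2, abs_mul, abs_neg, abs_of_pos (by linarith [ht.2] : 0 < 1 - t)] at h1
    have h3 : 0 < 1 - t := by linarith [ht.2]
    nlinarith
  have h0 : k 0 = 0 := by
    have := hkAB (x := 0) (by simp)
    simp only [this]
    linarith
  have h1 : f 0 ^ 2 = L ^ 2 := by
    simp only [hk] at h0
    linarith
  have h2 : f 0 = L := (pow_left_inj₀ dist_nonneg hL0 two_ne_zero).1 h1
  simpa [hf] using h2

theorem IsMarkedSurface.exists_uniform_dist_eq (hS : IsMarkedSurface S) :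
    ∃ ρ > 0, ∀ s ∈ S, ∀ (φ : Plane → X) (y z : Plane),
      (∀ t ∈ Ico (0 : ℝ) 1, LocIso φ (AffineMap.lineMap y z t) ∧ φ (AffineMap.lineMap y z t) ∉ S) →
      Tendsto (fun t : ℝ => φ (AffineMap.lineMap y z t)) (𝓝[<] 1) (𝓝 s) →
      dist y z < ρ → dist (φ y) s = dist y z := by
  choose ρ hρ h using fun s : X => exists_dist_eq_of_tendsto (hS.conical s)
  obtain ⟨s₀, hs₀, hmin⟩ := hS.finite.exists_minimalFor ρ S hS.nonempty
  refine ⟨ρ s₀, hρ s₀, fun s hs φ y z hloc hlim hyz => h s φ y z (fun t ht => ?_) hlim ?_⟩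
  · exact ⟨(hloc t ht).1, fun h => (hloc t ht).2 (h ▸ hs)⟩
  · rcases le_total (ρ s₀) (ρ s) with h' | h'
    · exact hyz.trans_le h'
    · exact hyz.trans_le (hmin hs h')

theorem exists_pos_forall_dist_lt {S : Set X} (hS : S.Finite) :
    ∃ ρ > 0, ∀ s ∈ S, ∀ s' ∈ S, dist s s' < ρ → s = s' := by
  rcases S.eq_empty_or_nonempty with rfl | hne
  · exact ⟨1, one_pos, by simp⟩
  rcases S.subsingleton_or_nontrivial with h | h
  · exact ⟨1, one_pos, fun s hs s' hs' _ => h hs hs'⟩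
  · refine ⟨S.infsep, (Set.Finite.infsep_pos_iff_nontrivial hS).2 h, fun s hs s' hs' hlt => ?_⟩
    by_contra hne
    exact absurd hlt (not_lt.2 (infsep_le_dist_of_mem hs hs' hne))

/-- The endpoints on the closure of a developed convex domain are isolated. -/
theorem IsMarkedSurface.exists_nhds_inter_visible_subset (hS : IsMarkedSurface S)
    {D : Set Plane} (h0 : 0 ∈ devDomain S e) (hDo : IsOpen D) (hD : Convex ℝ D) (hD0 : 0 ∈ D)
    (hDΩ : D ⊆ devDomain S e) {z : Plane} (hz : z ∈ closure D) :
    ∃ N ∈ 𝓝 z, N ∩ visible S e ⊆ {z} := by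
  by_cases hzΩ : z ∈ devDomain S e
  · exact ⟨_, isOpen_devDomain.mem_nhds hzΩ, fun w hw => absurd hw.1 hw.2.1⟩
  have hzv := mem_visible_of_mem_closure hDo hD hD0 hDΩ hz hzΩ
  have hsS := (hS.extendFrom_mem_iff h0 hDo hD hD0 hDΩ hz).2 hzv
  have := hS.compact
  have hΦ : Dev S D (devMap S e) := hS.dev_devMap.mono hDΩ
  have hcont := hΦ.continuousOn_extendFrom hD
  set s := extendFrom D (devMap S e) z with hs
  obtain ⟨ρ, hρ, hcone⟩ := hS.exists_uniform_dist_eq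
  obtain ⟨ρ', hρ', hsep⟩ := exists_pos_forall_dist_lt hS.finite
  set η := min ρ (ρ' / 2) with hη
  have hη0 : 0 < η := lt_min hρ (by positivity)
  have hev1 : ∀ᶠ t in 𝓝[<] (1 : ℝ), t ∈ Ioo (0 : ℝ) 1 := Ioo_mem_nhdsLT zero_lt_one
  have hlim0 : Tendsto (fun t : ℝ => (1 - t) * ‖z‖) (𝓝[<] 1) (𝓝 0) := by
    have : ContinuousAt (fun t : ℝ => (1 - t) * ‖z‖) 1 := by fun_prop
    simpa using this.tendsto.mono_left (nhdsWithin_le_nhds (s := Iio 1))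
  obtain ⟨t₁, ht₁, htz⟩ := (hev1.and (hlim0.eventually_lt_const hη0)).exists
  -- For a visible `z'` near `z`, the distance from the image of `t • z'` to the marked point is
  -- measured along the segment to `z` and along the ray to `z'`. Equating both values for two
  -- different parameters `t` will force `z' = z`.
  obtain ⟨t₂, ht₂, ht₂'⟩ := exists_between ht₁.2
  have ht₂0 : 0 < t₂ := ht₁.1.trans ht₂
  have hP : ∀ t, t₁ ≤ t → t < 1 → ∀ᶠ z' in 𝓝 z, t • z' ∈ D ∧ (1 - t) * ‖z'‖ < η ∧
      dist (t • z') z < η := by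
    intro t ht ht1
    have hlt : (1 - t) * ‖z‖ < η :=
      lt_of_le_of_lt (mul_le_mul_of_nonneg_right (by linarith) (norm_nonneg _)) htz
    have c1 : ContinuousAt (fun z' : Plane => t • z') z := by fun_prop
    have c2 : ContinuousAt (fun z' : Plane => (1 - t) * ‖z'‖) z := by fun_prop
    have c3 : ContinuousAt (fun z' : Plane => dist (t • z') z) z := by fun_prop
    refine (c1.eventually (hDo.mem_nhds
      (smul_mem_of_mem_closure hDo hD hD0 hz ⟨ht₁.1.le.trans ht, ht1⟩))).and
      ((c2.eventually_lt continuousAt_const hlt).and (c3.eventually_lt continuousAt_const ?_))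
    rw [dist_comm, dist_eq_norm]
    have : z - t • z = (1 - t) • z := by rw [sub_smul, one_smul]
    rw [this, norm_smul, Real.norm_of_nonneg (by linarith)]
    exact hlt
  refine ⟨_, (hP t₁ le_rfl ht₁.2).and (hP t₂ ht₂.le ht₂'), ?_⟩
  rintro z' ⟨hz', hz'v⟩
  have hz'1 : ∀ t, t = t₁ ∨ t = t₂ → t • z' ∈ D ∧ (1 - t) * ‖z'‖ < η ∧ dist (t • z') z < η := by
    rintro t (rfl | rfl)
    exacts [hz'.1, hz'.2]
  obtain ⟨s', hs'S, hs'⟩ := hS.exists_tendsto_of_mem_visible h0 hz'v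
  have ht : ∀ t, t = t₁ ∨ t = t₂ → t ∈ Ioo (0 : ℝ) 1 := by
    rintro t (rfl | rfl)
    exacts [ht₁, ⟨ht₂0, ht₂'⟩]
  have hd1 : ∀ t, t = t₁ ∨ t = t₂ → dist (devMap S e (t • z')) s = dist (t • z') z := by
    intro t htt
    obtain ⟨hm, -, hlt⟩ := hz'1 t htt
    have hseg : ∀ τ ∈ Ico (0 : ℝ) 1, AffineMap.lineMap (t • z') z τ ∈ D := by
      intro τ hτ
      have hos : AffineMap.lineMap (t • z') z τ ∈ insert (t • z') (openSegment ℝ (t • z') z) := by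
        rcases hτ.1.eq_or_lt with h | h
        · left; simp [← h]
        · right
          rw [openSegment_eq_image_lineMap]
          exact mem_image_of_mem _ ⟨h, hτ.2⟩
      rcases hos with h | h
      · rwa [h]
      · have := hD.openSegment_interior_closure_subset_interior (hDo.interior_eq.symm ▸ hm) hz h
        rwa [hDo.interior_eq] at this
    have hlim : Tendsto (fun τ : ℝ => devMap S e (AffineMap.lineMap (t • z') z τ)) (𝓝[<] 1)
        (𝓝 s) := by
      have hmem : ∀ᶠ τ : ℝ in 𝓝[<] 1, AffineMap.lineMap (t • z') z τ ∈ D :=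
        hev1.mono fun τ hτ => hseg τ ⟨hτ.1.le, hτ.2⟩
      refine ((hcont z hz).tendsto.comp (tendsto_nhdsWithin_iff.2 ⟨tendsto_lineMap_left _ _,
        hmem.mono fun τ hτ => subset_closure hτ⟩)).congr' (hmem.mono fun τ hτ => ?_)
      exact hΦ.eqOn_extendFrom hDo hτ
    exact hcone s hsS _ _ _ (fun τ hτ => ⟨hΦ.locIso hDo (hseg τ hτ), (hΦ _ (hseg τ hτ)).1⟩) hlim
      (hlt.trans_le (min_le_left _ _))
  have hd2 : ∀ t, t = t₁ ∨ t = t₂ → dist (devMap S e (t • z')) s' = (1 - t) * ‖z'‖ := by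
    intro t htt
    have ht' := ht t htt
    have hline : ∀ τ : ℝ, AffineMap.lineMap (t • z') z' τ = (t + τ * (1 - t)) • z' := by
      intro τ
      rw [AffineMap.lineMap_apply, vsub_eq_sub, vadd_eq_add]
      module
    have hdd : dist (t • z') z' = (1 - t) * ‖z'‖ := by
      rw [dist_comm, dist_eq_norm]
      have : z' - t • z' = (1 - t) • z' := by rw [sub_smul, one_smul]
      rw [this, norm_smul, Real.norm_of_nonneg (by linarith [ht'.2])]
    rw [← hdd]
    have hmem : ∀ τ ∈ Ico (0 : ℝ) 1, t + τ * (1 - t) ∈ Ico (0 : ℝ) 1 := fun τ hτ =>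
      ⟨by nlinarith [hτ.1, ht'.1, ht'.2], by nlinarith [hτ.2, ht'.2]⟩
    refine hcone s' hs'S _ _ _ (fun τ hτ => ?_) ?_ ?_
    · rw [hline]
      have := hz'v.2 _ (hmem τ hτ)
      exact ⟨hS.dev_devMap.locIso isOpen_devDomain this, (hS.dev_devMap _ this).1⟩
    · simp_rw [hline]
      refine hs'.comp (f := fun τ => t + τ * (1 - t)) (tendsto_nhdsWithin_iff.2 ⟨?_, ?_⟩)
      · have : ContinuousAt (fun τ : ℝ => t + τ * (1 - t)) 1 := by fun_prop
        simpa using this.tendsto.mono_left (nhdsWithin_le_nhds (s := Iio 1))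
      · exact hev1.mono fun τ hτ => (hmem τ ⟨hτ.1.le, hτ.2⟩).2
    · rw [hdd]
      exact (hz'1 t htt).2.1.trans_le (min_le_left _ _)
  -- Both points are within `η ≤ ρ' / 2` of the image of `t₁ • z'`.
  have hss : s = s' := by
    refine hsep s hsS s' hs'S ?_
    have h1 := hd1 t₁ (Or.inl rfl)
    have h2 := hd2 t₁ (Or.inl rfl)
    obtain ⟨-, h3, h4⟩ := hz'1 t₁ (Or.inl rfl)
    have h5 : η ≤ ρ' / 2 := min_le_right _ _
    have := dist_triangle_left s s' (devMap S e (t₁ • z'))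
    linarith
  -- The equality of squared distances is affine in `t`. Holding at two parameters, it yields `⟪z',
  -- z⟫ = ‖z'‖²` and `‖z‖ = ‖z'‖`.
  have heq : ∀ t, t = t₁ ∨ t = t₂ →
      ‖z‖ ^ 2 - 2 * t * inner ℝ z' z = (1 - 2 * t) * ‖z'‖ ^ 2 := by
    intro t htt
    have h1 : dist (t • z') z ^ 2 = ((1 - t) * ‖z'‖) ^ 2 := by
      rw [← hd1 t htt, ← hd2 t htt, hss]
    rw [dist_eq_norm, norm_sub_sq_real, norm_smul, real_inner_smul_left, mul_pow, mul_pow,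
      Real.norm_eq_abs, sq_abs] at h1
    linarith
  have e1 := heq t₁ (Or.inl rfl)
  have e2 := heq t₂ (Or.inr rfl)
  have hin : inner ℝ z' z = ‖z'‖ ^ 2 := by
    have : (t₂ - t₁) * (inner ℝ z' z - ‖z'‖ ^ 2) = 0 := by linarith
    rcases mul_eq_zero.1 this with h | h <;> linarith
  have hn : ‖z‖ ^ 2 = ‖z'‖ ^ 2 := by rw [hin] at e1; linarith
  have : ‖z' - z‖ ^ 2 = 0 := by rw [norm_sub_sq_real, hin, hn]; ring
  simpa [sub_eq_zero] using this

/-- Around the closure of a bounded developed convex domain there are only finitely many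
endpoints, and all of them lie on the closure. -/
theorem IsMarkedSurface.exists_open_inter_visible_finite (hS : IsMarkedSurface S)
    {D : Set Plane} (h0 : 0 ∈ devDomain S e) (hDo : IsOpen D) (hD : Convex ℝ D) (hD0 : 0 ∈ D)
    (hDΩ : D ⊆ devDomain S e) (hDb : Bornology.IsBounded D) :
    ∃ N, IsOpen N ∧ closure D ⊆ N ∧ (N ∩ visible S e).Finite ∧ N ∩ visible S e ⊆ closure D := by
  have hc : IsCompact (closure D) := hDb.isCompact_closure
  have hfin : ∃ N ∈ 𝓝ˢ (closure D), (N ∩ visible S e).Finite := by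
    refine hc.induction_on (p := fun A => ∃ N ∈ 𝓝ˢ A, (N ∩ visible S e).Finite)
      ⟨∅, by simp, by simp⟩ (fun A B hAB ⟨N, hN, h⟩ => ⟨N, nhdsSet_mono hAB hN, h⟩)
      (fun A B ⟨N, hN, h⟩ ⟨N', hN', h'⟩ => ⟨N ∪ N', union_mem_nhdsSet hN hN', ?_⟩) ?_
    · rw [union_inter_distrib_right]
      exact h.union h'
    · intro z hz
      obtain ⟨N, hN, h⟩ := hS.exists_nhds_inter_visible_subset h0 hDo hD hD0 hDΩ hz
      obtain ⟨V, hVN, hV, hzV⟩ := mem_nhds_iff.1 hN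
      exact ⟨V, nhdsWithin_le_nhds (hV.mem_nhds hzV), V, hV.mem_nhdsSet.2 le_rfl,
        (finite_singleton z).subset ((inter_subset_inter_left _ hVN).trans h)⟩
  obtain ⟨N, hN, hfin⟩ := hfin
  obtain ⟨V, hV, hDV, hVN⟩ := mem_nhdsSet_iff_exists.1 hN
  have hF : (V ∩ visible S e).Finite := hfin.subset (inter_subset_inter_left _ hVN)
  -- The unwanted endpoints in `V` are finite in number, so deleting them leaves an open set.
  refine ⟨V \ ((V ∩ visible S e) \ closure D), hV.sdiff (hF.subset sdiff_subset).isClosed,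
    fun z hz => ⟨hDV hz, fun h => h.2 hz⟩, hF.subset fun z hz => ⟨hz.1.1, hz.2⟩, ?_⟩
  rintro z ⟨⟨hzV, hz⟩, hzv⟩
  by_contra h
  exact hz ⟨⟨hzV, hzv⟩, h⟩

end Endpoint

/-! ### Delaunay discs cover the surface -/

section Cover

variable {X : Type*} [MetricSpace X] {S : Set X} {e : Plane → X}

/-- Iterated midpoints towards `x` give arbitrarily small steps towards `s` without loss of
distance, so no geodesic has to be constructed. -/
theorem IsMarkedSurface.exists_dist_lt (hS : IsMarkedSurface S) (x s : X) {η : ℝ} (hη : 0 < η)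
    (hxs : x ≠ s) : ∃ m, 0 < dist x m ∧ dist x m < η ∧ dist x m + dist m s ≤ dist x s := by
  have key : ∀ n : ℕ, ∃ m, dist x m = dist x s * (1 / 2) ^ n ∧ dist x m + dist m s ≤ dist x s := by
    intro n
    induction n with
    | zero => exact ⟨s, by simp, by simp⟩
    | succ n ih =>
      obtain ⟨m, hm, hms⟩ := ih
      obtain ⟨m', h1, h2⟩ := hS.midpoint x m
      refine ⟨m', by rw [h1, hm, pow_succ]; ring, ?_⟩
      linarith [dist_triangle m' m s]
  have hpos : 0 < dist x s := dist_pos.2 hxs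
  obtain ⟨n, hn⟩ := exists_pow_lt_of_lt_one (div_pos hη hpos) (by norm_num : (1 / 2 : ℝ) < 1)
  obtain ⟨m, hm, hms⟩ := key n
  refine ⟨m, by rw [hm]; positivity, ?_, hms⟩
  rw [hm, mul_comm]
  exact (lt_div_iff₀ hpos).1 hn

theorem IsMarkedSurface.exists_preimage (hS : IsMarkedSurface S) {φ : Plane → X} {y : Plane}
    (h : LocIso φ y) (hy : φ y ∉ S) :
    ∃ ε > 0, ∀ m ∈ Metric.ball (φ y) ε, ∃ y', φ y' = m ∧ dist y' y = dist m (φ y) := by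
  obtain ⟨ε, E, hE, -⟩ := hS.exists_flatChart hy
  obtain ⟨g, hg, hgE⟩ := hE.exists_eventuallyEq h (Metric.mem_ball_self hE.pos) hE.map_zero.symm
  obtain ⟨δ, hδ, hb⟩ := Metric.eventually_nhds_iff_ball.1 hgE
  refine ⟨min ε δ, lt_min hE.pos hδ, fun m hm => ?_⟩
  obtain ⟨w, hw, rfl⟩ := hE.surj m (Metric.ball_subset_ball (min_le_left _ _) hm)
  have hd : dist (g.symm w) y = dist (E w) (φ y) := by
    rw [← g.dist_map, g.apply_symm_apply, hg, dist_zero_right, hE.dist_center hw]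
  refine ⟨g.symm w, ?_, hd⟩
  rw [hb _ (by rw [Metric.mem_ball, hd]; exact (Metric.mem_ball.1 hm).trans_le (min_le_right _ _)),
    g.apply_symm_apply]

/-- If `s` were closer than `R`, minimise `dist (φ y) s` among the `y` with `dist y ω + dist (φ y) s
≤ dist (φ ω) s`. This is a compact set inside the open disc. The image of a minimiser is off `S`,
and a small step from it towards `s` lifts through `φ`, stays in the set and decreases the distance.
-/
theorem IsMarkedSurface.radius_le_dist (hS : IsMarkedSurface S) {φ : Plane → X} {ω : Plane}
    {R : ℝ} (hφ : Dev S (Metric.ball ω R) φ) {s : X} (hs : s ∈ S) : R ≤ dist (φ ω) s := by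
  by_contra! hlt
  set d := dist (φ ω) s with hd
  have hd0 : 0 ≤ d := dist_nonneg
  have hsub : Metric.closedBall ω d ⊆ Metric.ball ω R := Metric.closedBall_subset_ball hlt
  have hcont : ContinuousOn φ (Metric.closedBall ω d) := fun y hy =>
    (hφ.locIso Metric.isOpen_ball (hsub hy)).continuousAt.continuousWithinAt
  have hdist : ContinuousOn (fun y => dist (φ y) s) (Metric.closedBall ω d) := fun y hy =>
    Filter.Tendsto.dist (hcont y hy) tendsto_const_nhds
  have hK : IsCompact {y ∈ Metric.closedBall ω d | dist y ω + dist (φ y) s ≤ d} := by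
    refine (isCompact_closedBall ω d).of_isClosed_subset ?_ (sep_subset _ _)
    exact Metric.isClosed_closedBall.isClosed_le ((by fun_prop : Continuous fun y =>
      dist y ω).continuousOn.add hdist) continuousOn_const
  obtain ⟨y, ⟨hy, hyd⟩, hmin⟩ := hK.exists_isMinOn ⟨ω, by simp [hd0], by simp [hd]⟩
    (hdist.mono (sep_subset _ _))
  have hyS : φ y ∉ S := (hφ y (hsub hy)).1
  obtain ⟨ε, hε, hpre⟩ := hS.exists_preimage (hφ.locIso Metric.isOpen_ball (hsub hy)) hyS
  obtain ⟨m, hm0, hmε, hms⟩ := hS.exists_dist_lt (φ y) s hε fun h => hyS (h ▸ hs)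
  obtain ⟨y', rfl, hy'⟩ := hpre m (by rwa [Metric.mem_ball, dist_comm])
  rw [dist_comm (φ y)] at hm0 hms
  have h1 := dist_triangle y' y ω
  have h2 : dist y' ω + dist (φ y') s ≤ d := by linarith
  have h3 := hmin (a := y') ⟨by
    rw [Metric.mem_closedBall]; linarith [dist_nonneg (x := φ y') (y := s)], h2⟩
  have h4 : dist (φ y) s ≤ dist (φ y') s := h3
  linarith

/-- The new radius is chosen so that `R² - |ω|²` grows by exactly `2εκ`. Near the old disc all
visible points lie on its boundary, and `κ ≤ ⟪u, z⟫` says precisely that they are not inside the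
moved disc; `0 ≤ κ` keeps the origin inside. -/
theorem IsMarkedSurface.eventually_ball_subset_devDomain (hS : IsMarkedSurface S)
    (h0 : 0 ∈ devDomain S e) {ω : Plane} {R : ℝ} (hR : 0 < R) (hω : 0 ∈ Metric.ball ω R)
    (hD : Metric.ball ω R ⊆ devDomain S e) {u : Plane} {κ : ℝ} (hκ : 0 ≤ κ)
    (hu : ∀ z ∈ Metric.closedBall ω R ∩ visible S e, κ ≤ inner ℝ u z) :
    ∀ᶠ ε in 𝓝[>] (0 : ℝ), ∃ R', 0 ≤ R' ∧
      R' ^ 2 = R ^ 2 + 2 * ε * κ - 2 * ε * inner ℝ u ω + ε ^ 2 * ‖u‖ ^ 2 ∧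
      Metric.ball (ω - ε • u) R' ⊆ devDomain S e := by
  obtain ⟨N, hN, hDN, -, hNv⟩ := hS.exists_open_inter_visible_finite h0 Metric.isOpen_ball
    (convex_ball ω R) hω hD Metric.isBounded_ball
  rw [closure_ball ω hR.ne'] at hDN hNv
  obtain ⟨r, hr, hrN⟩ := (isCompact_closedBall ω R).exists_thickening_subset_open hN hDN
  rw [thickening_closedBall hr hR.le] at hrN
  set Q : ℝ → ℝ := fun ε => R ^ 2 + 2 * ε * κ - 2 * ε * inner ℝ u ω + ε ^ 2 * ‖u‖ ^ 2 with hQ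
  have hQ0 : Q 0 = R ^ 2 := by simp [hQ]
  have hQc : ContinuousAt Q 0 := by fun_prop
  have h1 : ∀ᶠ ε in 𝓝[>] (0 : ℝ), 0 < Q ε :=
    (hQc.eventually_const_lt (by rw [hQ0]; positivity)).filter_mono nhdsWithin_le_nhds
  have h2 : ∀ᶠ ε in 𝓝[>] (0 : ℝ), Real.sqrt (Q ε) + ε * ‖u‖ < r + R := by
    have hc : ContinuousAt (fun ε => Real.sqrt (Q ε) + ε * ‖u‖) 0 := by fun_prop
    refine (hc.eventually_lt_const ?_).filter_mono nhdsWithin_le_nhds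
    simp only [hQ0, Real.sqrt_sq hR.le]
    linarith
  filter_upwards [h1, h2, self_mem_nhdsWithin] with ε hε1 hε2 hε
  have hε0 : 0 < ε := hε
  have hsq : Real.sqrt (Q ε) ^ 2 = Q ε := Real.sq_sqrt hε1.le
  refine ⟨Real.sqrt (Q ε), Real.sqrt_nonneg _, hsq, ?_⟩
  have hmem : ∀ z, z ∈ Metric.ball (ω - ε • u) (Real.sqrt (Q ε)) ↔
      ‖z - ω‖ ^ 2 + 2 * ε * (inner ℝ u z - inner ℝ u ω) + ε ^ 2 * ‖u‖ ^ 2 < Q ε := by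
    intro z
    rw [Metric.mem_ball, dist_eq_norm, ← sq_lt_sq₀ (norm_nonneg _) (Real.sqrt_nonneg _), hsq,
      ← sub_add, norm_add_sq_real, norm_smul, real_inner_smul_right, real_inner_comm,
      inner_sub_right, mul_pow, Real.norm_eq_abs, sq_abs]
    ring_nf
  refine subset_devDomain_of_disjoint h0 (convex_ball _ _) ?_ fun z hz hzD => ?_
  · rw [hmem]
    rw [Metric.mem_ball, dist_comm, dist_zero_right, ← sq_lt_sq₀ (norm_nonneg _) hR.le] at hω
    simp only [zero_sub, norm_neg, inner_zero_right, hQ]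
    nlinarith [mul_nonneg hε0.le hκ]
  · have hzN : z ∈ N := hrN (by
      rw [Metric.mem_ball, dist_eq_norm] at hzD ⊢
      have : ‖z - ω‖ ≤ ‖z - (ω - ε • u)‖ + ‖ε • u‖ := by
        have := norm_sub_le (z - (ω - ε • u)) (ε • u)
        rwa [sub_sub, sub_add_cancel] at this
      rw [norm_smul, Real.norm_of_nonneg hε0.le] at this
      linarith)
    have hzc := hNv ⟨hzN, hz⟩
    have hzR : R ≤ ‖z - ω‖ := by
      rw [← dist_eq_norm]
      by_contra! h
      exact hz.1 (hD h)
    have h3 := hu z ⟨hzc, hz⟩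
    have h4 := (hmem z).1 hzD
    have h5 : R ^ 2 ≤ ‖z - ω‖ ^ 2 := pow_le_pow_left₀ hR.le hzR 2
    simp only [hQ] at h4
    nlinarith

theorem exists_ne_zero_inner_eq_zero (a : Plane) : ∃ u : Plane, u ≠ 0 ∧ inner ℝ u a = 0 := by
  by_cases ha : a = 0
  · exact ⟨EuclideanSpace.single 0 1, by simp, by simp [ha]⟩
  · refine ⟨!₂[-a 1, a 0], fun h => ha ?_, ?_⟩
    · have h0 : -a 1 = 0 := congrArg (fun v : Plane => v 0) h
      have h1 : a 0 = 0 := congrArg (fun v : Plane => v 1) h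
      ext i
      fin_cases i
      · simpa using h1
      · simpa using h0
    · simp [PiLp.inner_apply, Fin.sum_univ_two]
      ring

/-- Maximise `P = R² - |ω|²`, the opposite of the power of the origin, over developed discs; radii
are bounded by the diameter, so a maximum exists. If the origin were not in the hull of the boundary
marked points, moving along a separating functional would increase `P`. Among the maximisers take
one of largest radius: with at most two marked points the centre could be moved so as to keep `P`
and enlarge `R`. -/
theorem IsMarkedSurface.exists_maximal_disc (hS : IsMarkedSurface S) (he : LocIso e 0)
    (heS : e 0 ∉ S) : ∃ ω R, 0 < R ∧ (0 : Plane) ∈ Metric.ball ω R ∧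
      Metric.ball ω R ⊆ devDomain S e ∧
      0 ∈ convexHull ℝ (Metric.closedBall ω R ∩ visible S e) ∧
      3 ≤ (Metric.closedBall ω R ∩ visible S e).encard := by
  have := hS.compact
  have h0 := hS.zero_mem_devDomain he heS
  obtain ⟨δ, hδ, hδΩ⟩ := Metric.isOpen_iff.1 isOpen_devDomain 0 h0
  obtain ⟨s, hs⟩ := hS.nonempty
  set C := Metric.diam (univ : Set X) with hC
  have hRC : ∀ ω R, Metric.ball ω R ⊆ devDomain S e → R ≤ C := fun ω R h =>
    (hS.radius_le_dist (hS.dev_devMap.mono h) hs).trans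
      (Metric.dist_le_diam_of_mem isCompact_univ.isBounded (mem_univ _) (mem_univ _))
  set P : Plane × ℝ → ℝ := fun q => q.2 ^ 2 - ‖q.1‖ ^ 2 with hP
  set K : Set (Plane × ℝ) := {q | 0 ≤ q.2 ∧ δ ^ 2 ≤ P q ∧ Metric.ball q.1 q.2 ⊆ devDomain S e}
    with hKdef
  -- Written as a family of inequalities, the condition of being developed is visibly closed in the
  -- centre and radius.
  have hball : {q : Plane × ℝ | Metric.ball q.1 q.2 ⊆ devDomain S e} =
      ⋂ y ∈ (devDomain S e)ᶜ, {q : Plane × ℝ | q.2 ≤ dist y q.1} := by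
    ext q
    simp only [mem_ofPred_eq, mem_iInter, mem_compl_iff, subset_def, Metric.mem_ball]
    refine forall_congr' fun y => ?_
    rw [← not_lt, not_imp_not]
  have hKc : IsCompact K := by
    refine ((isCompact_closedBall (0 : Plane) C).prod (isCompact_Icc (a := (0 : ℝ))
      (b := C))).of_isClosed_subset ?_ ?_
    · have h1 : IsClosed {q : Plane × ℝ | 0 ≤ q.2} := isClosed_le (by fun_prop) (by fun_prop)
      have h2 : IsClosed {q : Plane × ℝ | δ ^ 2 ≤ P q} := isClosed_le (by fun_prop) (by fun_prop)
      have h3 : IsClosed {q : Plane × ℝ | Metric.ball q.1 q.2 ⊆ devDomain S e} := by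
        rw [hball]
        exact isClosed_biInter fun y _ => isClosed_le (by fun_prop) (by fun_prop)
      exact h1.inter (h2.inter h3)
    · rintro q ⟨h1, h2, h3⟩
      have h4 := hRC _ _ h3
      refine ⟨?_, h1, h4⟩
      rw [mem_closedBall_zero_iff]
      refine le_trans ((sq_le_sq₀ (norm_nonneg _) h1).1 ?_) h4
      simp only [hP] at h2
      nlinarith
  obtain ⟨q₁, hq₁, hmax₁⟩ := hKc.exists_isMaxOn ⟨(0, δ), hδ.le, by simp [hP], hδΩ⟩
    (f := P) (by fun_prop)
  have hK'c : IsCompact (K ∩ {q | P q₁ ≤ P q}) :=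
    hKc.inter_right (isClosed_le (by fun_prop) (by fun_prop))
  obtain ⟨⟨ω, R⟩, ⟨hq, hPq⟩, hmax₂⟩ := hK'c.exists_isMaxOn ⟨q₁, hq₁, le_refl (P q₁)⟩
    (f := fun q : Plane × ℝ => q.2) (by fun_prop)
  have hδ2 : 0 < δ ^ 2 := by positivity
  have hRpos : 0 < R := by
    have h1 : 0 ≤ R := hq.1
    have h2 : δ ^ 2 ≤ R ^ 2 - ‖ω‖ ^ 2 := hq.2.1
    rcases h1.eq_or_lt with h | h
    · rw [← h] at h2
      nlinarith [sq_nonneg ‖ω‖]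
    · exact h
  have hω : (0 : Plane) ∈ Metric.ball ω R := by
    have h2 : δ ^ 2 ≤ R ^ 2 - ‖ω‖ ^ 2 := hq.2.1
    rw [Metric.mem_ball, dist_comm, dist_zero_right, ← sq_lt_sq₀ (norm_nonneg _) hRpos.le]
    linarith
  have hD : Metric.ball ω R ⊆ devDomain S e := hq.2.2
  have hPmove : ∀ (u : Plane) (ε κ R' : ℝ),
      R' ^ 2 = R ^ 2 + 2 * ε * κ - 2 * ε * inner ℝ u ω + ε ^ 2 * ‖u‖ ^ 2 →
      P (ω - ε • u, R') = P (ω, R) + 2 * ε * κ := by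
    intro u ε κ R' h
    simp only [hP]
    rw [h, norm_sub_sq_real, norm_smul, real_inner_smul_right, real_inner_comm, mul_pow,
      Real.norm_eq_abs, sq_abs]
    ring
  have hfin : (Metric.closedBall ω R ∩ visible S e).Finite := by
    obtain ⟨N, -, hDN, hfin, -⟩ := hS.exists_open_inter_visible_finite h0 Metric.isOpen_ball
      (convex_ball ω R) hω hD Metric.isBounded_ball
    rw [closure_ball ω hRpos.ne'] at hDN
    exact hfin.subset (inter_subset_inter_left _ hDN)
  have hconv : 0 ∈ convexHull ℝ (Metric.closedBall ω R ∩ visible S e) := by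
    by_contra hn
    obtain ⟨f, κ, hf0, hf⟩ := geometric_hahn_banach_point_closed (convex_convexHull ℝ _)
      (hfin.isClosed_convexHull ℝ) hn
    rw [map_zero] at hf0
    obtain ⟨ε, ⟨R', hR'0, hR', hR'D⟩, hε⟩ := ((hS.eventually_ball_subset_devDomain h0 hRpos hω hD
      (u := (InnerProductSpace.toDual ℝ Plane).symm f) hf0.le fun z hz => by
        rw [InnerProductSpace.toDual_symm_apply]
        exact (hf z (subset_convexHull ℝ _ hz)).le).and self_mem_nhdsWithin).exists
    have hε0 : 0 < ε := hε
    have h1 := hPmove _ _ _ _ hR'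
    have h3 : 0 < 2 * ε * κ := by positivity
    have h2 : P (ω - ε • (InnerProductSpace.toDual ℝ Plane).symm f, R') ≤ P q₁ :=
      hmax₁ ⟨hR'0, by rw [h1]; linarith [hq.2.1], hR'D⟩
    have h4 : P q₁ ≤ P (ω, R) := hPq
    linarith
  refine ⟨ω, R, hRpos, hω, hD, hconv, ?_⟩
  by_contra! hcard
  obtain ⟨a, b, hab⟩ : ∃ a b, Metric.closedBall ω R ∩ visible S e ⊆ {a, b} := by
    rw [hfin.encard_eq_coe_toFinset_card] at hcard
    have h3 : hfin.toFinset.card < 3 := by exact_mod_cast hcard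
    obtain ⟨a, ha⟩ := convexHull_nonempty_iff.1 ⟨0, hconv⟩
    have h4 := Finset.card_erase_of_mem (hfin.mem_toFinset.2 ha)
    obtain ⟨b, hb⟩ := Finset.card_le_one_iff_subset_singleton.1 (by omega :
      (hfin.toFinset.erase a).card ≤ 1)
    refine ⟨a, b, fun z hz => ?_⟩
    by_cases hza : z = a
    · exact Or.inl hza
    · simpa [hza] using hb (Finset.mem_erase.2 ⟨hza, hfin.mem_toFinset.2 hz⟩)
  -- The origin lies on the segment from `a` to `b`, so `a` and `b` are on a line through it and
  -- have a common normal.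
  obtain ⟨u, hu0, hua, hub⟩ : ∃ u : Plane, u ≠ 0 ∧ inner ℝ u a = 0 ∧ inner ℝ u b = 0 := by
    have h := convexHull_mono hab hconv
    rw [convexHull_pair, segment_eq_image] at h
    obtain ⟨t, ht, htab⟩ := h
    by_cases ht0 : t = 0
    · have ha : a = 0 := by simpa [ht0] using htab
      obtain ⟨u, hu, hub⟩ := exists_ne_zero_inner_eq_zero b
      exact ⟨u, hu, by simp [ha], hub⟩
    · obtain ⟨u, hu, hua⟩ := exists_ne_zero_inner_eq_zero a
      refine ⟨u, hu, hua, ?_⟩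
      have := congrArg (inner ℝ u) htab
      simpa [inner_add_right, real_inner_smul_right, hua, ht0] using this
  -- With this sign, `R'² = R² - 2ε⟪u, ω⟫ + ε²|u|²` exceeds `R²`.
  obtain ⟨u, hu0, hua, hub, huω⟩ : ∃ u : Plane, u ≠ 0 ∧ inner ℝ u a = 0 ∧ inner ℝ u b = 0 ∧
      inner ℝ u ω ≤ 0 := by
    rcases le_total (inner ℝ u ω) 0 with h | h
    · exact ⟨u, hu0, hua, hub, h⟩
    · exact ⟨-u, neg_ne_zero.2 hu0, by simp [hua], by simp [hub], by simpa using h⟩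
  obtain ⟨ε, ⟨R', hR'0, hR', hR'D⟩, hε⟩ := ((hS.eventually_ball_subset_devDomain h0 hRpos hω hD
    (u := u) le_rfl fun z hz => by
      rcases hab hz with h | h <;> rw [h]
      exacts [hua.ge, hub.ge]).and self_mem_nhdsWithin).exists
  have hε0 : 0 < ε := hε
  have h1 := hPmove _ _ _ _ hR'
  rw [mul_zero, add_zero] at h1
  have h2 : R' ≤ R := hmax₂ (a := (ω - ε • u, R')) ⟨⟨hR'0, by rw [h1]; exact hq.2.1, hR'D⟩, by
    change P q₁ ≤ P _
    rw [h1]; exact hPq⟩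
  have h3 : R' ^ 2 ≤ R ^ 2 := pow_le_pow_left₀ hR'0 h2 2
  have h4 : 0 < ε ^ 2 * ‖u‖ ^ 2 := by
    have := norm_pos_iff.2 hu0
    positivity
  nlinarith

theorem IsDelaunayDisc.comp {ω : Plane} {R : ℝ} {φ : Plane → X} (h : IsDelaunayDisc S ω R φ)
    (g : Plane ≃ᵃⁱ[ℝ] Plane) : IsDelaunayDisc S (g.symm ω) R (φ ∘ g) ∧
      markedPoints S (g.symm ω) R (φ ∘ g) = g ⁻¹' markedPoints S ω R φ := by
  obtain ⟨hR, hc, hD, h3⟩ := h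
  have hcb : Metric.closedBall (g.symm ω) R = g ⁻¹' Metric.closedBall ω R := by
    ext y
    rw [mem_preimage, Metric.mem_closedBall, Metric.mem_closedBall, ← g.dist_map,
      g.apply_symm_apply]
  have hb : Metric.ball (g.symm ω) R = g ⁻¹' Metric.ball ω R := by
    ext y
    rw [mem_preimage, Metric.mem_ball, Metric.mem_ball, ← g.dist_map, g.apply_symm_apply]
  have hm : markedPoints S (g.symm ω) R (φ ∘ g) = g ⁻¹' markedPoints S ω R φ := by
    ext y
    rw [mem_preimage, markedPoints, markedPoints, hcb]
    rfl
  refine ⟨⟨hR, ?_, ?_, ?_⟩, hm⟩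
  · rw [hcb]
    exact hc.comp g.continuous.continuousOn (mapsTo_preimage _ _)
  · rw [hb]
    exact Dev.comp (S := S) hD Metric.isOpen_ball g
  · rw [hm, Set.encard_preimage_of_bijective g.bijective]
    exact h3

/-- Each point off `S` lies in a Delaunay cell. -/
theorem IsMarkedSurface.exists_isDelaunayDisc (hS : IsMarkedSurface S) {x : X} (hx : x ∉ S) :
    ∃ R φ y, IsDelaunayDisc S 0 R φ ∧ y ∈ Metric.ball (0 : Plane) R ∧
      y ∈ convexHull ℝ (markedPoints S 0 R φ) ∧ φ y = x := by
  have := hS.compact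
  obtain ⟨ε, e, he, -⟩ := hS.exists_flatChart hx
  have hl : LocIso e 0 := he.locIso (Metric.mem_ball_self he.pos)
  have heS : e 0 ∉ S := by rwa [he.map_zero]
  have h0 := hS.zero_mem_devDomain hl heS
  obtain ⟨ω, R, hR, hω, hD, hconv, h3⟩ := hS.exists_maximal_disc hl heS
  set φ := extendFrom (Metric.ball ω R) (devMap S e) with hφ
  have hΦ : Dev S (Metric.ball ω R) (devMap S e) := hS.dev_devMap.mono hD
  have heq := hΦ.eqOn_extendFrom Metric.isOpen_ball
  have hm : markedPoints S ω R φ = Metric.closedBall ω R ∩ visible S e := by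
    ext z
    refine and_congr_right fun hz => ?_
    exact hS.extendFrom_mem_iff h0 Metric.isOpen_ball (convex_ball _ _) hω hD
      (by rwa [closure_ball ω hR.ne'])
  have hdisc : IsDelaunayDisc S ω R φ := by
    refine ⟨hR, ?_, ?_, by rwa [hm]⟩
    · have := hΦ.continuousOn_extendFrom (convex_ball ω R)
      rwa [closure_ball ω hR.ne'] at this
    · exact hΦ.congr Metric.isOpen_ball heq.symm
  have hφ0 : φ 0 = x := by
    rw [hφ, heq hω, (hS.devMap_eventuallyEq hl heS).self_of_nhds, he.map_zero]
  obtain ⟨h1, h2⟩ := hdisc.comp (AffineIsometryEquiv.vaddConst ℝ ω)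
  have hsymm : (AffineIsometryEquiv.vaddConst ℝ ω).symm ω = 0 := by simp
  rw [hsymm] at h1 h2
  refine ⟨R, _, -ω, h1, ?_, ?_, ?_⟩
  · simpa using hω
  · rw [h2, hm]
    have himg := (AffineIsometryEquiv.vaddConst ℝ ω).symm.toAffineEquiv.toAffineMap.image_convexHull
      (Metric.closedBall ω R ∩ visible S e)
    have : (AffineIsometryEquiv.vaddConst ℝ ω).symm '' (Metric.closedBall ω R ∩ visible S e) =
        (AffineIsometryEquiv.vaddConst ℝ ω) ⁻¹' (Metric.closedBall ω R ∩ visible S e) :=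
      (AffineIsometryEquiv.vaddConst ℝ ω).symm.toEquiv.image_eq_preimage_symm _
    rw [← this]
    refine himg ▸ ⟨0, hconv, ?_⟩
    simp
  · simp [hφ0]

end Cover

/-! ### Finiteness of the set of centres of Delaunay discs -/

section Voronoi

variable {X : Type*} [MetricSpace X] {S : Set X} {e : Plane → X}

theorem exists_three_of_encard {α : Type*} {M : Set α} (h : 3 ≤ M.encard) :
    ∃ a ∈ M, ∃ b ∈ M, ∃ c ∈ M, a ≠ b ∧ a ≠ c ∧ b ≠ c := by
  obtain ⟨t, ht, h3⟩ := Set.exists_subset_encard_eq h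
  obtain ⟨a, b, c, hab, hac, hbc, rfl⟩ := Set.encard_eq_three.1 h3
  exact ⟨a, ht (by simp), b, ht (by simp), c, ht (by simp), hab, hac, hbc⟩

theorem IsDelaunayDisc.dist_le {ω : Plane} {R : ℝ} {φ : Plane → X} (h : IsDelaunayDisc S ω R φ)
    {y z : Plane} (hy : y ∈ Metric.closedBall ω R) (hz : z ∈ Metric.closedBall ω R) :
    dist (φ y) (φ z) ≤ dist y z := by
  have hl := Dev.lipschitzOnWith (S := S) h.2.2.1 (convex_ball ω R)
  have hc := h.2.1
  rw [← closure_ball ω h.1.ne'] at hy hz hc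
  simpa using (hl.closure hc).dist_le_mul y hy z hz

theorem IsDelaunayDisc.dev {ω : Plane} {R : ℝ} {φ : Plane → X} (h : IsDelaunayDisc S ω R φ) :
    Dev S (Metric.ball ω R) φ := h.2.2.1

theorem IsDelaunayDisc.dist_eq_of_mem {ω : Plane} {R : ℝ} {φ : Plane → X}
    (h : IsDelaunayDisc S ω R φ) {z : Plane} (hz : z ∈ markedPoints S ω R φ) :
    dist z ω = R := by
  refine le_antisymm hz.1 ?_
  by_contra! hlt
  exact (h.dev z hlt).1 hz.2

theorem IsMarkedSurface.dist_center_eq (hS : IsMarkedSurface S) {ω : Plane} {R : ℝ}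
    {φ : Plane → X} (h : IsDelaunayDisc S ω R φ) {z : Plane} (hz : z ∈ markedPoints S ω R φ) :
    dist (φ ω) (φ z) = R := by
  refine le_antisymm ?_ (hS.radius_le_dist h.dev hz.2)
  rw [← h.dist_eq_of_mem hz, dist_comm z]
  exact h.dist_le (Metric.mem_closedBall_self h.1.le) hz.1

/-- Consequently the radius of a Delaunay disc depends only on its centre in the surface. -/
theorem IsMarkedSurface.radius_eq_infDist (hS : IsMarkedSurface S) {ω : Plane} {R : ℝ}
    {φ : Plane → X} (h : IsDelaunayDisc S ω R φ) : R = Metric.infDist (φ ω) S := by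
  refine le_antisymm ((Metric.le_infDist hS.nonempty).2 fun s hs =>
    hS.radius_le_dist h.dev hs) ?_
  obtain ⟨z, hz, -⟩ := exists_three_of_encard h.2.2.2
  rw [← hS.dist_center_eq h hz]
  exact Metric.infDist_le_dist_of_mem hz.2

theorem IsMarkedSurface.infDist_le_norm_of_mem_visible (hS : IsMarkedSurface S) (he : LocIso e 0)
    (heS : e 0 ∉ S) {z : Plane} (hz : z ∈ visible S e) : Metric.infDist (e 0) S ≤ ‖z‖ := by
  have h0 := hS.zero_mem_devDomain he heS
  obtain ⟨s, hs, hlim⟩ := hS.exists_tendsto_of_mem_visible h0 hz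
  refine (Metric.infDist_le_dist_of_mem hs).trans ?_
  refine le_of_tendsto (tendsto_const_nhds.dist hlim) ?_
  filter_upwards [Ioo_mem_nhdsLT zero_lt_one] with t ht
  have h1 := hS.dist_devMap_smul_le hz (t := 0) (t' := t) (by simp) ⟨ht.1.le, ht.2⟩
  rw [zero_smul, (hS.devMap_eventuallyEq he heS).self_of_nhds, zero_sub, abs_neg,
    abs_of_pos ht.1] at h1
  refine h1.trans ?_
  nlinarith [ht.2, norm_nonneg z]

/-- The centres of the Delaunay discs. -/
def centers (S : Set X) : Set X := {p | ∃ R φ, IsDelaunayDisc S 0 R φ ∧ φ 0 = p}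

/-- For a centre close to `s` all marked points are sent to `s`, so the radii to two of them are
shortest paths from the centre to `s`. These are unique near `s`, while the chart is injective near
the centre. -/
theorem IsMarkedSurface.eventually_notMem_centers_of_mem (hS : IsMarkedSurface S) {s : X}
    (hs : s ∈ S) : ∀ᶠ q in 𝓝 s, q ∉ centers S := by
  obtain ⟨θ, hθ⟩ := hS.conical s
  obtain ⟨ε, hε, hrad⟩ := exists_unique_radial hθ
  obtain ⟨ρ, hρ, hsep⟩ := exists_pos_forall_dist_lt hS.finite
  filter_upwards [Metric.ball_mem_nhds s hε, Metric.ball_mem_nhds s (half_pos hρ)] with q hqε hqρ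
  rintro ⟨R, φ, hφ, rfl⟩
  rw [Metric.mem_ball] at hqρ
  have hRs : R ≤ dist (φ 0) s := hS.radius_le_dist hφ.dev hs
  have hmarked : ∀ z ∈ markedPoints S 0 R φ, φ z = s := by
    intro z hz
    refine hsep _ hz.2 _ hs ?_
    have := hS.dist_center_eq hφ hz
    linarith [dist_triangle_left (φ z) s (φ 0)]
  obtain ⟨a, ha, b, hb, -, -, hab, -⟩ := exists_three_of_encard hφ.2.2.2
  have hR : dist (φ 0) s = R := by rw [← hmarked a ha]; exact hS.dist_center_eq hφ ha
  have h0 : (0 : Plane) ∈ Metric.closedBall 0 R := Metric.mem_closedBall_self hφ.1.le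
  have hray : ∀ z ∈ markedPoints S 0 R φ, ∀ t ∈ Icc (0 : ℝ) 1,
      dist (φ 0) (φ (t • z)) = t * R ∧ dist (φ (t • z)) s = (1 - t) * R := by
    intro z hz t ht
    have hzn : ‖z‖ = R := by rw [← dist_zero_right]; exact hφ.dist_eq_of_mem hz
    have h1 : dist 0 (t • z) = t * R := by
      rw [dist_zero_left, norm_smul, Real.norm_of_nonneg ht.1, hzn]
    have h2 : dist (t • z) z = (1 - t) * R := by
      rw [dist_comm, dist_eq_norm]
      have : z - t • z = (1 - t) • z := by rw [sub_smul, one_smul]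
      rw [this, norm_smul, Real.norm_of_nonneg (by linarith [ht.2]), hzn]
    have htz : t • z ∈ Metric.closedBall (0 : Plane) R := by
      rw [Metric.mem_closedBall, dist_comm, h1]
      nlinarith [ht.2, hφ.1]
    have h3 := hφ.dist_le h0 htz
    have h4 := hφ.dist_le htz hz.1
    rw [hmarked z hz] at h4
    have := dist_triangle (φ 0) (φ (t • z)) s
    constructor <;> linarith
  have heq : ∀ t ∈ Icc (0 : ℝ) 1, φ (t • a) = φ (t • b) := by
    intro t ht
    obtain ⟨h1, h2⟩ := hray a ha t ht
    obtain ⟨h3, h4⟩ := hray b hb t ht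
    refine hrad (φ 0) hqε _ _ ?_ ?_ (by rw [h1, h3])
    · rw [h1, h2, hR]; ring
    · rw [h3, h4, hR]; ring
  obtain ⟨δ, hδ, hiso⟩ := hφ.dev.locIso Metric.isOpen_ball (Metric.mem_ball_self hφ.1)
  have hlim : ∀ z : Plane, ∀ᶠ t in 𝓝[>] (0 : ℝ), t • z ∈ Metric.ball (0 : Plane) δ := by
    intro z
    have hc : ContinuousAt (fun t : ℝ => t • z) 0 := by fun_prop
    refine (hc.eventually (Metric.ball_mem_nhds _ ?_)).filter_mono nhdsWithin_le_nhds |>.mono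
      fun t ht => by simpa using ht
    exact hδ
  obtain ⟨t, ⟨hta, htb⟩, ht⟩ := (((hlim a).and (hlim b)).and
    (Ioo_mem_nhdsGT zero_lt_one : Ioo (0 : ℝ) 1 ∈ 𝓝[>] 0)).exists
  have := hiso _ hta _ htb
  rw [heq t ⟨ht.1.le, ht.2.le⟩, dist_self, eq_comm, dist_eq_zero] at this
  exact hab (smul_right_injective Plane ht.1.ne' this)

/-- Developed from `p`, the marked points of a disc with a nearby centre `x ≠ 0` are visible and
close to the disc of radius `r = infDist p S`, so they lie on its boundary circle. They also lie on
a circle centred at `x`, and these circles share at most two points. -/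
theorem IsMarkedSurface.eventually_notMem_centers_of_notMem (hS : IsMarkedSurface S) {p : X}
    (hp : p ∉ S) : ∀ᶠ q in 𝓝[≠] p, q ∉ centers S := by
  have hcomp := hS.compact
  obtain ⟨ε, e, he, heS⟩ := hS.exists_flatChart hp
  have hm0 : (0 : Plane) ∈ Metric.ball 0 ε := Metric.mem_ball_self he.pos
  have hl : LocIso e 0 := he.locIso hm0
  have h0 := hS.zero_mem_devDomain hl (heS 0 hm0)
  have hedev : Dev S (Metric.ball 0 ε) e :=
    (dev_iff Metric.isOpen_ball).2 fun y hy => ⟨heS y hy, he.locIso hy⟩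
  set r := Metric.infDist p S with hr
  have hr0 : 0 < r := (hS.finite.isClosed.notMem_iff_infDist_pos hS.nonempty).1 hp
  have hmr : (0 : Plane) ∈ Metric.ball 0 r := Metric.mem_ball_self hr0
  have hrΩ : Metric.ball 0 r ⊆ devDomain S e := by
    refine subset_devDomain_of_disjoint h0 (convex_ball _ _) hmr fun z hz hzr => ?_
    have := hS.infDist_le_norm_of_mem_visible hl (heS 0 hm0) hz
    rw [he.map_zero] at this
    exact absurd (mem_ball_zero_iff.1 hzr) (not_lt.2 this)
  obtain ⟨N, hN, hDN, -, hNv⟩ := hS.exists_open_inter_visible_finite h0 Metric.isOpen_ball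
    (convex_ball (0 : Plane) r) hmr hrΩ Metric.isBounded_ball
  rw [closure_ball _ hr0.ne'] at hDN hNv
  obtain ⟨η, hη, hηN⟩ := (isCompact_closedBall (0 : Plane) r).exists_thickening_subset_open hN hDN
  rw [thickening_closedBall hη hr0.le] at hηN
  have hpos : 0 < min ε (min (η / 2) (r / 2)) :=
    lt_min he.pos (lt_min (half_pos hη) (half_pos hr0))
  filter_upwards [nhdsWithin_le_nhds (Metric.ball_mem_nhds p hpos), self_mem_nhdsWithin] with q hq
    hqp
  rintro ⟨R, φ, hφ, rfl⟩
  have hq' := Metric.mem_ball.1 hq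
  have hqε := hq'.trans_le (min_le_left _ _)
  have hqη := hq'.trans_le ((min_le_right _ _).trans (min_le_left _ _))
  have hqr := hq'.trans_le ((min_le_right _ _).trans (min_le_right _ _))
  obtain ⟨x, hx, hxq⟩ := he.surj _ (Metric.mem_ball.2 hqε)
  have hxn : ‖x‖ = dist (φ 0) p := by rw [← hxq, he.dist_center hx]
  have hx0 : x ≠ 0 := by
    rintro rfl
    exact hqp (by rw [mem_singleton_iff, ← hxq, he.map_zero])
  have hRinf := hS.radius_eq_infDist hφ
  have hR1 : R ≤ r + dist (φ 0) p := hRinf ▸ Metric.infDist_le_infDist_add_dist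
  have hR2 : r ≤ R + dist (φ 0) p := by
    rw [hRinf, dist_comm]; exact Metric.infDist_le_infDist_add_dist
  have hmR : (0 : Plane) ∈ Metric.ball 0 R := Metric.mem_ball_self hφ.1
  obtain ⟨g, hgx, hg⟩ := hS.exists_transition (he.locIso hx)
    (hφ.dev.locIso Metric.isOpen_ball hmR) hxq (heS x hx)
  have hDq : g ⁻¹' Metric.ball 0 R = Metric.ball x R := by
    ext y
    rw [mem_preimage, Metric.mem_ball, Metric.mem_ball, ← hgx, g.dist_map]
  have hψ : Dev S (Metric.ball x R) (φ ∘ g) := hDq ▸ hφ.dev.comp Metric.isOpen_ball g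
  have h0D : (0 : Plane) ∈ Metric.ball x R := by
    rw [Metric.mem_ball, dist_comm, dist_zero_right]; linarith
  have hagree : EqOn e (φ ∘ g) (Metric.ball 0 ε ∩ Metric.ball x R) :=
    hS.eqOn_of_dev (Metric.isOpen_ball.inter Metric.isOpen_ball)
      ((convex_ball _ _).inter (convex_ball _ _)).isPreconnected (hedev.mono inter_subset_left)
      (hψ.mono inter_subset_right) ⟨hx, Metric.mem_ball_self hφ.1⟩ hg
  have hev : φ ∘ g =ᶠ[𝓝 0] e := hagree.symm.eventuallyEq_of_mem
    ((Metric.isOpen_ball.inter Metric.isOpen_ball).mem_nhds ⟨hm0, h0D⟩)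
  have hDΩ : Metric.ball x R ⊆ devDomain S e := fun y hy =>
    ⟨_, _, Metric.isOpen_ball, convex_ball _ _, h0D, hy, hψ, hev⟩
  have hΦ := hS.eqOn_devMap Metric.isOpen_ball (convex_ball _ _) h0D hψ hev
  have hkey : ∀ z ∈ markedPoints S 0 R φ, dist (g.symm z) 0 = r ∧ dist (g.symm z) x = R := by
    intro z hz
    have hzx : dist (g.symm z) x = R := by
      rw [← g.dist_map, g.apply_symm_apply, hgx]
      exact hφ.dist_eq_of_mem hz
    have hzcl : g.symm z ∈ closure (Metric.ball x R) := by
      rw [closure_ball _ hφ.1.ne']; exact hzx.le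
    have hlim : Tendsto (devMap S e) (𝓝[Metric.ball x R] (g.symm z)) (𝓝 (φ z)) := by
      have h1 := (hφ.2.1 z hz.1).tendsto
      have h2 : Tendsto g (𝓝[Metric.ball x R] (g.symm z)) (𝓝[Metric.closedBall 0 R] z) := by
        refine tendsto_nhdsWithin_iff.2 ⟨?_, ?_⟩
        · have := g.continuous.tendsto (g.symm z)
          rw [g.apply_symm_apply] at this
          exact this.mono_left nhdsWithin_le_nhds
        · filter_upwards [self_mem_nhdsWithin] with y hy
          rw [← hDq] at hy
          exact Metric.ball_subset_closedBall hy
      refine (h1.comp h2).congr' ?_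
      filter_upwards [self_mem_nhdsWithin] with y hy using (hΦ hy).symm
    have hzv : g.symm z ∈ visible S e := by
      rw [← hS.extendFrom_mem_iff h0 Metric.isOpen_ball (convex_ball _ _) h0D hDΩ hzcl,
        extendFrom_eq hzcl hlim]
      exact hz.2
    have hzN : g.symm z ∈ N := hηN (by
      rw [Metric.mem_ball]
      have := dist_triangle (g.symm z) x 0
      rw [dist_zero_right x] at this
      linarith)
    refine ⟨le_antisymm (hNv ⟨hzN, hzv⟩) ?_, hzx⟩
    by_contra! hlt
    exact hzv.1 (hrΩ hlt)
  obtain ⟨a, ha, b, hb, c, hc, hab, hac, hbc⟩ := exists_three_of_encard hφ.2.2.2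
  obtain ⟨ha1, ha2⟩ := hkey a ha
  obtain ⟨hb1, hb2⟩ := hkey b hb
  obtain ⟨hc1, hc2⟩ := hkey c hc
  have hinj := g.symm.injective
  rcases EuclideanGeometry.eq_of_dist_eq_of_dist_eq_of_finrank_eq_two (V := Plane) (P := Plane)
    (by simp) hx0.symm (hinj.ne hab) ha1 hb1 hc1 ha2 hb2 hc2 with h | h
  · exact hac (hinj h).symm
  · exact hbc (hinj h).symm

theorem IsMarkedSurface.finite_centers (hS : IsMarkedSurface S) : (centers S).Finite := by
  have := hS.compact
  by_contra hinf
  obtain ⟨p, -, hp⟩ := Set.Infinite.exists_accPt_of_subset_isCompact hinf isCompact_univ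
    (subset_univ _)
  rw [accPt_iff_frequently_nhdsNE] at hp
  by_cases hpS : p ∈ S
  · exact hp (((hS.eventually_notMem_centers_of_mem hpS).filter_mono nhdsWithin_le_nhds).mono
      fun q hq => hq)
  · exact hp ((hS.eventually_notMem_centers_of_notMem hpS).mono fun q hq => hq)

/-- The marked points are visible from the centre, and only finitely many endpoints lie around a
bounded developed disc. -/
theorem IsMarkedSurface.finite_markedPoints (hS : IsMarkedSurface S) {R : ℝ} {φ : Plane → X}
    (hφ : IsDelaunayDisc S 0 R φ) : (markedPoints S 0 R φ).Finite := by
  have hcomp := hS.compact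
  have hmR : (0 : Plane) ∈ Metric.ball 0 R := Metric.mem_ball_self hφ.1
  have hl := hφ.dev.locIso Metric.isOpen_ball hmR
  have h0 := hS.zero_mem_devDomain hl (hφ.dev 0 hmR).1
  have hDΩ : Metric.ball 0 R ⊆ devDomain S φ := fun y hy =>
    ⟨_, _, Metric.isOpen_ball, convex_ball _ _, hmR, hy, hφ.dev, EventuallyEq.rfl⟩
  obtain ⟨N, -, hDN, hfin, -⟩ := hS.exists_open_inter_visible_finite h0 Metric.isOpen_ball
    (convex_ball (0 : Plane) R) hmR hDΩ Metric.isBounded_ball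
  refine hfin.subset fun z hz => ?_
  have hzcl : z ∈ closure (Metric.ball 0 R) := by rw [closure_ball _ hφ.1.ne']; exact hz.1
  refine ⟨hDN hzcl, ?_⟩
  rw [← hS.extendFrom_mem_iff h0 Metric.isOpen_ball (convex_ball _ _) hmR hDΩ hzcl]
  have hlim : Tendsto (devMap S φ) (𝓝[Metric.ball 0 R] z) (𝓝 (φ z)) := by
    refine ((hφ.2.1 z hz.1).tendsto.mono_left
      (nhdsWithin_mono _ Metric.ball_subset_closedBall)).congr' ?_
    filter_upwards [self_mem_nhdsWithin] with y hy using
      (hS.eqOn_devMap Metric.isOpen_ball (convex_ball _ _) hmR hφ.dev EventuallyEq.rfl hy).symm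
  rw [extendFrom_eq hzcl hlim]
  exact hz.2

end Voronoi

/-! ### Triangulations of planar polygons by lower convex hulls -/

theorem affineMap_sum {ι : Type*} (A : Plane →ᵃ[ℝ] ℝ) (s : Finset ι) (w : ι → ℝ) (v : ι → Plane)
    (hw : ∑ i ∈ s, w i = 1) : A (∑ i ∈ s, w i • v i) = ∑ i ∈ s, w i * A (v i) := by
  have h : ∀ y, A y = A.linear y + A 0 := fun y => congrFun A.decomp y
  rw [h, map_sum]
  simp_rw [h (v _), mul_add, Finset.sum_add_distrib, ← Finset.sum_mul, hw, one_mul, map_smul,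
    smul_eq_mul]

/-- The affine basis of the plane formed by the vertices of a nondegenerate triangle. -/
def triangleBasis {v : Fin 3 → Plane} (hv : AffineIndependent ℝ v) : AffineBasis (Fin 3) ℝ Plane :=
  ⟨v, hv, hv.affineSpan_eq_top_iff_card_eq_finrank_add_one.2 (by simp)⟩

/-- The affine function with given values at the vertices of a triangle. -/
def interp {v : Fin 3 → Plane} (hv : AffineIndependent ℝ v) (τ : Fin 3 → ℝ) : Plane →ᵃ[ℝ] ℝ :=
  ∑ k, τ k • (triangleBasis hv).coord k

theorem interp_apply {v : Fin 3 → Plane} (hv : AffineIndependent ℝ v) (τ : Fin 3 → ℝ) (x : Plane) :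
    interp hv τ x = ∑ k, τ k * (triangleBasis hv).coord k x := by
  simp [interp, Fin.sum_univ_three]

theorem triangleBasis_coord_vertex {v : Fin 3 → Plane} (hv : AffineIndependent ℝ v) (k j : Fin 3) :
    (triangleBasis hv).coord k (v j) = if k = j then 1 else 0 :=
  (triangleBasis hv).coord_apply k j

theorem interp_vertex {v : Fin 3 → Plane} (hv : AffineIndependent ℝ v) (τ : Fin 3 → ℝ)
    (k : Fin 3) : interp hv τ (v k) = τ k := by
  simp [interp_apply, triangleBasis_coord_vertex]

theorem triangleBasis_sum {v : Fin 3 → Plane} (hv : AffineIndependent ℝ v) (x : Plane) :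
    ∑ k, (triangleBasis hv).coord k x = 1 := (triangleBasis hv).sum_coord_apply_eq_one x

theorem triangleBasis_sum_smul {v : Fin 3 → Plane} (hv : AffineIndependent ℝ v) (x : Plane) :
    ∑ k, (triangleBasis hv).coord k x • v k = x :=
  (triangleBasis hv).linear_combination_coord_eq_self x

theorem coord_sum_smul {v : Fin 3 → Plane} (hv : AffineIndependent ℝ v) {w : Fin 3 → ℝ}
    (hw : ∑ k, w k = 1) (k : Fin 3) : (triangleBasis hv).coord k (∑ j, w j • v j) = w k := by
  rw [affineMap_sum _ _ _ _ hw]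
  simp [triangleBasis_coord_vertex]

theorem mem_convexHull_range_iff (v : Fin 3 → Plane) (x : Plane) : x ∈ convexHull ℝ (range v) ↔
    ∃ w : Fin 3 → ℝ, (∀ k, 0 ≤ w k) ∧ ∑ k, w k = 1 ∧ ∑ k, w k • v k = x := by
  rw [convexHull_range_eq_exists_affineCombination]
  constructor
  · rintro ⟨s, w, hw0, hw1, rfl⟩
    refine ⟨fun k => if k ∈ s then w k else 0, fun k => ?_, ?_, ?_⟩
    · by_cases h : k ∈ s
      · simp [h, hw0 k h]
      · simp [h]
    · simpa using hw1
    · rw [Finset.affineCombination_eq_linear_combination _ _ _ hw1]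
      simp [ite_smul]
  · rintro ⟨w, hw0, hw1, rfl⟩
    exact ⟨Finset.univ, w, fun k _ => hw0 k, hw1,
      Finset.affineCombination_eq_linear_combination _ _ _ hw1⟩

theorem openFace_subset_convexHull (v : Fin 3 → Plane) (F : Finset (Fin 3)) :
    openFace v F ⊆ convexHull ℝ (range v) := by
  rintro x ⟨w, h1, h2, h3, rfl⟩
  refine (mem_convexHull_range_iff v _).2 ⟨w, fun k => ?_, h3, rfl⟩
  by_cases h : k ∈ F
  · exact (h1 k h).le
  · exact (h2 k h).ge

theorem exists_mem_openFace {v : Fin 3 → Plane} {x : Plane} (hx : x ∈ convexHull ℝ (range v)) :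
    ∃ F, x ∈ openFace v F := by
  obtain ⟨w, h0, h1, rfl⟩ := (mem_convexHull_range_iff v x).1 hx
  refine ⟨Finset.univ.filter fun k => 0 < w k, w, fun k hk => (Finset.mem_filter.1 hk).2,
    fun k hk => ?_, h1, rfl⟩
  by_contra h
  exact hk (Finset.mem_filter.2 ⟨Finset.mem_univ _, (h0 k).lt_of_ne (Ne.symm h)⟩)

theorem dense_biInter_finset {Y ι : Type*} [TopologicalSpace Y] (s : Finset ι) {U : ι → Set Y}
    (ho : ∀ i ∈ s, IsOpen (U i)) (hd : ∀ i ∈ s, Dense (U i)) :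
    IsOpen (⋂ i ∈ s, U i) ∧ Dense (⋂ i ∈ s, U i) := by
  classical
  induction s using Finset.induction_on with
  | empty => simp
  | insert a s _ ih =>
    obtain ⟨h1, h2⟩ := ih (fun i hi => ho i (Finset.mem_insert_of_mem hi))
      fun i hi => hd i (Finset.mem_insert_of_mem hi)
    have ha := Finset.mem_insert_self a s
    rw [Finset.set_biInter_insert]
    exact ⟨(ho a ha).inter h1, (hd a ha).inter_of_isOpen_left h2 (ho a ha)⟩

theorem dense_compl_segment (a b : Plane) : Dense (segment ℝ a b)ᶜ := by
  rw [← interior_eq_empty_iff_dense_compl, ← not_nonempty_iff_eq_empty, ← convexHull_pair,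
    interior_convexHull_nonempty_iff_affineSpan_eq_top]
  intro h
  have h1 : Module.finrank ℝ (vectorSpan ℝ ({a, b} : Set Plane)) ≤ 1 :=
    collinear_iff_finrank_le_one.1 (collinear_pair ℝ a b)
  rw [← direction_affineSpan, h, AffineSubspace.direction_top, finrank_top] at h1
  simp at h1

/-- Each condition `ℓ j σ ≠ 0` is open and, by moving along `ρ`, dense; the strict inequalities
satisfied by `τ` persist nearby. This breaks ties among heights without spoiling what is already
strict. -/
theorem exists_perturbation {J : Type*} (s : Finset J) (ℓ : J → (Plane → ℝ) → ℝ)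
    (hℓ : ∀ j ∈ s, Continuous (ℓ j))
    (hd : ∀ j ∈ s, ∃ ρ : Plane → ℝ, ∀ σ : Plane → ℝ, ∀ ε : ℝ, ℓ j (σ + ε • ρ) = ℓ j σ - ε)
    (τ : Plane → ℝ) :
    ∃ σ : Plane → ℝ, ∀ j ∈ s, ℓ j σ ≠ 0 ∧ (0 < ℓ j τ → 0 < ℓ j σ) := by
  obtain ⟨-, hdense⟩ := dense_biInter_finset (U := fun j => {σ | ℓ j σ ≠ 0}) s
    (fun j hj => isOpen_ne_fun (hℓ j hj) continuous_const) fun j hj => by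
      obtain ⟨ρ, hρ⟩ := hd j hj
      intro σ
      have hc : ContinuousAt (fun ε : ℝ => σ + ε • ρ) 0 := by fun_prop
      have hlim : Tendsto (fun ε : ℝ => σ + ε • ρ) (𝓝[≠] 0) (𝓝 σ) := by
        simpa using hc.tendsto.mono_left (nhdsWithin_le_nhds (s := {0}ᶜ))
      refine mem_closure_of_tendsto hlim ?_
      have hne : ∀ᶠ ε in 𝓝[≠] (0 : ℝ), ε ≠ ℓ j σ := by
        by_cases h : ℓ j σ = 0
        · rw [h]; exact self_mem_nhdsWithin
        · exact nhdsWithin_le_nhds (isOpen_ne.mem_nhds (Ne.symm h))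
      filter_upwards [hne] with ε hε
      rw [hρ, sub_ne_zero]
      exact hε.symm
  have hopen : ∀ᶠ σ in 𝓝 τ, ∀ j ∈ s, 0 < ℓ j τ → 0 < ℓ j σ := by
    rw [Finset.eventually_all]
    intro j hj
    by_cases h : 0 < ℓ j τ
    · exact ((hℓ j hj).continuousAt.eventually_const_lt h).mono fun σ hσ _ => hσ
    · exact Eventually.of_forall fun σ h' => absurd h' h
  obtain ⟨V, hV, hVo, hτV⟩ := mem_nhds_iff.1 hopen
  obtain ⟨σ, hσV, hσ⟩ := hdense.inter_open_nonempty V hVo ⟨τ, hτV⟩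
  refine ⟨σ, fun j hj => ⟨mem_iInter₂.1 hσ j hj, hV hσV j hj⟩⟩

/-- An enumeration of a set with three elements. -/
def enum {t : Finset Plane} (ht : t.card = 3) (k : Fin 3) : Plane :=
  ((t.equivFinOfCardEq ht).symm k : Plane)

theorem enum_injective {t : Finset Plane} (ht : t.card = 3) : Function.Injective (enum ht) :=
  Subtype.val_injective.comp (t.equivFinOfCardEq ht).symm.injective

theorem range_enum {t : Finset Plane} (ht : t.card = 3) : range (enum ht) = t := by
  ext x
  constructor
  · rintro ⟨k, rfl⟩
    exact Subtype.property _
  · intro hx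
    exact ⟨t.equivFinOfCardEq ht ⟨x, hx⟩, by simp [enum]⟩

theorem enum_mem {t : Finset Plane} (ht : t.card = 3) (k : Fin 3) : enum ht k ∈ t := by
  have := mem_range_self (f := enum ht) k
  rwa [range_enum] at this

theorem exists_enum_eq {t : Finset Plane} (ht : t.card = 3) {x : Plane} (hx : x ∈ t) :
    ∃ k, enum ht k = x := by
  have : x ∈ range (enum ht) := by rw [range_enum]; exact hx
  exact this

/-- No three points of `M` are aligned. -/
def NoThreeAligned (M : Finset Plane) : Prop :=
  ∀ v : Fin 3 → Plane, Function.Injective v → range v ⊆ M → AffineIndependent ℝ v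

section LowerHull

variable {M : Finset Plane}

theorem affineIndependent_enum (hM : NoThreeAligned M) {t : Finset Plane} (htM : t ⊆ M) (ht : t.card = 3) :
    AffineIndependent ℝ (enum ht) :=
  hM _ (enum_injective ht) (by rw [range_enum]; exact_mod_cast htM)

/-- If a point lies above the lifted triangle `t`, some triangle with vertices in `M` lies below
`t` at a given interior point of `t`. -/
theorem exists_lower_triangle (hM : NoThreeAligned M) {σ : Plane → ℝ} {t : Finset Plane} (htM : t ⊆ M) (ht : t.card = 3)
    {x : Plane} (hx : ∀ k, 0 < (triangleBasis (affineIndependent_enum hM htM ht)).coord k x)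
    {d : Plane} (hdM : d ∈ M) (hdt : d ∉ t)
    (hd : σ d < interp (affineIndependent_enum hM htM ht) (σ ∘ enum ht) d) :
    ∃ (t' : Finset Plane) (htM' : t' ⊆ M) (ht' : t'.card = 3), x ∈ convexHull ℝ (t' : Set Plane) ∧
      interp (affineIndependent_enum hM htM' ht') (σ ∘ enum ht') x <
        interp (affineIndependent_enum hM htM ht) (σ ∘ enum ht) x := by
  classical
  set hv := affineIndependent_enum hM htM ht
  set α : Fin 3 → ℝ := fun k => (triangleBasis hv).coord k x with hα
  set l : Fin 3 → ℝ := fun k => (triangleBasis hv).coord k d with hl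
  have hl1 : ∑ k, l k = 1 := triangleBasis_sum hv d
  have hα1 : ∑ k, α k = 1 := triangleBasis_sum hv x
  have hld : ∑ k, l k • enum ht k = d := triangleBasis_sum_smul hv d
  have hαx : ∑ k, α k • enum ht k = x := triangleBasis_sum_smul hv x
  obtain ⟨i₀, hi₀⟩ : ∃ i, 0 < l i := by
    by_contra! h
    have := Finset.sum_nonpos fun k (_ : k ∈ Finset.univ) => h k
    linarith
  -- An exchange as in the simplex method: the minimal ratio `α i / l i` is the largest weight that
  -- can be given to `d` while keeping all weights nonnegative, and vertex `i` is replaced by `d`.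
  -- The height over `x` changes by `s * (σ d - A d) < 0`, with `A` the interpolation on `t`.
  obtain ⟨i, hi, hmin⟩ := Finset.exists_min_image (Finset.univ.filter fun k => 0 < l k)
    (fun k => α k / l k) ⟨i₀, by simpa using hi₀⟩
  have hli : 0 < l i := by simpa using hi
  set s := α i / l i with hs
  have hs0 : 0 < s := div_pos (hx i) hli
  have hnn : ∀ k, 0 ≤ α k - s * l k := by
    intro k
    rcases le_or_gt (l k) 0 with h | h
    · have h1 : 0 < α k := hx k
      have h2 : s * l k ≤ 0 := mul_nonpos_of_nonneg_of_nonpos hs0.le h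
      linarith
    · have := hmin k (by simpa using h)
      rw [le_div_iff₀ h] at this
      linarith
  have hi0 : α i - s * l i = 0 := by rw [hs, div_mul_cancel₀ _ hli.ne', sub_self]
  set w : Fin 3 → ℝ := Function.update (fun k => α k - s * l k) i s with hw
  set v : Fin 3 → Plane := Function.update (enum ht) i d with hv'
  have hsum : ∀ {V : Type} [AddCommGroup V] [Module ℝ V] (a : Fin 3 → V) (y : V),
      ∑ k, w k • (Function.update a i y) k = ∑ k, α k • a k - s • ∑ k, l k • a k + s • y := by
    intro V _ _ a y
    rw [← Finset.add_sum_erase _ _ (Finset.mem_univ i)]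
    rw [← Finset.add_sum_erase _ (fun k => α k • a k) (Finset.mem_univ i),
      ← Finset.add_sum_erase _ (fun k => l k • a k) (Finset.mem_univ i)]
    have h1 : ∑ k ∈ Finset.univ.erase i, w k • (Function.update a i y) k =
        ∑ k ∈ Finset.univ.erase i, α k • a k - s • ∑ k ∈ Finset.univ.erase i, l k • a k := by
      rw [Finset.smul_sum, ← Finset.sum_sub_distrib]
      refine Finset.sum_congr rfl fun k hk => ?_
      have hki := Finset.ne_of_mem_erase hk
      rw [hw, Function.update_of_ne hki, Function.update_of_ne hki, sub_smul, mul_smul]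
    have h2 : α i • a i = s • l i • a i := by
      rw [smul_smul, ← sub_eq_zero, ← sub_smul, hi0, zero_smul]
    rw [h1, hw, Function.update_self, Function.update_self, h2, smul_add]
    abel
  have hwsum : ∑ k, w k = 1 := by
    have := hsum (fun _ => (1 : ℝ)) (1 : ℝ)
    simp only [smul_eq_mul, mul_one, hα1, hl1] at this
    rw [Function.update_eq_self_iff.2 rfl] at this
    simp only [mul_one] at this
    linarith
  have hwx : ∑ k, w k • v k = x := by
    rw [hv', hsum, hld, hαx, sub_add_cancel]
  have hwnn : ∀ k, 0 ≤ w k := by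
    intro k
    by_cases h : k = i
    · rw [h, hw, Function.update_self]; exact hs0.le
    · rw [hw, Function.update_of_ne h]; exact hnn k
  have hinj : Function.Injective v := by
    intro a b hab
    by_cases ha : a = i <;> by_cases hb : b = i
    · rw [ha, hb]
    · rw [hv', ha, Function.update_self, Function.update_of_ne hb] at hab
      exact absurd (hab ▸ enum_mem ht b) hdt
    · rw [hv', hb, Function.update_self, Function.update_of_ne ha] at hab
      exact absurd (hab ▸ enum_mem ht a) hdt
    · rw [hv', Function.update_of_ne ha, Function.update_of_ne hb] at hab
      exact enum_injective ht hab
  have hvM : ∀ k, v k ∈ M := by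
    intro k
    by_cases h : k = i
    · rw [h, hv', Function.update_self]; exact hdM
    · rw [hv', Function.update_of_ne h]; exact htM (enum_mem ht k)
  have htM' : Finset.univ.image v ⊆ M := by
    intro y hy
    obtain ⟨k, -, rfl⟩ := Finset.mem_image.1 hy
    exact hvM k
  have ht' : (Finset.univ.image v).card = 3 := by
    rw [Finset.card_image_of_injective _ hinj]; simp
  refine ⟨_, htM', ht', ?_, ?_⟩
  · have : ((Finset.univ.image v : Finset Plane) : Set Plane) = range v := by simp
    rw [this, mem_convexHull_range_iff]
    exact ⟨w, hwnn, hwsum, hwx⟩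
  · set A' := interp (affineIndependent_enum hM htM' ht') (σ ∘ enum ht') with hA'
    have hA'v : ∀ k, A' (v k) = σ (v k) := by
      intro k
      obtain ⟨m, hm⟩ := exists_enum_eq ht' (Finset.mem_image_of_mem v (Finset.mem_univ k))
      rw [← hm, hA', interp_vertex]
      rfl
    have h1 : A' x = ∑ k, w k • (Function.update (σ ∘ enum ht) i (σ d)) k := by
      rw [← hwx, affineMap_sum _ _ _ _ hwsum]
      refine Finset.sum_congr rfl fun k _ => ?_
      rw [hA'v, smul_eq_mul]
      by_cases h : k = i
      · rw [h, hv', Function.update_self, Function.update_self]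
      · rw [hv', Function.update_of_ne h, Function.update_of_ne h]; rfl
    have e1 : ∑ k, α k • (σ ∘ enum ht) k = interp hv (σ ∘ enum ht) x := by
      rw [interp_apply]
      exact Finset.sum_congr rfl fun k _ => by rw [smul_eq_mul, mul_comm]
    have e2 : ∑ k, l k • (σ ∘ enum ht) k = interp hv (σ ∘ enum ht) d := by
      rw [interp_apply]
      exact Finset.sum_congr rfl fun k _ => by rw [smul_eq_mul, mul_comm]
    rw [h1, hsum, e1, e2, smul_eq_mul, smul_eq_mul]
    nlinarith

end LowerHull

section LowerHull

variable {M : Finset Plane}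

theorem coord_pos_of_notMem_segment (hM : NoThreeAligned M) {t : Finset Plane} (htM : t ⊆ M) (ht : t.card = 3) {x : Plane}
    (hx : x ∈ convexHull ℝ (t : Set Plane)) (hxs : ∀ a ∈ M, ∀ b ∈ M, x ∉ segment ℝ a b)
    (k : Fin 3) : 0 < (triangleBasis (affineIndependent_enum hM htM ht)).coord k x := by
  rw [← range_enum ht, mem_convexHull_range_iff] at hx
  obtain ⟨w, h0, h1, rfl⟩ := hx
  rw [coord_sum_smul _ h1]
  refine (h0 k).lt_of_ne fun hk => ?_
  have hm : ∀ j, enum ht j ∈ M := fun j => htM (enum_mem ht j)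
  have key : ∀ i j, w k + (w i + w j) = 1 →
      ∑ l, w l • enum ht l = w k • enum ht k + (w i • enum ht i + w j • enum ht j) → False := by
    intro i j hs hc
    refine hxs _ (hm i) _ (hm j) ⟨w i, w j, h0 i, h0 j, by linarith, ?_⟩
    rw [hc, ← hk, zero_smul, zero_add]
  rw [Fin.sum_univ_three] at h1
  fin_cases k
  · exact key 1 2 (by simp only [Fin.zero_eta] at *; linarith)
      (by simp only [Fin.zero_eta, Fin.sum_univ_three]; abel)
  · exact key 0 2 (by simp only [Fin.mk_one] at *; linarith)
      (by simp only [Fin.mk_one, Fin.sum_univ_three]; abel)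
  · exact key 0 1 (by simp only [Fin.reduceFinMk] at *; linarith)
      (by simp only [Fin.reduceFinMk, Fin.sum_univ_three]; abel)

/-- Carathéodory's theorem gives at most three vertices, and fewer would put `x` on a segment. -/
theorem exists_triangle_of_notMem_segment {x : Plane} (hx : x ∈ convexHull ℝ (M : Set Plane))
    (hxs : ∀ a ∈ M, ∀ b ∈ M, x ∉ segment ℝ a b) :
    ∃ t ⊆ M, t.card = 3 ∧ x ∈ convexHull ℝ (t : Set Plane) := by
  rw [convexHull_eq_union] at hx
  simp only [mem_iUnion] at hx
  obtain ⟨t, htM, hind, hxt⟩ := hx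
  have htM' : t ⊆ M := by exact_mod_cast htM
  refine ⟨t, htM', ?_, hxt⟩
  have hle : t.card ≤ 3 := by
    have := hind.card_le_finrank_succ
    have h2 := Submodule.finrank_le (vectorSpan ℝ (range ((↑) : t → Plane)))
    simp only [Fintype.card_coe] at this
    have h3 : Module.finrank ℝ Plane = 2 := by simp
    omega
  by_contra hne
  obtain ⟨a, ha⟩ := convexHull_nonempty_iff.1 ⟨x, hxt⟩
  have ha' : a ∈ t := ha
  have h4 := Finset.card_erase_of_mem ha'
  have h5 : t.card ≤ 2 := by omega
  obtain ⟨b, hb⟩ := Finset.card_le_one_iff_subset_singleton.1 (by omega : (t.erase a).card ≤ 1)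
  by_cases hbt : b ∈ t
  · refine hxs a (htM' ha') b (htM' hbt) ?_
    rw [← convexHull_pair]
    refine convexHull_mono (fun z hz => ?_) hxt
    by_cases hza : z = a
    · exact Or.inl hza
    · simpa [hza] using hb (Finset.mem_erase.2 ⟨hza, hz⟩)
  · refine hxs a (htM' ha') a (htM' ha') ?_
    rw [← convexHull_pair]
    refine convexHull_mono (fun z hz => ?_) hxt
    by_cases hza : z = a
    · exact Or.inl hza
    · have h6 : z ∈ t.erase a := Finset.mem_erase.2 ⟨hza, hz⟩
      have h7 : z = b := by simpa using hb h6
      exact absurd (h7 ▸ hz) hbt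

theorem convexHull_subset_closure_diff_segments
    (hMne : (interior (convexHull ℝ (M : Set Plane))).Nonempty) :
    convexHull ℝ (M : Set Plane) ⊆
      closure {x ∈ convexHull ℝ (M : Set Plane) | ∀ a ∈ M, ∀ b ∈ M, x ∉ segment ℝ a b} := by
  have hc := convex_convexHull ℝ (M : Set Plane)
  obtain ⟨-, hd⟩ := dense_biInter_finset (U := fun p : Plane × Plane => (segment ℝ p.1 p.2)ᶜ)
    (M ×ˢ M) (fun p _ => by
      have : IsCompact (segment ℝ p.1 p.2) := by
        rw [segment_eq_image_lineMap]
        exact isCompact_Icc.image (by fun_prop)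
      exact this.isClosed.isOpen_compl) fun p _ => dense_compl_segment _ _
  refine subset_closure.trans ?_
  rw [← hc.closure_interior_eq_closure_of_nonempty_interior hMne]
  refine closure_minimal ((hd.open_subset_closure_inter isOpen_interior).trans
    (closure_mono fun x hx => ⟨interior_subset hx.1, fun a ha b hb => ?_⟩)) isClosed_closure
  exact mem_iInter₂.1 hx.2 (a, b) (Finset.mk_mem_product ha hb)

/-- A finite planar set without three aligned points has, for each height function `τ`, a
triangulation without new vertices whose lifted triangles lie below all the lifted points. -/
theorem exists_lower_triangulation (hM : NoThreeAligned M)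
    (hMne : (interior (convexHull ℝ (M : Set Plane))).Nonempty) (τ : Plane → ℝ) :
    ∃ (I : Type) (_ : Finite I) (v : I → Fin 3 → Plane) (hv : ∀ i, AffineIndependent ℝ (v i)),
      (∀ i, range (v i) ⊆ M) ∧
      convexHull ℝ (M : Set Plane) ⊆ ⋃ i, convexHull ℝ (range (v i)) ∧
      (∀ i j F G, (openFace (v i) F ∩ openFace (v j) G).Nonempty →
        v i '' F = v j '' G ∧ (F = Finset.univ → i = j)) ∧
      ∀ i, ∀ d ∈ M, interp (hv i) (τ ∘ v i) d ≤ τ d := by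
  classical
  let J := {t : Finset Plane // t ⊆ M ∧ t.card = 3} × Plane
  let A : {t : Finset Plane // t ⊆ M ∧ t.card = 3} → (Plane → ℝ) → (Plane →ᵃ[ℝ] ℝ) := fun t σ =>
    interp (affineIndependent_enum hM t.2.1 t.2.2) (σ ∘ enum t.2.2)
  let ℓ : J → (Plane → ℝ) → ℝ := fun j σ => A j.1 σ j.2 - σ j.2
  have hTfin : Finite {t : Finset Plane // t ⊆ M ∧ t.card = 3} :=
    Set.Finite.to_subtype ((M.powerset.finite_toSet).subset fun t ht =>
      Finset.mem_coe.2 (Finset.mem_powerset.2 ht.1))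
  have hfin : {j : J | j.2 ∈ M ∧ j.2 ∉ j.1.1}.Finite :=
    ((Set.finite_univ (α := {t : Finset Plane // t ⊆ M ∧ t.card = 3})).prod
      M.finite_toSet).subset fun j hj => ⟨mem_univ _, hj.1⟩
  -- Raising the height at `d ∉ t` alone leaves the interpolation on `t` unchanged, which gives the
  -- direction of decrease required of each `ℓ j`. For the resulting `σ` no four lifted points of
  -- `M` are coplanar.
  obtain ⟨σ, hσ⟩ := exists_perturbation hfin.toFinset ℓ (fun j _ => by
      simp only [ℓ, A, interp_apply, Function.comp]
      fun_prop) (fun j hj => by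
      have hj' : j.2 ∈ M ∧ j.2 ∉ j.1.1 := by simpa using hj
      refine ⟨Pi.single j.2 1, fun σ ε => ?_⟩
      have h1 : (σ + ε • Pi.single j.2 1) ∘ enum j.1.2.2 = σ ∘ enum j.1.2.2 := by
        funext k
        have hne : enum j.1.2.2 k ≠ j.2 := fun h => hj'.2 (h ▸ enum_mem _ k)
        simp [Pi.single_eq_of_ne hne]
      simp only [ℓ, A, h1]
      simp
      ring) τ
  have hσ' : ∀ (t) (d), d ∈ M → d ∉ t.1 → A t σ d ≠ σ d ∧ (τ d < A t τ d → σ d < A t σ d) := by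
    intro t d hd hdt
    obtain ⟨h1, h2⟩ := hσ (t, d) (by simp [hd, hdt])
    exact ⟨sub_ne_zero.1 h1, fun h => sub_pos.1 (h2 (sub_pos.2 h))⟩
  have hAv : ∀ t ρ, ∀ d ∈ t.1, A t ρ d = ρ d := by
    intro t ρ d hd
    obtain ⟨k, rfl⟩ := exists_enum_eq t.2.2 hd
    exact interp_vertex _ _ _
  let I := {t : {t : Finset Plane // t ⊆ M ∧ t.card = 3} // ∀ d ∈ M, d ∉ t.1 → A t σ d < σ d}
  have hAle : ∀ t : I, ∀ d ∈ M, A t.1 σ d ≤ σ d := by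
    intro t d hd
    by_cases h : d ∈ t.1.1
    · exact (hAv t.1 σ d h).le
    · exact (t.2 d hd h).le
  have hIfin : Finite I := Subtype.finite
  let v : I → Fin 3 → Plane := fun t => enum t.1.2.2
  have hv : ∀ t, AffineIndependent ℝ (v t) := fun t => affineIndependent_enum hM t.1.2.1 t.1.2.2
  have hrange : ∀ t, range (v t) = (t.1.1 : Set Plane) := fun t => range_enum t.1.2.2
  refine ⟨I, hIfin, v, hv, fun t => ?_, ?_, ?_, ?_⟩
  · rw [hrange]
    exact_mod_cast t.1.2.1
  · refine (convexHull_subset_closure_diff_segments hMne).trans (closure_minimal ?_ ?_)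
    · rintro x ⟨hx, hxs⟩
      -- Over a point off all segments, the lowest lifted triangle has no lifted point below its
      -- plane, since such a point would give a lower triangle. Such points are dense in the hull,
      -- and the union of the triangles is closed.
      obtain ⟨t₀, ht₀M, ht₀, hxt₀⟩ := exists_triangle_of_notMem_segment hx hxs
      obtain ⟨t, hxt, hmin⟩ := Set.exists_min_image
        {t : {t : Finset Plane // t ⊆ M ∧ t.card = 3} | x ∈ convexHull ℝ (t.1 : Set Plane)}
        (fun t => A t σ x) (Set.toFinite _) ⟨⟨t₀, ht₀M, ht₀⟩, hxt₀⟩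
      have hgood : ∀ d ∈ M, d ∉ t.1 → A t σ d < σ d := by
        intro d hd hdt
        by_contra! hle
        obtain ⟨t', ht'M, ht', hxt', hlt⟩ := exists_lower_triangle hM t.2.1 t.2.2
          (coord_pos_of_notMem_segment hM t.2.1 t.2.2 hxt hxs) hd hdt
          (hle.lt_of_ne (hσ' t d hd hdt).1.symm)
        exact absurd (hmin ⟨t', ht'M, ht'⟩ hxt') (not_le.2 hlt)
      refine mem_iUnion.2 ⟨⟨t, hgood⟩, ?_⟩
      rw [hrange]
      exact hxt
    · exact isClosed_iUnion_of_finite fun i => (finite_range _).isClosed_convexHull ℝ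
  -- Compare the interpolations of `i` and `j` at `x`. Neither exceeds `σ` on `M`, and each equals
  -- `σ` at its own vertices, so they agree at `x` and every vertex of `F` is a contact point of
  -- `j`. Strictness makes it a vertex of `j`, and barycentric coordinates place it in `G`.
  · have hsub : ∀ i j F G, ∀ x ∈ openFace (v i) F, x ∈ openFace (v j) G → v i '' F ⊆ v j '' G := by
      rintro i j F G x ⟨w, hF, hF', hw, hx⟩ ⟨w', hG, hG', hw', hx'⟩
      have hm : ∀ i k, v i k ∈ i.1.1 := fun i k => enum_mem i.1.2.2 k
      have hw0 : ∀ k, 0 ≤ w k := fun k => by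
        by_cases h : k ∈ F
        exacts [(hF k h).le, (hF' k h).ge]
      have hw0' : ∀ k, 0 ≤ w' k := fun k => by
        by_cases h : k ∈ G
        exacts [(hG k h).le, (hG' k h).ge]
      have e1 : A i.1 σ x = ∑ k, w k * σ (v i k) := by
        rw [hx, affineMap_sum _ _ _ _ hw]
        exact Finset.sum_congr rfl fun k _ => by rw [hAv i.1 σ _ (hm i k)]
      have e2 : A j.1 σ x = ∑ k, w k * A j.1 σ (v i k) := by rw [hx, affineMap_sum _ _ _ _ hw]
      have e3 : A j.1 σ x = ∑ k, w' k * σ (v j k) := by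
        rw [hx', affineMap_sum _ _ _ _ hw']
        exact Finset.sum_congr rfl fun k _ => by rw [hAv j.1 σ _ (hm j k)]
      have e4 : A i.1 σ x = ∑ k, w' k * A i.1 σ (v j k) := by rw [hx', affineMap_sum _ _ _ _ hw']
      have hle : A i.1 σ x ≤ A j.1 σ x := by
        rw [e3, e4]
        exact Finset.sum_le_sum fun k _ => mul_le_mul_of_nonneg_left
          (hAle i _ (j.1.2.1 (hm j k))) (hw0' k)
      have hterm : ∀ k, w k * A j.1 σ (v i k) ≤ w k * σ (v i k) := fun k =>
        mul_le_mul_of_nonneg_left (hAle j _ (i.1.2.1 (hm i k))) (hw0 k)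
      have heq : ∀ k, w k * A j.1 σ (v i k) = w k * σ (v i k) := fun k =>
        (Finset.sum_eq_sum_iff_of_le fun k _ => hterm k).1
          (le_antisymm (Finset.sum_le_sum fun k _ => hterm k) (by rw [← e1, ← e2]; exact hle)) k
          (Finset.mem_univ k)
      have hFj : ∀ k ∈ F, ∃ m, v j m = v i k := by
        intro k hk
        refine exists_enum_eq j.1.2.2 ?_
        by_contra hn
        exact (j.2 _ (i.1.2.1 (hm i k)) hn).ne (mul_left_cancel₀ (hF k hk).ne' (heq k))
      rintro _ ⟨k, hk, rfl⟩
      obtain ⟨m, hmk⟩ := hFj k hk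
      refine ⟨m, ?_, hmk⟩
      by_contra hmG
      have hc : (triangleBasis (hv j)).coord m x = 0 := by
        rw [hx', coord_sum_smul _ hw', hG' m hmG]
      rw [hx, affineMap_sum _ _ _ _ hw] at hc
      have hnn : ∀ l ∈ Finset.univ, 0 ≤ w l * (triangleBasis (hv j)).coord m (v i l) := by
        intro l _
        by_cases hl : l ∈ F
        · obtain ⟨m', hm'⟩ := hFj l hl
          rw [← hm', triangleBasis_coord_vertex]
          split_ifs
          · simpa using hw0 l
          · simp
        · rw [hF' l hl, zero_mul]
      have := (Finset.sum_eq_zero_iff_of_nonneg hnn).1 hc k (Finset.mem_univ k)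
      rw [← hmk, triangleBasis_coord_vertex, if_pos rfl, mul_one] at this
      exact (hF k hk).ne' this
    rintro i j F G ⟨x, hxF, hxG⟩
    have himg : v i '' F = v j '' G :=
      (hsub i j F G x hxF hxG).antisymm (hsub j i G F x hxG hxF)
    refine ⟨himg, ?_⟩
    rintro rfl
    have hsubset : i.1.1 ⊆ j.1.1 := by
      intro y hy
      obtain ⟨k, rfl⟩ := exists_enum_eq i.1.2.2 hy
      have : v i k ∈ v j '' G := himg ▸ mem_image_of_mem _ (Finset.mem_coe.2 (Finset.mem_univ k))
      obtain ⟨m, -, hmk⟩ := this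
      have h2 : v j m ∈ j.1.1 := enum_mem j.1.2.2 m
      rwa [hmk] at h2
    exact Subtype.ext (Subtype.ext
      (Finset.eq_of_subset_of_card_le hsubset (by rw [i.1.2.2, j.1.2.2])))
  -- A strict violation for `τ` would have persisted for the perturbed heights `σ`.
  · intro t d hd
    by_cases h : d ∈ t.1.1
    · exact (hAv t.1 τ d h).le
    · by_contra! hlt
      exact absurd ((hσ' t.1 d hd h).2 hlt) (not_lt.2 (hAle t d hd))

end LowerHull

/-! ### Faces of inscribed triangles -/

section Faces

variable {v v' : Fin 3 → Plane} {F G : Finset (Fin 3)} {R : ℝ} {x : Plane}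

/-- Weights are attached to points rather than to indices, so that an open face depends only on its
set of vertices. -/
theorem mem_openFace_iff (hv : Function.Injective v) : x ∈ openFace v F ↔
    ∃ w : Plane → ℝ, (∀ y ∈ v '' F, 0 < w y) ∧ ∑ k ∈ F, w (v k) = 1 ∧
      x = ∑ k ∈ F, w (v k) • v k := by
  constructor
  · rintro ⟨w, h1, h2, h3, rfl⟩
    have hinv : ∀ k, Function.extend v w 0 (v k) = w k := fun k => hv.extend_apply _ _ _
    refine ⟨Function.extend v w 0, ?_, ?_, ?_⟩
    · rintro _ ⟨k, hk, rfl⟩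
      rw [hinv]
      exact h1 k hk
    · simp_rw [hinv]
      rw [← h3]
      exact Finset.sum_subset (Finset.subset_univ _) fun k _ hk => h2 k hk
    · simp_rw [hinv]
      refine (Finset.sum_subset (Finset.subset_univ _) fun k _ hk => ?_).symm
      rw [h2 k hk, zero_smul]
  · rintro ⟨w, h1, h2, rfl⟩
    refine ⟨fun k => if k ∈ F then w (v k) else 0, fun k hk => ?_, fun k hk => ?_, ?_, ?_⟩
    · simp only [hk, if_true]
      exact h1 _ (mem_image_of_mem v hk)
    · simp [hk]
    · simpa using h2
    · simp [ite_smul]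

theorem openFace_eq_of_image_eq (hv : Function.Injective v) (hv' : Function.Injective v')
    (h : v '' F = v' '' G) : openFace v F = openFace v' G := by
  classical
  have himg : F.image v = G.image v' := by
    rw [← Finset.coe_inj, Finset.coe_image, Finset.coe_image, h]
  have hsum : ∀ {V : Type} [AddCommMonoid V] (a : Plane → V),
      ∑ k ∈ F, a (v k) = ∑ k ∈ G, a (v' k) := by
    intro V _ a
    rw [← Finset.sum_image (f := a) hv.injOn, himg, Finset.sum_image hv'.injOn]
  ext x
  rw [mem_openFace_iff hv, mem_openFace_iff hv', h]
  refine exists_congr fun w => ?_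
  rw [hsum fun y => w y, hsum fun y => w y • y]

theorem affineIsometry_sum {ι : Type*} (g : Plane ≃ᵃⁱ[ℝ] Plane) (s : Finset ι) (w : ι → ℝ)
    (v : ι → Plane) (hw : ∑ i ∈ s, w i = 1) :
    g (∑ i ∈ s, w i • v i) = ∑ i ∈ s, w i • g (v i) := by
  have h : ∀ y, g y = g.linearIsometryEquiv y + g 0 := fun y => by
    simpa using g.map_vadd 0 y
  rw [h, map_sum]
  simp_rw [h (v _), smul_add, Finset.sum_add_distrib, ← Finset.sum_smul, hw, one_smul, map_smul]

theorem map_mem_openFace_iff (g : Plane ≃ᵃⁱ[ℝ] Plane) :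
    g x ∈ openFace (g ∘ v) F ↔ x ∈ openFace v F := by
  refine exists_congr fun w => and_congr_right fun _ => and_congr_right fun _ =>
    and_congr_right fun h => ?_
  simp only [Function.comp]
  rw [← affineIsometry_sum g Finset.univ w v h, g.injective.eq_iff]

theorem image_openFace (g : Plane ≃ᵃⁱ[ℝ] Plane) :
    g '' openFace v F = openFace (g ∘ v) F := by
  ext y
  obtain ⟨x, rfl⟩ := g.surjective y
  rw [map_mem_openFace_iff, g.injective.mem_set_image]

theorem openFace_card_ne_zero (hx : x ∈ openFace v F) : F.card ≠ 0 := by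
  obtain ⟨w, -, h2, h3, -⟩ := hx
  intro h
  rw [Finset.card_eq_zero] at h
  subst h
  simp [h2] at h3

theorem openFace_singleton (k : Fin 3) : openFace v {k} = {v k} := by
  ext x
  constructor
  · rintro ⟨w, -, h2, h3, rfl⟩
    have h : ∀ j ∈ Finset.univ, j ≠ k → w j = 0 := fun j _ hj => h2 j (by simpa using hj)
    rw [Finset.sum_eq_single_of_mem k (Finset.mem_univ k) h] at h3
    rw [mem_singleton_iff, Finset.sum_eq_single_of_mem k (Finset.mem_univ k) fun j hj hjk => by
      rw [h j hj hjk, zero_smul], h3, one_smul]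
  · rintro rfl
    exact ⟨Pi.single k 1, fun j hj => by simp [Finset.mem_singleton.1 hj],
      fun j hj => Pi.single_eq_of_ne (by simpa using hj) _, by simp, by simp [Pi.single_apply]⟩

/-- The opposite of the power of `x` is the weighted variance of the vertices. It is positive as
soon as two distinct vertices have positive weight. -/
theorem sq_sub_norm_sq {w : Fin 3 → ℝ} (hR : ∀ k, ‖v k‖ = R) (hw : ∑ k, w k = 1)
    (hx : x = ∑ k, w k • v k) : R ^ 2 - ‖x‖ ^ 2 = ∑ k, w k * ‖v k - x‖ ^ 2 := by
  have h1 : ∑ k, w k * ‖v k - x‖ ^ 2 =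
      (∑ k, w k) * (R ^ 2 + ‖x‖ ^ 2) - 2 * ∑ k, w k * inner ℝ (v k) x := by
    rw [Finset.sum_mul, Finset.mul_sum, ← Finset.sum_sub_distrib]
    refine Finset.sum_congr rfl fun k _ => ?_
    rw [norm_sub_sq_real, hR]
    ring
  have h2 : ∑ k, w k * inner ℝ (v k) x = ‖x‖ ^ 2 := by
    rw [← real_inner_self_eq_norm_sq]
    conv_rhs => rw [hx, sum_inner]
    refine Finset.sum_congr rfl fun k _ => ?_
    rw [real_inner_smul_left, ← hx]
  rw [h1, h2, hw]
  ring

theorem norm_lt_of_mem_openFace (hv : Function.Injective v) (hR : ∀ k, ‖v k‖ = R)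
    (hx : x ∈ openFace v F) (hF : 2 ≤ F.card) : ‖x‖ < R := by
  obtain ⟨w, h1, h2, h3, hx⟩ := hx
  obtain ⟨a, ha, b, hb, hab⟩ := Finset.one_lt_card.1 hF
  have h4 := sq_sub_norm_sq hR h3 hx
  have hnn : ∀ k ∈ Finset.univ, 0 ≤ w k * ‖v k - x‖ ^ 2 := by
    intro k _
    by_cases hk : k ∈ F
    · have := h1 k hk
      positivity
    · rw [h2 k hk, zero_mul]
  obtain ⟨k, hk, hkx⟩ : ∃ k ∈ F, v k ≠ x := by
    by_contra! h
    exact hab (hv ((h a ha).trans (h b hb).symm))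
  have hpos : 0 < ∑ k, w k * ‖v k - x‖ ^ 2 := by
    refine Finset.sum_pos' hnn ⟨k, Finset.mem_univ k, ?_⟩
    have h5 := h1 k hk
    have h6 := norm_pos_iff.2 (sub_ne_zero.2 hkx)
    positivity
  have hR0 : 0 ≤ R := hR 0 ▸ norm_nonneg _
  rw [← sq_lt_sq₀ (norm_nonneg _) hR0]
  linarith

theorem two_le_card_of_norm_lt (hR : ∀ k, ‖v k‖ = R) (hx : x ∈ openFace v F) (hxR : ‖x‖ < R) :
    2 ≤ F.card := by
  by_contra! h
  have h0 := openFace_card_ne_zero hx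
  obtain ⟨k, rfl⟩ := Finset.card_eq_one.1 (by omega : F.card = 1)
  rw [openFace_singleton, mem_singleton_iff] at hx
  rw [hx, hR] at hxR
  exact lt_irrefl _ hxR

theorem norm_lt_of_notMem_range (hv : Function.Injective v) (hR : ∀ k, ‖v k‖ = R)
    (hx : x ∈ convexHull ℝ (range v)) (hxv : x ∉ range v) : ‖x‖ < R := by
  obtain ⟨F, hF⟩ := exists_mem_openFace hx
  refine norm_lt_of_mem_openFace hv hR hF ?_
  by_contra! h
  have h0 := openFace_card_ne_zero hF
  obtain ⟨k, rfl⟩ := Finset.card_eq_one.1 (by omega : F.card = 1)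
  rw [openFace_singleton, mem_singleton_iff] at hF
  exact hxv ⟨k, hF.symm⟩

end Faces

/-! ### Comparison of two Delaunay discs -/

section TwoDiscs

variable {X : Type*} [MetricSpace X] {S : Set X} {R R' : ℝ} {φ φ' : Plane → X}
  {g : Plane ≃ᵃⁱ[ℝ] Plane} {x : Plane}

/-- The developments of two Delaunay discs, the second one transported by the isometry `g` of the
plane, agree near `x`. -/
structure Overlap (S : Set X) (R : ℝ) (φ : Plane → X) (R' : ℝ) (φ' : Plane → X)
    (g : Plane ≃ᵃⁱ[ℝ] Plane) (x : Plane) : Prop where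
  left : IsDelaunayDisc S 0 R φ
  right : IsDelaunayDisc S 0 R' φ'
  mem_left : ‖x‖ < R
  mem_right : ‖g x‖ < R'
  eq : ∀ᶠ z in 𝓝 x, φ z = φ' (g z)

theorem Overlap.symm (h : Overlap S R φ R' φ' g x) : Overlap S R' φ' R φ g.symm (g x) where
  left := h.right
  right := h.left
  mem_left := h.mem_right
  mem_right := by simpa using h.mem_left
  eq := by
    have hc : Tendsto g.symm (𝓝 (g x)) (𝓝 x) := by simpa using g.symm.continuous.tendsto (g x)
    filter_upwards [hc.eventually h.eq] with z hz
    rw [hz, g.apply_symm_apply]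

theorem IsMarkedSurface.exists_overlap (hS : IsMarkedSurface S) (h : IsDelaunayDisc S 0 R φ)
    (h' : IsDelaunayDisc S 0 R' φ') {y : Plane} (hx : ‖x‖ < R) (hy : ‖y‖ < R')
    (hxy : φ x = φ' y) : ∃ g : Plane ≃ᵃⁱ[ℝ] Plane, g x = y ∧ Overlap S R φ R' φ' g x := by
  have hxb : x ∈ Metric.ball 0 R := mem_ball_zero_iff.2 hx
  have hyb : y ∈ Metric.ball 0 R' := mem_ball_zero_iff.2 hy
  obtain ⟨g, hg, hge⟩ := hS.exists_transition (h.dev.locIso Metric.isOpen_ball hxb)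
    (h'.dev.locIso Metric.isOpen_ball hyb) hxy (h.dev x hxb).1
  exact ⟨g, hg, h, h', hx, hg ▸ hy, hge⟩

theorem IsMarkedSurface.eq_of_overlap (hS : IsMarkedSurface S) (h : Overlap S R φ R' φ' g x)
    {z : Plane} (hz : ‖z‖ ≤ R) (hgz : ‖g z‖ ≤ R') : φ z = φ' (g z) := by
  have hc := h.left.2.1
  have hc' := h.right.2.1
  rw [← closure_ball _ h.left.1.ne'] at hc
  rw [← closure_ball _ h.right.1.ne'] at hc'
  refine hS.eq_of_dev_closure Metric.isOpen_ball Metric.isOpen_ball (convex_ball _ _)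
    (convex_ball _ _) h.left.dev h.right.dev hc hc' (mem_ball_zero_iff.2 h.mem_left)
    (mem_ball_zero_iff.2 h.mem_right) h.eq ?_ ?_
  · rw [closure_ball _ h.left.1.ne']; simpa using hz
  · rw [closure_ball _ h.right.1.ne']; simpa using hgz

theorem IsDelaunayDisc.norm_eq (h : IsDelaunayDisc S 0 R φ) {z : Plane}
    (hz : z ∈ markedPoints S 0 R φ) : ‖z‖ = R := by
  rw [← dist_zero_right]; exact h.dist_eq_of_mem hz

theorem IsMarkedSurface.mem_markedPoints_of_overlap (hS : IsMarkedSurface S)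
    (h : Overlap S R φ R' φ' g x) {z : Plane} (hz : z ∈ markedPoints S 0 R φ) (hgz : ‖g z‖ ≤ R') :
    g z ∈ markedPoints S 0 R' φ' :=
  ⟨by simpa using hgz, hS.eq_of_overlap h (h.left.norm_eq hz).le hgz ▸ hz.2⟩

/-- The empty disc property: the developments agree on the intersection of the closed discs, and the
open disc on the right contains no marked point. -/
theorem IsMarkedSurface.radius_le_norm_of_overlap (hS : IsMarkedSurface S)
    (h : Overlap S R φ R' φ' g x) {z : Plane} (hz : z ∈ markedPoints S 0 R φ) :
    R' ≤ ‖g z‖ := by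
  by_contra! hlt
  exact hlt.ne (h.right.norm_eq (hS.mem_markedPoints_of_overlap h hz hlt.le))

/-- The difference of the powers of a point with respect to two circles is an affine function. -/
theorem exists_radical (g : Plane ≃ᵃⁱ[ℝ] Plane) (R R' : ℝ) : ∃ H : Plane →ᵃ[ℝ] ℝ,
    ∀ y, H y = (‖y‖ ^ 2 - R ^ 2) - (‖g y‖ ^ 2 - R' ^ 2) := by
  set c := g.symm 0 with hc
  refine ⟨((2 : ℝ) • (innerSL ℝ c : Plane →L[ℝ] ℝ).toLinearMap).toAffineMap +
    AffineMap.const ℝ Plane (R' ^ 2 - R ^ 2 - ‖c‖ ^ 2), fun y => ?_⟩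
  have h1 : ‖g y‖ = ‖y - c‖ := by
    rw [← dist_zero_right, ← dist_eq_norm, ← g.dist_map y, hc, g.apply_symm_apply]
  rw [h1, norm_sub_sq_real]
  simp [real_inner_comm y c]
  ring

/-- If a convex combination of marked points of a disc lies in another cell, the points which
contribute to it are marked points of the other disc. -/
theorem IsMarkedSurface.mem_markedPoints_of_weight_pos (hS : IsMarkedSurface S)
    (h : Overlap S R φ R' φ' g x) {v : Fin 3 → Plane} (hv : ∀ k, v k ∈ markedPoints S 0 R φ)
    {w : Fin 3 → ℝ} (hw0 : ∀ k, 0 ≤ w k) (hw1 : ∑ k, w k = 1) (hx : x = ∑ k, w k • v k)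
    (hgx : g x ∈ convexHull ℝ (markedPoints S 0 R' φ')) {k : Fin 3} (hk : w k ≠ 0) :
    g (v k) ∈ markedPoints S 0 R' φ' := by
  obtain ⟨H, hH⟩ := exists_radical g R R'
  -- The radical axis separates the polygons: `H ≤ 0` on the first and `H ≥ 0` on the second. At the
  -- common point `x` the weighted sum of nonpositive terms is therefore zero, and contributing
  -- vertices lie on both circles.
  have hHv : ∀ k, H (v k) ≤ 0 := by
    intro k
    have h1 := hS.radius_le_norm_of_overlap h (hv k)
    have h2 : R' ^ 2 ≤ ‖g (v k)‖ ^ 2 := pow_le_pow_left₀ h.right.1.le h1 2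
    rw [hH, h.left.norm_eq (hv k)]
    linarith
  have hHx : 0 ≤ H x := by
    have hsub : markedPoints S 0 R' φ' ⊆
        (H.comp g.symm.toAffineEquiv.toAffineMap) ⁻¹' Ici 0 := by
      intro y hy
      have h1 := hS.radius_le_norm_of_overlap h.symm hy
      have h2 : R ^ 2 ≤ ‖g.symm y‖ ^ 2 := pow_le_pow_left₀ h.left.1.le h1 2
      change 0 ≤ H (g.symm y)
      rw [hH, g.apply_symm_apply, h.right.norm_eq hy]
      linarith
    have := convexHull_min hsub ((convex_Ici 0).affine_preimage _) hgx
    change 0 ≤ H (g.symm (g x)) at this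
    rwa [g.symm_apply_apply] at this
  rw [hx, affineMap_sum _ _ _ _ hw1] at hHx
  have hterm : ∀ k ∈ Finset.univ, w k * H (v k) ≤ 0 := fun k _ =>
    mul_nonpos_of_nonneg_of_nonpos (hw0 k) (hHv k)
  have hz := (Finset.sum_eq_zero_iff_of_nonpos hterm).1
    (le_antisymm (Finset.sum_nonpos hterm) hHx) k (Finset.mem_univ k)
  have h3 : H (v k) = 0 := (mul_eq_zero.1 hz).resolve_left hk
  rw [hH, h.left.norm_eq (hv k)] at h3
  refine hS.mem_markedPoints_of_overlap h (hv k) ?_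
  rw [← sq_le_sq₀ (norm_nonneg _) h.right.1.le]
  linarith

theorem IsMarkedSurface.mem_markedPoints_of_mem_openFace (hS : IsMarkedSurface S)
    (h : Overlap S R φ R' φ' g x) {v : Fin 3 → Plane} (hv : ∀ k, v k ∈ markedPoints S 0 R φ)
    {F : Finset (Fin 3)} (hx : x ∈ openFace v F)
    (hgx : g x ∈ convexHull ℝ (markedPoints S 0 R' φ')) {k : Fin 3} (hk : k ∈ F) :
    g (v k) ∈ markedPoints S 0 R' φ' := by
  obtain ⟨w, h1, h2, h3, h4⟩ := hx
  refine hS.mem_markedPoints_of_weight_pos h hv (fun j => ?_) h3 h4 hgx (h1 k hk).ne'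
  by_cases hj : j ∈ F
  exacts [(h1 j hj).le, (h2 j hj).ge]

theorem convexHull_range_subset {v : Fin 3 → Plane} {M : Set Plane} (hv : ∀ k, v k ∈ M) :
    convexHull ℝ (range v) ⊆ convexHull ℝ M :=
  convexHull_mono (range_subset_iff.2 hv)

theorem eq_or_eq_of_two_circles {c p q z : Plane} {r r' : ℝ} (hc : c ≠ 0) (hpq : p ≠ q)
    (hp : ‖p‖ = r) (hq : ‖q‖ = r) (hz : ‖z‖ = r) (hp' : dist p c = r') (hq' : dist q c = r')
    (hz' : dist z c = r') : z = p ∨ z = q := by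
  rw [← dist_zero_right] at hp hq hz
  exact EuclideanGeometry.eq_of_dist_eq_of_dist_eq_of_finrank_eq_two (V := Plane) (P := Plane)
    (by simp) hc.symm hpq hp hq hz hp' hq' hz'

/-- Two triangles inscribed in different Delaunay discs whose open faces meet off `S` meet along
a common edge. -/
theorem IsMarkedSurface.image_subset_of_overlap (hS : IsMarkedSurface S)
    (h : Overlap S R φ R' φ' g x) (hg : g.symm 0 ≠ 0) {v v' : Fin 3 → Plane}
    (hv' : Function.Injective v') (hvm : ∀ k, v k ∈ markedPoints S 0 R φ)
    (hvm' : ∀ k, v' k ∈ markedPoints S 0 R' φ') {F G : Finset (Fin 3)} (hx : x ∈ openFace v F)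
    (hgx : g x ∈ openFace v' G) : (g ∘ v) '' F ⊆ v' '' G := by
  rintro _ ⟨k, hk, rfl⟩
  -- Two vertices of `G` already exhaust the intersection of the two circles, whose centres differ,
  -- so `v k` is one of them.
  obtain ⟨l, hl, m, hm, hlm⟩ := Finset.one_lt_card.1
    (two_le_card_of_norm_lt (fun k => h.right.norm_eq (hvm' k)) hgx h.mem_right)
  have hl' : ∀ l ∈ G, ‖g.symm (v' l)‖ = R ∧ dist (g.symm (v' l)) (g.symm 0) = R' := by
    intro l hl
    refine ⟨h.left.norm_eq (hS.mem_markedPoints_of_mem_openFace h.symm hvm' hgx ?_ hl), ?_⟩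
    · rw [g.symm_apply_apply]
      exact convexHull_range_subset hvm (openFace_subset_convexHull v F hx)
    · rw [g.symm.dist_map, dist_zero_right, h.right.norm_eq (hvm' l)]
  have hk' : dist (v k) (g.symm 0) = R' := by
    rw [← g.dist_map, g.apply_symm_apply, dist_zero_right]
    exact h.right.norm_eq (hS.mem_markedPoints_of_mem_openFace h hvm hx
      (convexHull_range_subset hvm' (openFace_subset_convexHull v' G hgx)) hk)
  have hne : g.symm (v' l) ≠ g.symm (v' m) := g.symm.injective.ne (hv'.ne hlm)
  rcases eq_or_eq_of_two_circles hg hne (hl' l hl).1 (hl' m hm).1 (h.left.norm_eq (hvm k))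
    (hl' l hl).2 (hl' m hm).2 hk' with h' | h'
  · exact ⟨l, hl, by rw [Function.comp, h', g.apply_symm_apply]⟩
  · exact ⟨m, hm, by rw [Function.comp, h', g.apply_symm_apply]⟩

theorem IsMarkedSurface.ne_univ_of_overlap (hS : IsMarkedSurface S)
    (h : Overlap S R φ R' φ' g x) (hg : g.symm 0 ≠ 0) {v v' : Fin 3 → Plane}
    (hv : Function.Injective v) (hvm : ∀ k, v k ∈ markedPoints S 0 R φ)
    (hvm' : ∀ k, v' k ∈ markedPoints S 0 R' φ') {F G : Finset (Fin 3)} (hx : x ∈ openFace v F)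
    (hgx : g x ∈ openFace v' G) : F ≠ Finset.univ := by
  rintro rfl
  have hk' : ∀ k, dist (v k) (g.symm 0) = R' := fun k => by
    rw [← g.dist_map, g.apply_symm_apply, dist_zero_right]
    exact h.right.norm_eq (hS.mem_markedPoints_of_mem_openFace h hvm hx
      (convexHull_range_subset hvm' (openFace_subset_convexHull v' G hgx)) (Finset.mem_univ k))
  have hn : ∀ k, ‖v k‖ = R := fun k => h.left.norm_eq (hvm k)
  rcases eq_or_eq_of_two_circles hg (hv.ne (by decide : (0 : Fin 3) ≠ 1)) (hn 0) (hn 1) (hn 2)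
    (hk' 0) (hk' 1) (hk' 2) with h' | h'
  · exact absurd (hv h') (by decide)
  · exact absurd (hv h') (by decide)

theorem IsMarkedSurface.center_eq_of_overlap (hS : IsMarkedSurface S)
    (h : Overlap S R φ R' φ' g x) (hg : g.symm 0 = 0) : φ 0 = φ' 0 := by
  have h0 : g 0 = 0 := by
    conv_lhs => rw [← hg]
    exact g.apply_symm_apply 0
  have := hS.eq_of_overlap h (z := 0) (by simpa using h.left.1.le) (by
    rw [h0]; simpa using h.right.1.le)
  rwa [h0] at this

/-- Since `φ ∘ g = φ` around the fixed point `m`, the rigidity lemma applies; no nontrivial symmetry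
of the development fixes an interior point. -/
theorem IsMarkedSurface.eq_id_of_overlap (hS : IsMarkedSurface S) (h : Overlap S R φ R φ g x)
    {m : Plane} (hm : ‖m‖ < R) (hgm : g m = m) (z : Plane) : g z = z := by
  have hmb : m ∈ Metric.ball 0 R := mem_ball_zero_iff.2 hm
  refine (h.left.dev.locIso Metric.isOpen_ball hmb).eventuallyEq_id hgm ?_ z
  have h1 : ∀ᶠ a in 𝓝 m, ‖a‖ < R ∧ ‖g a‖ < R := by
    have c1 : ContinuousAt (fun a : Plane => ‖a‖) m := by fun_prop
    have c2 : ContinuousAt (fun a : Plane => ‖g a‖) m := g.continuous.norm.continuousAt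
    exact (c1.eventually_lt continuousAt_const hm).and
      (c2.eventually_lt continuousAt_const (by rwa [hgm]))
  have h2 : ∀ᶠ a in 𝓝 m, ∀ᶠ z in 𝓝 a, φ (g z) = φ z := by
    rw [eventually_eventually_nhds]
    exact h1.mono fun a ha => (hS.eq_of_overlap h ha.1.le ha.2.le).symm
  exact h2.frequently

/-- A symmetry of a face of an inscribed triangle compatible with the development is trivial. -/
theorem IsMarkedSurface.eq_id_of_image_eq (hS : IsMarkedSurface S) (h : Overlap S R φ R φ g x)
    {v : Fin 3 → Plane} (hv : Function.Injective v) (hvm : ∀ k, v k ∈ markedPoints S 0 R φ)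
    {F : Finset (Fin 3)} (hF : 2 ≤ F.card) (himg : (g ∘ v) '' F = v '' F) (z : Plane) :
    g z = z := by
  classical
  set P := F.image v with hP
  have hPc : P.card = F.card := Finset.card_image_of_injective _ hv
  have hP0 : (0 : ℝ) < P.card := by rw [hPc]; exact_mod_cast (by omega : 0 < F.card)
  have hgP : P.image g = P := by
    rw [← Finset.coe_inj, Finset.coe_image, hP, Finset.coe_image, ← image_comp, himg]
  have hsum : ∑ y ∈ P, (P.card : ℝ)⁻¹ = 1 := by
    rw [Finset.sum_const, nsmul_eq_mul, mul_inv_cancel₀ hP0.ne']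
  -- The barycentre of the face is fixed by any isometry permuting its vertices, and is interior to
  -- the disc because the face has at least two vertices.
  set m := ∑ y ∈ P, (P.card : ℝ)⁻¹ • y with hm
  have hgm : g m = m := by
    have h1 := affineIsometry_sum g P (fun _ => (P.card : ℝ)⁻¹) id hsum
    have h2 : ∑ y ∈ P, (P.card : ℝ)⁻¹ • g y = ∑ y ∈ P.image g, (P.card : ℝ)⁻¹ • y :=
      (Finset.sum_image (f := fun y => (P.card : ℝ)⁻¹ • y) g.injective.injOn).symm
    rw [hgP] at h2
    exact h1.trans h2
  have hmF : m ∈ openFace v F := by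
    rw [mem_openFace_iff hv]
    refine ⟨fun _ => (P.card : ℝ)⁻¹, fun _ _ => by positivity, ?_, ?_⟩
    · rw [← hsum, hP, Finset.sum_image hv.injOn]
    · rw [hm, hP, Finset.sum_image hv.injOn]
  exact hS.eq_id_of_overlap h
    (norm_lt_of_mem_openFace hv (fun k => h.left.norm_eq (hvm k)) hmF hF) hgm z

end TwoDiscs

/-! ### The triangulation -/

section Triangulation

variable {X : Type*} [MetricSpace X] {S : Set X}

/-- A choice of a Delaunay disc for each centre. -/
structure DiscFamily (S : Set X) where
  R : centers S → ℝ
  φ : centers S → Plane → X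
  disc : ∀ p, IsDelaunayDisc S 0 (R p) (φ p)
  center : ∀ p, φ p 0 = p

theorem nonempty_discFamily (S : Set X) : Nonempty (DiscFamily S) := by
  choose R φ h using fun p : centers S => p.2
  exact ⟨⟨R, φ, fun p => (h p).1, fun p => (h p).2⟩⟩

/-- The marked points of the chosen disc of centre `p`. -/
def DiscFamily.marked (D : DiscFamily S) (p : centers S) : Set Plane :=
  markedPoints S 0 (D.R p) (D.φ p)

/-- Any Delaunay disc has the same radius as the chosen one with the same centre, and the transition
isometry at the centre identifies their marked points; one disc per centre is enough. -/
theorem IsMarkedSurface.exists_mem_cell (hS : IsMarkedSurface S) (D : DiscFamily S) {x : X}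
    (hx : x ∉ S) : ∃ p, ∃ y ∈ convexHull ℝ (D.marked p), D.φ p y = x := by
  obtain ⟨R, φ, y, hφ, hyR, hy, rfl⟩ := hS.exists_isDelaunayDisc hx
  let p : centers S := ⟨φ 0, R, φ, hφ, rfl⟩
  have hRp : R = D.R p := by
    rw [hS.radius_eq_infDist hφ, hS.radius_eq_infDist (D.disc p), D.center]
  obtain ⟨g, hg, hov⟩ := hS.exists_overlap hφ (D.disc p) (x := 0) (y := 0)
    (by simpa using hφ.1) (by simpa using (D.disc p).1) (D.center p).symm
  have hnorm : ∀ z, ‖g z‖ = ‖z‖ := fun z => by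
    rw [← dist_zero_right, ← hg, g.dist_map, dist_zero_right]
  refine ⟨p, g y, ?_, ?_⟩
  · have hsub : markedPoints S 0 R φ ⊆ g.toAffineEquiv.toAffineMap ⁻¹' convexHull ℝ (D.marked p) :=
      fun z hz => subset_convexHull ℝ _ (hS.mem_markedPoints_of_overlap hov hz (by
        rw [hnorm, hφ.norm_eq hz, hRp]))
    exact convexHull_min hsub ((convex_convexHull ℝ _).affine_preimage _) hy
  · have hyR' : ‖y‖ ≤ R := (mem_ball_zero_iff.1 hyR).le
    exact (hS.eq_of_overlap hov hyR' (by rw [hnorm, ← hRp]; exact hyR')).symm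

/-- Triangulations of the polygons inscribed in the chosen Delaunay discs. -/
structure CellTriangulation (D : DiscFamily S) where
  n : ℕ
  c : Fin n → centers S
  v : Fin n → Fin 3 → Plane
  affineIndependent : ∀ i, AffineIndependent ℝ (v i)
  mem : ∀ i k, v i k ∈ D.marked (c i)
  cover : ∀ p, ∀ x ∈ convexHull ℝ (D.marked p), ∃ i, c i = p ∧ x ∈ convexHull ℝ (range (v i))
  planar : ∀ i j, c i = c j → ∀ F G, (openFace (v i) F ∩ openFace (v j) G).Nonempty →
    v i '' F = v j '' G ∧ (F = Finset.univ → i = j)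

/-- On each polygon, the interpolation of `τ` on each triangle is at most `τ`. -/
def CellTriangulation.IsLowerHull {D : DiscFamily S} (T : CellTriangulation D) (τ : X → ℝ) : Prop :=
  ∀ i, ∀ d ∈ D.marked (T.c i),
    interp (T.affineIndependent i) (τ ∘ D.φ (T.c i) ∘ T.v i) d ≤ τ (D.φ (T.c i) d)

/-- Points on a circle are never aligned three by three, so the planar lower hull construction
applies to each of the finitely many cells. -/
theorem IsMarkedSurface.exists_cellTriangulation (hS : IsMarkedSurface S) (D : DiscFamily S)
    (τ : X → ℝ) : ∃ T : CellTriangulation D, T.IsLowerHull τ := by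
  have key : ∀ p : centers S, ∃ (I : Type) (_ : Finite I) (v : I → Fin 3 → Plane)
      (hv : ∀ i, AffineIndependent ℝ (v i)), (∀ i, range (v i) ⊆ D.marked p) ∧
      convexHull ℝ (D.marked p) ⊆ ⋃ i, convexHull ℝ (range (v i)) ∧
      (∀ i j F G, (openFace (v i) F ∩ openFace (v j) G).Nonempty →
        v i '' F = v j '' G ∧ (F = Finset.univ → i = j)) ∧
      ∀ i, ∀ d ∈ D.marked p, interp (hv i) ((τ ∘ D.φ p) ∘ v i) d ≤ (τ ∘ D.φ p) d := by
    intro p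
    have hfin : (D.marked p).Finite := hS.finite_markedPoints (D.disc p)
    have hcoe : (hfin.toFinset : Set Plane) = D.marked p := hfin.coe_toFinset
    have hM : NoThreeAligned hfin.toFinset := by
      intro v hv hvr
      refine EuclideanGeometry.Cospherical.affineIndependent (s := D.marked p)
        ⟨0, D.R p, fun z hz => (D.disc p).dist_eq_of_mem hz⟩ ?_ hv
      rwa [hcoe] at hvr
    have hne : (interior (convexHull ℝ (hfin.toFinset : Set Plane))).Nonempty := by
      obtain ⟨a, ha, b, hb, c, hc, hab, hac, hbc⟩ := exists_three_of_encard (D.disc p).2.2.2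
      have hinj : Function.Injective ![a, b, c] := by
        intro i j hij
        fin_cases i <;> fin_cases j <;> simp_all
      have hr : range ![a, b, c] ⊆ hfin.toFinset := by
        rw [hcoe]
        rintro _ ⟨i, rfl⟩
        fin_cases i
        exacts [ha, hb, hc]
      rw [interior_convexHull_nonempty_iff_affineSpan_eq_top, eq_top_iff]
      have h1 := (hM _ hinj hr).affineSpan_eq_top_iff_card_eq_finrank_add_one.2 (by simp)
      rw [← h1]
      exact affineSpan_mono ℝ hr
    obtain ⟨I, hI, v, hv, h1, h2, h3, h4⟩ := exists_lower_triangulation hM hne (τ ∘ D.φ p)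
    rw [hcoe] at h2
    exact ⟨I, hI, v, hv, fun i => hcoe ▸ h1 i, h2, h3, fun i d hd =>
      h4 i d (hfin.mem_toFinset.2 hd)⟩
  choose I hI v hv h1 h2 h3 h4 using key
  have hfin : Finite (centers S) := hS.finite_centers.to_subtype
  obtain ⟨n, ⟨e⟩⟩ := Finite.exists_equiv_fin (Σ p, I p)
  refine ⟨⟨n, fun i => (e.symm i).1, fun i => v _ (e.symm i).2, fun i => hv _ _,
    fun i k => h1 _ _ (mem_range_self k), ?_, ?_⟩, fun i d hd => h4 _ _ d hd⟩
  · intro p x hx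
    obtain ⟨i, hi⟩ := mem_iUnion.1 (h2 p hx)
    refine ⟨e ⟨p, i⟩, by simp, ?_⟩
    rw [e.symm_apply_apply]
    exact hi
  · have hsig : ∀ a b : Σ p, I p, a.1 = b.1 → ∀ F G,
        (openFace (v a.1 a.2) F ∩ openFace (v b.1 b.2) G).Nonempty →
        v a.1 a.2 '' F = v b.1 b.2 '' G ∧ (F = Finset.univ → a = b) := by
      rintro ⟨p, i⟩ ⟨q, j⟩ hpq F G h
      obtain rfl : p = q := hpq
      obtain ⟨h5, h6⟩ := h3 p i j F G h
      exact ⟨h5, fun hF => by rw [h6 hF]⟩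
    intro i j hij F G h
    obtain ⟨h5, h6⟩ := hsig _ _ hij F G h
    exact ⟨h5, fun hF => e.symm.injective (h6 hF)⟩

section

variable {D : DiscFamily S} (T : CellTriangulation D)

theorem CellTriangulation.injective (i : Fin T.n) : Function.Injective (T.v i) :=
  (T.affineIndependent i).injective

theorem CellTriangulation.norm_eq (i : Fin T.n) (k : Fin 3) : ‖T.v i k‖ = D.R (T.c i) :=
  (D.disc (T.c i)).norm_eq (T.mem i k)

theorem CellTriangulation.subset_convexHull (i : Fin T.n) :
    convexHull ℝ (range (T.v i)) ⊆ convexHull ℝ (D.marked (T.c i)) :=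
  convexHull_range_subset (T.mem i)

theorem CellTriangulation.norm_le {i : Fin T.n} {x : Plane}
    (hx : x ∈ convexHull ℝ (range (T.v i))) : ‖x‖ ≤ D.R (T.c i) := by
  have hsub : range (T.v i) ⊆ Metric.closedBall 0 (D.R (T.c i)) := by
    rintro _ ⟨k, rfl⟩
    simpa using (T.norm_eq i k).le
  simpa using convexHull_min hsub (convex_closedBall _ _) hx

theorem CellTriangulation.norm_lt_iff {i : Fin T.n} {x : Plane}
    (hx : x ∈ convexHull ℝ (range (T.v i))) : ‖x‖ < D.R (T.c i) ↔ D.φ (T.c i) x ∉ S := by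
  constructor
  · exact fun h => ((D.disc (T.c i)).dev x (mem_ball_zero_iff.2 h)).1
  · intro h
    refine norm_lt_of_notMem_range (T.injective i) (T.norm_eq i) hx ?_
    rintro ⟨k, rfl⟩
    exact h (T.mem i k).2

theorem CellTriangulation.exists_eq_singleton {i : Fin T.n} {F : Finset (Fin 3)} {x : Plane}
    (hx : x ∈ openFace (T.v i) F) (hxS : D.φ (T.c i) x ∈ S) : ∃ k, F = {k} := by
  by_contra hn
  have h0 := openFace_card_ne_zero hx
  have h1 : F.card ≠ 1 := fun h => hn (Finset.card_eq_one.1 h)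
  have := norm_lt_of_mem_openFace (T.injective i) (T.norm_eq i) hx (by omega)
  exact (T.norm_lt_iff (openFace_subset_convexHull _ _ hx)).1 this hxS

/-- Faces of the triangulation meeting off `S` agree after transport to a common planar
domain. -/
theorem IsMarkedSurface.image_eq_of_overlap (hS : IsMarkedSurface S) {i j : Fin T.n}
    {F G : Finset (Fin 3)} {g : Plane ≃ᵃⁱ[ℝ] Plane} {x : Plane}
    (h : Overlap S (D.R (T.c i)) (D.φ (T.c i)) (D.R (T.c j)) (D.φ (T.c j)) g x)
    (hx : x ∈ openFace (T.v i) F) (hgx : g x ∈ openFace (T.v j) G) :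
    (g ∘ T.v i) '' F = T.v j '' G ∧ (F = Finset.univ → i = j) := by
  -- If the developed centres coincide, the discs are the same chosen disc, `g` is the identity, and
  -- the claim is the planar one. Otherwise the circles are distinct and the faces share an edge.
  by_cases hg : g.symm 0 = 0
  · have hc : T.c i = T.c j := by
      have := hS.center_eq_of_overlap h hg
      rw [D.center, D.center] at this
      exact Subtype.ext this
    have h0 : g 0 = 0 := by
      conv_lhs => rw [← hg]
      exact g.apply_symm_apply 0
    have hid : ∀ z, g z = z := by
      rw [← hc] at h
      exact hS.eq_id_of_overlap h (m := 0) (by simpa using h.left.1) h0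
    have hcomp : g ∘ T.v i = T.v i := funext fun k => hid _
    rw [hcomp]
    rw [hid] at hgx
    exact T.planar i j hc F G ⟨x, hx, hgx⟩
  · have hg' : g.symm.symm 0 ≠ 0 := by
      rw [AffineIsometryEquiv.symm_symm]
      intro h0
      apply hg
      conv_lhs => rw [← h0]
      exact g.symm_apply_apply 0
    refine ⟨(hS.image_subset_of_overlap h hg (T.injective j) (T.mem i) (T.mem j) hx
      hgx).antisymm ?_, fun hF => absurd hF (hS.ne_univ_of_overlap h hg (T.injective i) (T.mem i)
        (T.mem j) hx hgx)⟩
    have hsub := hS.image_subset_of_overlap h.symm hg' (T.injective i) (T.mem j) (T.mem i) hgx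
      (by rwa [g.symm_apply_apply])
    rintro _ ⟨k, hk, rfl⟩
    obtain ⟨l, hl, hlk⟩ := hsub (mem_image_of_mem _ hk)
    exact ⟨l, hl, by rw [Function.comp, hlk, Function.comp, g.apply_symm_apply]⟩

/-- Off `S`, two points with the same image yield an isometry carrying the face to itself compatibly
with the development, and this isometry is trivial. -/
theorem IsMarkedSurface.injOn_openFace (hS : IsMarkedSurface S) (i : Fin T.n)
    (F : Finset (Fin 3)) : InjOn (D.φ (T.c i)) (openFace (T.v i) F) := by
  intro x hx y hy hxy
  have hx' := openFace_subset_convexHull _ _ hx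
  have hy' := openFace_subset_convexHull _ _ hy
  by_cases hxS : D.φ (T.c i) x ∈ S
  · obtain ⟨k, rfl⟩ := T.exists_eq_singleton hx hxS
    rw [openFace_singleton, mem_singleton_iff] at hx hy
    rw [hx, hy]
  · have hxn := (T.norm_lt_iff hx').2 hxS
    obtain ⟨g, hg, hov⟩ := hS.exists_overlap (D.disc _) (D.disc _) hxn
      ((T.norm_lt_iff hy').2 (hxy ▸ hxS)) hxy
    have himg := (hS.image_eq_of_overlap T hov hx (hg ▸ hy)).1
    rw [← hg, hS.eq_id_of_image_eq hov (T.injective i) (T.mem i)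
      (two_le_card_of_norm_lt (T.norm_eq i) hx hxn) himg]

/-- Off `S` the transition isometry matches the vertex sets of the two faces, hence the whole faces;
on `S` both faces are vertices. -/
theorem IsMarkedSurface.faces (hS : IsMarkedSurface S) (i j : Fin T.n) (F G : Finset (Fin 3))
    (h : (D.φ (T.c i) '' openFace (T.v i) F ∩ D.φ (T.c j) '' openFace (T.v j) G).Nonempty) :
    D.φ (T.c i) '' openFace (T.v i) F = D.φ (T.c j) '' openFace (T.v j) G ∧ F.card = G.card ∧
      (F = Finset.univ → i = j) := by
  obtain ⟨q, ⟨x, hx, rfl⟩, y, hy, hxy⟩ := h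
  have hx' := openFace_subset_convexHull _ _ hx
  have hy' := openFace_subset_convexHull _ _ hy
  by_cases hxS : D.φ (T.c i) x ∈ S
  · obtain ⟨k, rfl⟩ := T.exists_eq_singleton hx hxS
    obtain ⟨l, rfl⟩ := T.exists_eq_singleton hy (hxy ▸ hxS)
    rw [openFace_singleton, mem_singleton_iff] at hx hy
    subst hx hy
    refine ⟨by rw [openFace_singleton, openFace_singleton, image_singleton, image_singleton, hxy],
      by simp, fun hF => ?_⟩
    have := congrArg Finset.card hF
    simp at this
  · have hxn := (T.norm_lt_iff hx').2 hxS
    have hyn := (T.norm_lt_iff hy').2 (hxy ▸ hxS)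
    obtain ⟨g, rfl, hov⟩ := hS.exists_overlap (D.disc _) (D.disc _) hxn hyn hxy.symm
    obtain ⟨himg, huniv⟩ := hS.image_eq_of_overlap T hov hx hy
    have hgi : Function.Injective (g ∘ T.v i) := g.injective.comp (T.injective i)
    have hface : g '' openFace (T.v i) F = openFace (T.v j) G := by
      rw [image_openFace]
      exact openFace_eq_of_image_eq hgi (T.injective j) himg
    refine ⟨?_, ?_, huniv⟩
    · rw [← hface, image_image]
      refine image_congr fun z hz => hS.eq_of_overlap hov
        (T.norm_le (openFace_subset_convexHull _ _ hz)) ?_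
      exact T.norm_le (openFace_subset_convexHull _ _ (hface ▸ mem_image_of_mem g hz))
    · classical
      have : F.image (g ∘ T.v i) = G.image (T.v j) := by
        rw [← Finset.coe_inj, Finset.coe_image, Finset.coe_image, himg]
      rw [← Finset.card_image_of_injective F hgi, this,
        Finset.card_image_of_injective G (T.injective j)]

theorem IsMarkedSurface.dense_compl (hS : IsMarkedSurface S) : Dense Sᶜ := by
  intro s
  by_cases hs : s ∈ S
  · obtain ⟨θ, hθ, ε, hε, ψ, h0, hd, -⟩ := hS.conical s
    obtain ⟨ρ, hρ, hsep⟩ := exists_pos_forall_dist_lt hS.finite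
    rw [Metric.mem_closure_iff]
    intro δ hδ
    set r := min (min (ε / 2) (ρ / 2)) (δ / 2) with hr
    have hr0 : 0 < r := by positivity
    have hrε : r < ε := ((min_le_left _ _).trans (min_le_left _ _)).trans_lt (by linarith)
    have hrρ : r < ρ := ((min_le_left _ _).trans (min_le_right _ _)).trans_lt (by linarith)
    have hrδ : r < δ := (min_le_right _ _).trans_lt (by linarith)
    have hdist := dist_apex_of_polar h0 hd ⟨hr0.le, hrε⟩ (0 : AddCircle θ)
    refine ⟨ψ r 0, fun h => ?_, by rw [dist_comm, hdist]; exact hrδ⟩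
    have := hsep _ h s hs (by rw [hdist]; exact hrρ)
    rw [this, dist_self] at hdist
    exact hr0.ne hdist
  · exact subset_closure hs

theorem IsMarkedSurface.continuousOn_chart (i : Fin T.n) :
    ContinuousOn (D.φ (T.c i)) (convexHull ℝ (range (T.v i))) :=
  (D.disc (T.c i)).2.1.mono fun _ hx => by simpa using T.norm_le hx

/-- The cells cover the complement of `S`, which is dense because cone points are not isolated, and
the finite union of compact triangles is closed. -/
theorem IsMarkedSurface.iUnion_chart_image (hS : IsMarkedSurface S) :
    ⋃ i, D.φ (T.c i) '' convexHull ℝ (range (T.v i)) = univ := by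
  have hcl : IsClosed (⋃ i, D.φ (T.c i) '' convexHull ℝ (range (T.v i))) :=
    isClosed_iUnion_of_finite fun i => (((finite_range _).isCompact_convexHull ℝ).image_of_continuousOn
      (IsMarkedSurface.continuousOn_chart T i)).isClosed
  refine (hS.dense_compl.mono fun x hx => ?_).closure_eq ▸ hcl.closure_eq.symm
  obtain ⟨p, y, hy, rfl⟩ := hS.exists_mem_cell D hx
  obtain ⟨i, rfl, hi⟩ := T.cover p y hy
  exact mem_iUnion.2 ⟨i, mem_image_of_mem _ hi⟩

/-- The triangulations of the Delaunay polygons form an adapted triangulation. -/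
def CellTriangulation.toAdapted (hS : IsMarkedSurface S) : AdaptedTriangulation S where
  n := T.n
  vertex := T.v
  chart i := D.φ (T.c i)
  affineIndependent := T.affineIndependent
  continuousOn := IsMarkedSurface.continuousOn_chart T
  isometric i x hx hxv := ((D.disc (T.c i)).dev.locIso Metric.isOpen_ball (mem_ball_zero_iff.2
    (norm_lt_of_notMem_range (T.injective i) (T.norm_eq i) hx hxv))).isometricNear _
  covers := hS.iUnion_chart_image T
  vertices := by
    refine Subset.antisymm (iUnion_subset fun i => ?_) fun s hs => ?_
    · rintro _ ⟨_, ⟨k, rfl⟩, rfl⟩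
      exact (T.mem i k).2
    · obtain ⟨i, y, hy, rfl⟩ := mem_iUnion.1 ((hS.iUnion_chart_image T).ge (mem_univ s))
      refine mem_iUnion.2 ⟨i, y, ?_, rfl⟩
      by_contra hn
      exact (T.norm_lt_iff hy).1
        (norm_lt_of_notMem_range (T.injective i) (T.norm_eq i) hy hn) hs
  injOn := hS.injOn_openFace T
  faces := hS.faces T

theorem CellTriangulation.refinesDelaunay (hS : IsMarkedSurface S) :
    (T.toAdapted hS).RefinesDelaunay := fun i =>
  ⟨0, D.R (T.c i), D.φ (T.c i), D.disc _, T.subset_convexHull i, fun _ _ => rfl⟩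

end

end Triangulation

/-! ### Small heights -/

section Heights

variable {X : Type*} {S : Set X}

/-- The extension by zero of a function on `S`. -/
def extendZero (S : Set X) (τ : S → ℝ) (x : X) : ℝ := by
  classical exact if h : x ∈ S then τ ⟨x, h⟩ else 0

theorem extendZero_coe (τ : S → ℝ) (s : S) : extendZero S τ s = τ s := by
  simp [extendZero]

theorem extendZero_zero (x : X) : extendZero S 0 x = 0 := by
  simp [extendZero]

theorem continuous_extendZero (x : X) : Continuous fun τ : S → ℝ => extendZero S τ x := by
  by_cases h : x ∈ S
  · simp only [extendZero, h, dite_true]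
    exact continuous_apply _
  · simp only [extendZero, h, dite_false]
    exact continuous_const

variable [MetricSpace X]

/-- The heights `τ` are so small that the graph over a marked disc, extended to the positions
that a marked point outside of this disc may take, stays below `τ`. -/
def DiscFamily.IsSmall (D : DiscFamily S) (τ : X → ℝ) : Prop :=
  ∀ p q, ∀ z ∈ D.marked p, ∀ a ∈ D.marked p, ∀ b ∈ D.marked p, ∀ a' ∈ D.marked q,
    ∀ b' ∈ D.marked q, a' ≠ b' → ∀ v' ∈ {v' : Fin 3 → Plane | ∀ k, v' k ∈ D.marked q},
    ∀ y ∈ {y : Plane | dist y a' = dist z a ∧ dist y b' = dist z b},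
    ∀ hv' : AffineIndependent ℝ v', D.R q < ‖y‖ →
    D.R q ^ 2 - ‖y‖ ^ 2 + interp hv' (τ ∘ D.φ q ∘ v') y < τ (D.φ p z)

theorem finite_setOf_dist_eq {a b : Plane} (hab : a ≠ b) (r s : ℝ) :
    {y : Plane | dist y a = r ∧ dist y b = s}.Finite := by
  by_contra hinf
  obtain ⟨x, hx, y, hy, z, hz, hxy, hxz, hyz⟩ := exists_three_of_encard
    (show (3 : ℕ∞) ≤ _ from (Set.Infinite.encard_eq hinf).symm ▸ le_top)
  have hd : Module.finrank ℝ Plane = 2 := by simp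
  rcases EuclideanGeometry.eq_of_dist_eq_of_dist_eq_of_finrank_eq_two hd hab hxy hx.1 hy.1 hz.1
    hx.2 hy.2 hz.2 with h | h
  · exact hxz h.symm
  · exact hyz h.symm

/-- The distances to `a' ≠ b'` leave finitely many positions for `y`, so only finitely many strict
inequalities, continuous in `τ`, are involved. At `τ = 0` each reads `R² - |y|² < 0`. -/
theorem IsMarkedSurface.eventually_isSmall (hS : IsMarkedSurface S) (D : DiscFamily S) :
    ∀ᶠ τ in 𝓝 (0 : S → ℝ), D.IsSmall (extendZero S τ) := by
  have hfin : Finite (centers S) := hS.finite_centers.to_subtype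
  have hM : ∀ p, (D.marked p).Finite := fun p => hS.finite_markedPoints (D.disc p)
  unfold DiscFamily.IsSmall
  refine eventually_all.2 fun p => eventually_all.2 fun q => (eventually_all_finite (hM p)).2
    fun z _ => (eventually_all_finite (hM p)).2 fun a _ => (eventually_all_finite (hM p)).2
    fun b _ => (eventually_all_finite (hM q)).2 fun a' _ => (eventually_all_finite (hM q)).2
    fun b' _ => eventually_all.2 fun hab => (eventually_all_finite (Set.Finite.pi' fun _ => hM q)).2
    fun v' _ => (eventually_all_finite (finite_setOf_dist_eq hab _ _)).2
    fun y _ => eventually_all.2 fun hv' => eventually_all.2 fun hy => ?_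
  refine ContinuousAt.eventually_lt (Continuous.continuousAt ?_)
    (continuous_extendZero _).continuousAt ?_
  · simp only [interp_apply]
    refine continuous_const.add (continuous_finsetSum _ fun k _ => ?_)
    exact (continuous_extendZero _).mul continuous_const
  · simp only [interp_apply, Function.comp, extendZero_zero, zero_mul, Finset.sum_const_zero]
    have := (D.disc q).1
    nlinarith

section

variable {D : DiscFamily S} (T : CellTriangulation D) (τ : X → ℝ)

/-- The distance-like extension of `τ` on the triangle of index `i`. -/
def CellTriangulation.height (i : Fin T.n) (y : Plane) : ℝ :=
  D.R (T.c i) ^ 2 - ‖y‖ ^ 2 + interp (T.affineIndependent i) (τ ∘ D.φ (T.c i) ∘ T.v i) y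

theorem CellTriangulation.height_vertex (i : Fin T.n) (k : Fin 3) :
    T.height τ i (T.v i k) = τ (D.φ (T.c i) (T.v i k)) := by
  rw [CellTriangulation.height, interp_vertex, T.norm_eq]
  simp

variable {T τ}

/-- Developing along a common domain, the extension on a triangle is the largest there. -/
theorem IsMarkedSurface.height_le_height (hS : IsMarkedSurface S) (hT : T.IsLowerHull τ)
    (hτ : D.IsSmall τ) {i j : Fin T.n} {g : Plane ≃ᵃⁱ[ℝ] Plane} {x : Plane}
    (h : Overlap S (D.R (T.c i)) (D.φ (T.c i)) (D.R (T.c j)) (D.φ (T.c j)) g x)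
    (hx : x ∈ convexHull ℝ (range (T.v i))) (hgx : g x ∈ convexHull ℝ (range (T.v j)))
    {y : Plane} (hy : y ∈ convexHull ℝ (range (T.v i))) :
    T.height τ j (g y) ≤ T.height τ i y := by
  obtain ⟨H, hH⟩ := exists_radical g (D.R (T.c i)) (D.R (T.c j))
  -- The difference of the two heights, written as an affine map: the radical function absorbs both
  -- quadratic terms. Nonnegativity is then checked at the vertices of triangle `i`.
  set A : Plane →ᵃ[ℝ] ℝ := interp (T.affineIndependent i) (τ ∘ D.φ (T.c i) ∘ T.v i) -
    (interp (T.affineIndependent j) (τ ∘ D.φ (T.c j) ∘ T.v j)).comp g.toAffineEquiv.toAffineMap - H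
  have hA : ∀ z, A z = T.height τ i z - T.height τ j (g z) := fun z => by
    have h1 : A z = interp (T.affineIndependent i) (τ ∘ D.φ (T.c i) ∘ T.v i) z -
      interp (T.affineIndependent j) (τ ∘ D.φ (T.c j) ∘ T.v j) (g z) - H z := rfl
    rw [h1, hH, CellTriangulation.height, CellTriangulation.height]
    ring
  suffices hsub : range (T.v i) ⊆ A ⁻¹' Ici 0 by
    have := convexHull_min hsub ((convex_Ici 0).affine_preimage A) hy
    rw [mem_preimage, mem_Ici, hA] at this
    linarith
  rintro _ ⟨k, rfl⟩
  rw [mem_preimage, mem_Ici, hA, sub_nonneg, T.height_vertex]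
  -- On the circle of `j`, the lower hull property concludes. Strictly outside, the face containing
  -- `x` has two vertices sent to marked points of `j`; their distances to vertex `k` place its
  -- image among the positions controlled by `DiscFamily.IsSmall`.
  rcases (hS.radius_le_norm_of_overlap h (T.mem i k)).eq_or_lt with hk | hk
  · have hm := hS.mem_markedPoints_of_overlap h (T.mem i k) hk.ge
    have := hT j _ hm
    rw [CellTriangulation.height, ← hk, sub_self, zero_add]
    rwa [← hS.eq_of_overlap h (T.norm_eq i k).le hk.ge] at this
  · obtain ⟨F, hF⟩ := exists_mem_openFace hx
    obtain ⟨a, ha, b, hb, hab⟩ := Finset.one_lt_card.1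
      (two_le_card_of_norm_lt (T.norm_eq i) hF h.mem_left)
    have hmem : ∀ {l}, l ∈ F → g (T.v i l) ∈ D.marked (T.c j) := fun hl =>
      hS.mem_markedPoints_of_mem_openFace h (T.mem i) hF (T.subset_convexHull j hgx) hl
    exact le_of_lt <| hτ _ _ _ (T.mem i k) _ (T.mem i a) _ (T.mem i b) _ (hmem ha) _ (hmem hb)
      (fun he => hab (T.injective i (g.injective he))) _ (T.mem j) _
      ⟨g.dist_map _ _, g.dist_map _ _⟩ (T.affineIndependent j) hk

/-- Off `S`, each height dominates the other at the common point; on `S`, both equal `τ`. -/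
theorem IsMarkedSurface.height_eq_height (hS : IsMarkedSurface S) (hT : T.IsLowerHull τ)
    (hτ : D.IsSmall τ) {i j : Fin T.n} {x y : Plane} (hx : x ∈ convexHull ℝ (range (T.v i)))
    (hy : y ∈ convexHull ℝ (range (T.v j))) (hxy : D.φ (T.c i) x = D.φ (T.c j) y) :
    T.height τ i x = T.height τ j y := by
  by_cases hxS : D.φ (T.c i) x ∈ S
  · have hvert : ∀ {i x}, x ∈ convexHull ℝ (range (T.v i)) → D.φ (T.c i) x ∈ S →
        T.height τ i x = τ (D.φ (T.c i) x) := by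
      intro i x hx hxS
      obtain ⟨F, hF⟩ := exists_mem_openFace hx
      obtain ⟨k, rfl⟩ := T.exists_eq_singleton hF hxS
      rw [openFace_singleton, mem_singleton_iff] at hF
      rw [hF, T.height_vertex]
    rw [hvert hx hxS, hvert hy (hxy ▸ hxS), hxy]
  · obtain ⟨g, rfl, hov⟩ := hS.exists_overlap (D.disc _) (D.disc _) ((T.norm_lt_iff hx).2 hxS)
      ((T.norm_lt_iff hy).2 (hxy ▸ hxS)) hxy
    refine le_antisymm ?_ (hS.height_le_height hT hτ hov hx hy hx)
    have := hS.height_le_height hT hτ hov.symm hy (by rwa [g.symm_apply_apply]) hy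
    rwa [g.symm_apply_apply] at this

theorem IsMarkedSurface.exists_extension (hS : IsMarkedSurface S) (hT : T.IsLowerHull τ)
    (hτ : D.IsSmall τ) : ∃ f : X → ℝ,
      ∀ i, ∀ x ∈ convexHull ℝ (range (T.v i)), f (D.φ (T.c i) x) = T.height τ i x := by
  have hcov : ∀ x, ∃ i, ∃ y ∈ convexHull ℝ (range (T.v i)), D.φ (T.c i) y = x := fun x =>
    mem_iUnion.1 ((hS.iUnion_chart_image T).ge (mem_univ x))
  choose i y hy hyx using hcov
  exact ⟨fun x => T.height τ (i x) (y x), fun j x hx =>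
    hS.height_eq_height hT hτ (hy _) hx (hyx _)⟩

theorem exists_sub_dist_sq (A : Plane →ᵃ[ℝ] ℝ) : ∃ (ω : Plane) (t₀ : ℝ), ∀ x,
    A x - ‖x‖ ^ 2 = t₀ - dist x ω ^ 2 := by
  let ω : Plane := (2⁻¹ : ℝ) •
    (InnerProductSpace.toDual ℝ Plane).symm (LinearMap.toContinuousLinearMap A.linear)
  have hω : ∀ x, 2 * inner ℝ ω x = A.linear x := fun x => by
    rw [real_inner_smul_left, InnerProductSpace.toDual_symm_apply]
    simp
  refine ⟨ω, A 0 + ‖ω‖ ^ 2, fun x => ?_⟩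
  have h1 : A x = A.linear x + A 0 := by simpa using A.map_vadd 0 x
  rw [dist_eq_norm, @norm_sub_sq_real, h1, ← hω, real_inner_comm]
  ring

theorem CellTriangulation.isDistanceLikeExtension (hS : IsMarkedSurface S) {f : X → ℝ}
    (hf : ∀ i, ∀ x ∈ convexHull ℝ (range (T.v i)), f (D.φ (T.c i) x) = T.height τ i x) :
    (T.toAdapted hS).IsDistanceLikeExtension (fun s => τ s) f := by
  refine ⟨fun s => ?_, fun i => ?_⟩
  · obtain ⟨i, _, ⟨k, rfl⟩, hk⟩ := mem_iUnion.1 ((T.toAdapted hS).vertices.ge s.2)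
    have hk : D.φ (T.c i) (T.v i k) = s := hk
    have h := (hf i _ (_root_.subset_convexHull ℝ _ (mem_range_self k))).trans
      (T.height_vertex τ i k)
    rwa [hk] at h
  · obtain ⟨ω, t₀, h⟩ := exists_sub_dist_sq
      (interp (T.affineIndependent i) (τ ∘ D.φ (T.c i) ∘ T.v i) + AffineMap.const ℝ _ (D.R (T.c i) ^ 2))
    refine ⟨ω, t₀, fun x hx => ?_⟩
    rw [← h]
    refine (hf i x hx).trans ?_
    change D.R (T.c i) ^ 2 - _ + _ = _ + D.R (T.c i) ^ 2 - _
    ring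

end

end Heights

/-! ### Maxima of finitely many affine functions of one variable -/

section MaxAffine

variable {m : ℝ → ℝ} {a b t : ℝ} {J : Finset (ℝ × ℝ)}

/-- Pieces inactive at `t` stay below by continuity and the active ones are dominated by `q` along
the filter, so `q` alone realises the maximum. -/
theorem eventually_eq_of_dominates {l : Filter ℝ} (hl : l ≤ 𝓝 t)
    (hJ : ∀ᶠ x in l, (∃ q ∈ J, m x = q.1 * x + q.2) ∧ ∀ q ∈ J, q.1 * x + q.2 ≤ m x)
    {q : ℝ × ℝ} (hq : q ∈ J) (hact : m t = q.1 * t + q.2) (hle : ∀ q' ∈ J, q'.1 * t + q'.2 ≤ m t)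
    (hdom : ∀ q' ∈ J, m t = q'.1 * t + q'.2 → ∀ᶠ x in l, q'.1 * x + q'.2 ≤ q.1 * x + q.2) :
    ∀ᶠ x in l, m x = q.1 * x + q.2 := by
  have hall : ∀ᶠ x in l, ∀ q' ∈ J, q'.1 * x + q'.2 ≤ q.1 * x + q.2 := by
    refine (eventually_all_finset J).2 fun q' hq' => ?_
    rcases (hle q' hq').eq_or_lt with h | h
    · exact hdom q' hq' h.symm
    · have hc : ∀ q : ℝ × ℝ, ContinuousAt (fun x => q.1 * x + q.2) t := fun q => by fun_prop
      exact hl (((hc q').eventually_lt (hc q) (hact ▸ h)).mono fun x hx => hx.le)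
  filter_upwards [hJ, hall] with x ⟨⟨q', hq', hx⟩, h⟩ hx'
  exact (hx.trans_le (hx' q' hq')).antisymm (h q hq)

/-- A function which is locally a maximum of finitely many affine functions is affine on each
side of each point, with slopes in the right order. -/
theorem exists_slopes (ht : t ∈ Icc a b)
    (hJ : ∀ᶠ x in 𝓝[Icc a b] t, (∃ q ∈ J, m x = q.1 * x + q.2) ∧ ∀ q ∈ J, q.1 * x + q.2 ≤ m x) :
    ∃ q r : ℝ × ℝ, q.1 ≤ r.1 ∧ (∀ᶠ x in 𝓝[Icc a b ∩ Iic t] t, m x = q.1 * x + q.2) ∧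
      ∀ᶠ x in 𝓝[Icc a b ∩ Ici t] t, m x = r.1 * x + r.2 := by
  obtain ⟨⟨q₀, hq₀, hact₀⟩, hle⟩ := hJ.self_of_nhdsWithin ht
  set K := J.filter fun q => m t = q.1 * t + q.2
  have hK : ∀ q, q ∈ K ↔ q ∈ J ∧ m t = q.1 * t + q.2 := fun q => Finset.mem_filter
  have hne : K.Nonempty := ⟨q₀, (hK q₀).2 ⟨hq₀, hact₀⟩⟩
  -- Among the pieces active at `t`, the smallest slope wins on the left and the largest on the
  -- right.
  obtain ⟨q, hq, hqmin⟩ := K.exists_min_image Prod.fst hne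
  obtain ⟨r, hr, hrmax⟩ := K.exists_max_image Prod.fst hne
  rw [hK] at hq hr
  refine ⟨q, r, hqmin r ((hK r).2 hr),
    eventually_eq_of_dominates nhdsWithin_le_nhds
      (hJ.filter_mono (nhdsWithin_mono _ inter_subset_left)) hq.1 hq.2 hle fun q' hq' h => ?_,
    eventually_eq_of_dominates nhdsWithin_le_nhds
      (hJ.filter_mono (nhdsWithin_mono _ inter_subset_left)) hr.1 hr.2 hle fun q' hq' h => ?_⟩
  · filter_upwards [self_mem_nhdsWithin] with x hx
    have h1 := hqmin q' ((hK q').2 ⟨hq', h⟩)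
    have h2 : x ≤ t := hx.2
    nlinarith [hq.2]
  · filter_upwards [self_mem_nhdsWithin] with x hx
    have h1 := hrmax q' ((hK q').2 ⟨hq', h⟩)
    have h2 : t ≤ x := hx.2
    nlinarith [hr.2]

variable {h : ℝ → ℝ}

theorem tendsto_deriv_of_eventuallyEq {s : Set ℝ} (hs : IsOpen s) {p q : ℝ}
    (hh : ∀ᶠ x in 𝓝[s] t, h x = p * x + q - x ^ 2) :
    Tendsto (deriv h) (𝓝[s] t) (𝓝 (p - 2 * t)) := by
  have h1 : ∀ᶠ x in 𝓝[s] t, deriv h x = p - 2 * x := by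
    filter_upwards [eventually_eventually_nhdsWithin.2 hh, self_mem_nhdsWithin] with x hx hxs
    rw [hs.nhdsWithin_eq hxs] at hx
    have hd : HasDerivAt (fun x : ℝ => p * x + q - x ^ 2) (p - 2 * x) x := by
      refine ((((hasDerivAt_id x).const_mul p).add_const q).sub ((hasDerivAt_id x).pow 2)).congr_deriv ?_
      simp
    exact (hd.congr_of_eventuallyEq hx).deriv
  refine Tendsto.congr' (h1.mono fun x hx => hx.symm) (Tendsto.mono_left ?_ nhdsWithin_le_nhds)
  exact Continuous.tendsto (by fun_prop) t

/-- A function which, up to `x ↦ x²`, is locally a maximum of finitely many affine functions is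
Q-convex. -/
theorem qConvexOn_of_max (hJ : ∀ t ∈ Icc a b, ∃ J : Finset (ℝ × ℝ), ∀ᶠ x in 𝓝[Icc a b] t,
    (∃ q ∈ J, h x + x ^ 2 = q.1 * x + q.2) ∧ ∀ q ∈ J, q.1 * x + q.2 ≤ h x + x ^ 2) :
    QConvexOn h a b := by
  have hslopes : ∀ t ∈ Icc a b, ∃ q r : ℝ × ℝ, q.1 ≤ r.1 ∧
      (∀ᶠ x in 𝓝[Icc a b ∩ Iic t] t, h x = q.1 * x + q.2 - x ^ 2) ∧
      ∀ᶠ x in 𝓝[Icc a b ∩ Ici t] t, h x = r.1 * x + r.2 - x ^ 2 := by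
    intro t ht
    obtain ⟨J, hJ⟩ := hJ t ht
    obtain ⟨q, r, hqr, hq, hr⟩ := exists_slopes ht hJ
    exact ⟨q, r, hqr, hq.mono fun x hx => eq_sub_of_add_eq hx,
      hr.mono fun x hx => eq_sub_of_add_eq hx⟩
  have hcd : ∀ q : ℝ × ℝ, ContDiff ℝ 1 fun x : ℝ => q.1 * x + q.2 - x ^ 2 := fun q => by fun_prop
  refine ⟨fun t ht => ?_, ?_, fun t ht => ?_⟩
  · obtain ⟨q, r, -, hq, hr⟩ := hslopes t ht
    have hcov : Icc a b = (Icc a b ∩ Iic t) ∪ (Icc a b ∩ Ici t) := by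
      rw [← inter_union_distrib_left, Iic_union_Ici, inter_univ]
    rw [hcov]
    exact ((hcd q).continuous.continuousWithinAt.congr_of_eventuallyEq hq
        (hq.self_of_nhdsWithin ⟨ht, self_mem_Iic⟩)).union
      ((hcd r).continuous.continuousWithinAt.congr_of_eventuallyEq hr
        (hr.self_of_nhdsWithin ⟨ht, self_mem_Ici⟩))
  · choose! q r _ hq hr using hslopes
    have hU : ∀ t ∈ Icc a b, ∀ᶠ x in 𝓝 t,
        (x ∈ Icc a b ∩ Iic t → h x = (q t).1 * x + (q t).2 - x ^ 2) ∧
        (x ∈ Icc a b ∩ Ici t → h x = (r t).1 * x + (r t).2 - x ^ 2) := fun t ht =>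
      (eventually_nhdsWithin_iff.1 (hq t ht)).and (eventually_nhdsWithin_iff.1 (hr t ht))
    -- The centres of a finite subcover serve as break points: an interval whose interior avoids
    -- them lies on one side of each centre, where the function has a single formula.
    obtain ⟨D, hD, hcov⟩ := isCompact_Icc.elim_nhds_subcover _ fun t ht =>
      interior_mem_nhds.2 (hU t ht)
    refine ⟨D, fun u v hau _ hvb huv s hs => ?_⟩
    have hsub : Icc u v ⊆ Icc a b := Icc_subset_Icc hau hvb
    obtain ⟨t, htD, hst⟩ := mem_iUnion₂.1 (hcov (hsub hs))
    have hnear := mem_interior_iff_mem_nhds.1 hst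
    have key : ∀ p : ℝ × ℝ, (∀ᶠ x in 𝓝[Icc u v] s, h x = p.1 * x + p.2 - x ^ 2) →
        ContDiffWithinAt ℝ 1 h (Icc u v) s := fun p hp =>
      (hcd p).contDiffWithinAt.congr_of_eventuallyEq hp (hp.self_of_nhdsWithin hs)
    by_cases htu : t ≤ u
    · refine key (r t) ?_
      filter_upwards [nhdsWithin_le_nhds hnear, self_mem_nhdsWithin] with x hx hxs
      exact hx.2 ⟨hsub hxs, htu.trans hxs.1⟩
    · have hvt : v ≤ t := not_lt.1 fun hlt => huv t htD ⟨not_le.1 htu, hlt⟩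
      refine key (q t) ?_
      filter_upwards [nhdsWithin_le_nhds hnear, self_mem_nhdsWithin] with x hx hxs
      exact hx.1 ⟨hsub hxs, hxs.2.trans hvt⟩
  · obtain ⟨q, r, hqr, hq, hr⟩ := hslopes t (Ioo_subset_Icc_self ht)
    have hab : Icc a b ∈ 𝓝 t := Icc_mem_nhds ht.1 ht.2
    rw [nhdsWithin_inter_of_mem (nhdsWithin_le_nhds hab)] at hq hr
    exact ⟨q.1 - 2 * t, r.1 - 2 * t,
      tendsto_deriv_of_eventuallyEq isOpen_Iio (hq.filter_mono (nhdsWithin_mono _ Iio_subset_Iic_self)),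
      tendsto_deriv_of_eventuallyEq isOpen_Ioi (hr.filter_mono (nhdsWithin_mono _ Ioi_subset_Ici_self)),
      by linarith⟩

end MaxAffine

/-! ### Q-convexity of the extension -/

section Convexity

variable {X : Type*} [MetricSpace X] {S : Set X} {f : X → ℝ}

/-- If, in flat charts, `f` is locally a maximum of finitely many functions `t - d(·, ω)²`, then
`f` is Q-convex. -/
theorem IsMarkedSurface.qConvex_of_max (hS : IsMarkedSurface S)
    (hf : ∀ p ∉ S, ∀ ε e, IsFlatChart p ε e → ∃ I : Finset (Plane × ℝ), ∀ᶠ w in 𝓝 0,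
      (∃ q ∈ I, f (e w) = q.2 - dist w q.1 ^ 2) ∧ ∀ q ∈ I, q.2 - dist w q.1 ^ 2 ≤ f (e w)) :
    QConvex S f := by
  classical
  intro c a b hab hc
  refine qConvexOn_of_max fun t ht => ?_
  obtain ⟨htS, δ, hδ, hiso⟩ := hc t ht
  obtain ⟨ε, e, he, -⟩ := hS.exists_flatChart htS
  obtain ⟨I, hI⟩ := hf _ htS ε e he
  set η := min δ ε with hη
  have hη0 : 0 < η := lt_min hδ he.pos
  have htη : t ∈ Icc a b ∩ Metric.ball t η := ⟨ht, Metric.mem_ball_self hη0⟩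
  have hsub : Icc a b ∩ Metric.ball t η ⊆ Icc a b ∩ Metric.ball t δ :=
    inter_subset_inter_right _ (Metric.ball_subset_ball (min_le_left _ _))
  have hlift : ∀ x ∈ Icc a b ∩ Metric.ball t η, ∃ y ∈ Metric.ball (0 : Plane) ε, e y = c x := by
    intro x hx
    refine he.surj _ ?_
    rw [Metric.mem_ball, hiso x (hsub hx) t (hsub htη)]
    exact (Metric.mem_ball.1 hx.2).trans_le (min_le_right _ _)
  choose! u hu huc using hlift
  have hdist : ∀ x ∈ Icc a b ∩ Metric.ball t η, ∀ y ∈ Icc a b ∩ Metric.ball t η,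
      dist (u x) (u y) = |x - y| := by
    intro x hx y hy
    rw [← he.dist_eq _ (hu x hx) _ (hu y hy), huc x hx, huc y hy, hiso x (hsub hx) y (hsub hy),
      Real.dist_eq]
  have hut : u t = 0 := by
    rw [← norm_eq_zero, ← he.dist_center (hu t htη), huc t htη, dist_self]
  -- A second time near `t` fixes the direction of the lift; `t` may be an endpoint of `[a, b]`, so
  -- the side is chosen accordingly.
  obtain ⟨t₁, ht₁, hne⟩ : ∃ t₁ ∈ Icc a b ∩ Metric.ball t η, t ≠ t₁ := by
    rcases ht.2.lt_or_eq with h | h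
    · refine ⟨min b (t + η / 2), ⟨⟨le_min hab.le (by linarith [ht.1]), min_le_left _ _⟩, ?_⟩,
        (lt_min h (by linarith)).ne⟩
      rw [Metric.mem_ball, Real.dist_eq, abs_lt]
      constructor
      · linarith [(lt_min h (by linarith : t < t + η / 2))]
      · linarith [min_le_right b (t + η / 2)]
    · have h' : a < t := h ▸ hab
      refine ⟨max a (t - η / 2), ⟨⟨le_max_left _ _, max_le hab.le (by linarith [ht.2])⟩, ?_⟩,
        (max_lt h' (by linarith)).ne'⟩
      rw [Metric.mem_ball, Real.dist_eq, abs_lt]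
      constructor
      · linarith [le_max_right a (t - η / 2)]
      · linarith [(max_lt h' (by linarith : t - η / 2 < t))]
  set v : Plane := (t₁ - t)⁻¹ • u t₁ with hv
  have hv1 : ‖v‖ = 1 := by
    have h1 := hdist t₁ ht₁ t htη
    rw [hut, dist_zero_right] at h1
    rw [hv, norm_smul, h1, norm_inv, Real.norm_eq_abs, inv_mul_cancel₀]
    exact abs_ne_zero.2 (sub_ne_zero.2 hne.symm)
  have hline : ∀ x ∈ Icc a b ∩ Metric.ball t η, u x = (x - t) • v := by
    intro x hx
    have := eq_line_of_dist_eq hne (hdist t₁ ht₁ t htη) (hdist x hx t htη) (hdist x hx t₁ ht₁)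
    rwa [hut, zero_add, sub_zero] at this
  -- As `v` is a unit vector, adding `x²` cancels the quadratic term.
  have hsq : ∀ (q : Plane × ℝ) x, q.2 - dist ((x - t) • v) q.1 ^ 2 + x ^ 2 =
      (2 * t + 2 * inner ℝ v q.1) * x + (q.2 - t ^ 2 - 2 * t * inner ℝ v q.1 - ‖q.1‖ ^ 2) := by
    intro q x
    rw [dist_eq_norm, @norm_sub_sq_real, norm_smul, hv1, real_inner_smul_left, mul_one,
      Real.norm_eq_abs, sq_abs]
    ring
  refine ⟨I.image fun q => (2 * t + 2 * inner ℝ v q.1,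
    q.2 - t ^ 2 - 2 * t * inner ℝ v q.1 - ‖q.1‖ ^ 2), ?_⟩
  have htend : Tendsto (fun x : ℝ => (x - t) • v) (𝓝 t) (𝓝 0) := by
    have : Continuous fun x : ℝ => (x - t) • v := by fun_prop
    simpa using this.tendsto t
  filter_upwards [self_mem_nhdsWithin, nhdsWithin_le_nhds (Metric.ball_mem_nhds t hη0),
    nhdsWithin_le_nhds (htend.eventually hI)] with x hx hxη ⟨⟨q, hq, hfq⟩, hle⟩
  rw [← hline x ⟨hx, hxη⟩, huc x ⟨hx, hxη⟩] at hfq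
  refine ⟨⟨_, Finset.mem_image_of_mem _ hq, ?_⟩, fun r hr => ?_⟩
  · rw [← hsq, Function.comp, hfq, hline x ⟨hx, hxη⟩]
  · obtain ⟨r, hrI, rfl⟩ := Finset.mem_image.1 hr
    have := hle r hrI
    rw [← hsq, ← hline x ⟨hx, hxη⟩]
    rw [← hline x ⟨hx, hxη⟩, huc x ⟨hx, hxη⟩] at this
    simpa using this

variable {D : DiscFamily S} {T : CellTriangulation D} {τ : X → ℝ}

/-- Each open face contributes at most one preimage, because the charts are injective there. -/
theorem CellTriangulation.finite_fiber (hS : IsMarkedSurface S) (p : X) :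
    {k : Fin T.n × Plane | k.2 ∈ convexHull ℝ (range (T.v k.1)) ∧ D.φ (T.c k.1) k.2 = p}.Finite := by
  have hsub : {k : Fin T.n × Plane | k.2 ∈ convexHull ℝ (range (T.v k.1)) ∧
      D.φ (T.c k.1) k.2 = p} ⊆ ⋃ (i : Fin T.n) (F : Finset (Fin 3)),
        Prod.mk i '' {y ∈ openFace (T.v i) F | D.φ (T.c i) y = p} := by
    rintro ⟨i, y⟩ ⟨hy, hyp⟩
    obtain ⟨F, hF⟩ := exists_mem_openFace hy
    exact mem_iUnion₂.2 ⟨i, F, y, ⟨hF, hyp⟩, rfl⟩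
  refine Finite.subset (finite_iUnion fun i => finite_iUnion fun F => Finite.image _
    (Set.Subsingleton.finite ?_)) hsub
  exact fun x hx y hy => hS.injOn_openFace T i F hx.1 hy.1 (hx.2.trans hy.2.symm)

/-- The points close to `p` lie on triangles, close to the positions of `p`. -/
theorem CellTriangulation.eventually_exists_near (hS : IsMarkedSurface S) (p : X)
    {U : Fin T.n → Plane → Set Plane} (hU : ∀ i y, U i y ∈ 𝓝 y) :
    ∀ᶠ z in 𝓝 p, ∃ i, ∃ y ∈ convexHull ℝ (range (T.v i)), D.φ (T.c i) y = p ∧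
      ∃ y' ∈ convexHull ℝ (range (T.v i)), y' ∈ U i y ∧ D.φ (T.c i) y' = z := by
  -- The triangle minus neighbourhoods of the preimages of `p` is compact, so its image is closed
  -- and misses a neighbourhood of `p`.
  set K : Fin T.n → Set Plane := fun i => convexHull ℝ (range (T.v i)) \
    ⋃ y ∈ {y ∈ convexHull ℝ (range (T.v i)) | D.φ (T.c i) y = p}, interior (U i y)
  have hK : ∀ i, IsCompact (K i) := fun i =>
    ((finite_range _).isCompact_convexHull ℝ).diff
      (isOpen_biUnion fun y _ => isOpen_interior)
  have hclosed : ∀ i, IsClosed (D.φ (T.c i) '' K i) := fun i =>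
    ((hK i).image_of_continuousOn ((IsMarkedSurface.continuousOn_chart T i).mono
      sdiff_subset)).isClosed
  have hp : ∀ i, p ∉ D.φ (T.c i) '' K i := by
    rintro i ⟨y, ⟨hy, hyn⟩, hyp⟩
    exact hyn (mem_iUnion₂.2 ⟨y, ⟨hy, hyp⟩, mem_interior_iff_mem_nhds.2 (hU i y)⟩)
  filter_upwards [eventually_all.2 fun i => (hclosed i).isOpen_compl.mem_nhds (hp i)] with z hz
  obtain ⟨i, y', hy', rfl⟩ := mem_iUnion.1 ((hS.iUnion_chart_image T).ge (mem_univ z))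
  have : y' ∉ K i := fun h => hz i (mem_image_of_mem _ h)
  rw [Set.mem_sdiff, not_and, not_not] at this
  obtain ⟨y, hy, hyU⟩ := mem_iUnion₂.1 (this hy')
  exact ⟨i, y, hy.1, hy.2, y', hy', interior_subset hyU, rfl⟩

/-- The height of each triangle position over `p` is carried into the flat chart. A point near `p`
lies in one of these triangles, whose height is the value of `f`, and by
`IsMarkedSurface.height_le_height` it dominates all the others there. -/
theorem IsMarkedSurface.qConvex_extension (hS : IsMarkedSurface S) (hT : T.IsLowerHull τ)
    (hτ : D.IsSmall τ)
    (hf : ∀ i, ∀ x ∈ convexHull ℝ (range (T.v i)), f (D.φ (T.c i) x) = T.height τ i x) :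
    QConvex S f := by
  classical
  refine hS.qConvex_of_max fun p hp ε e he => ?_
  set P := (CellTriangulation.finite_fiber (T := T) hS p).toFinset
  have hP : ∀ i y, (i, y) ∈ P ↔ y ∈ convexHull ℝ (range (T.v i)) ∧ D.φ (T.c i) y = p :=
    fun i y => Finite.mem_toFinset _
  have hlt : ∀ i y, (i, y) ∈ P → ‖y‖ < D.R (T.c i) := fun i y h =>
    (T.norm_lt_iff ((hP i y).1 h).1).2 (((hP i y).1 h).2 ▸ hp)
  have hg : ∀ i y, ∃ g : Plane ≃ᵃⁱ[ℝ] Plane, (i, y) ∈ P → g y = 0 ∧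
      ∀ᶠ z in 𝓝 y, D.φ (T.c i) z = e (g z) := by
    intro i y
    by_cases h : (i, y) ∈ P
    · obtain ⟨g, hg⟩ := he.exists_eventuallyEq ((D.disc (T.c i)).dev.locIso Metric.isOpen_ball
        (mem_ball_zero_iff.2 (hlt i y h))) (Metric.mem_ball_self he.pos)
        (((hP i y).1 h).2.trans he.map_zero.symm)
      exact ⟨g, fun _ => hg⟩
    · exact ⟨AffineIsometryEquiv.refl ℝ _, fun h' => absurd h' h⟩
  choose g hg using hg
  have hq : ∀ i : Fin T.n, ∃ q : Plane × ℝ, ∀ y, T.height τ i y = q.2 - dist y q.1 ^ 2 := by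
    intro i
    obtain ⟨ω, t₀, h⟩ := exists_sub_dist_sq (interp (T.affineIndependent i)
      (τ ∘ D.φ (T.c i) ∘ T.v i) + AffineMap.const ℝ _ (D.R (T.c i) ^ 2))
    refine ⟨(ω, t₀), fun y => ?_⟩
    rw [← h]
    change D.R (T.c i) ^ 2 - _ + _ = _ + D.R (T.c i) ^ 2 - _
    ring
  choose q hq using hq
  have hheight : ∀ i y w, (q i).2 - dist w (g i y (q i).1) ^ 2 = T.height τ i ((g i y).symm w) := by
    intro i y w
    rw [hq, ← (g i y).dist_map ((g i y).symm w), (g i y).apply_symm_apply]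
  refine ⟨P.image fun k => (g k.1 k.2 (q k.1).1, (q k.1).2), ?_⟩
  set U : Fin T.n → Plane → Set Plane := fun i y =>
    {z | (i, y) ∈ P → D.φ (T.c i) z = e (g i y z) ∧ g i y z ∈ Metric.ball 0 ε}
  have hU : ∀ i y, U i y ∈ 𝓝 y := by
    intro i y
    by_cases h : (i, y) ∈ P
    · have h2 : ∀ᶠ z in 𝓝 y, g i y z ∈ Metric.ball 0 ε := (g i y).continuous.continuousAt
        (Metric.isOpen_ball.mem_nhds ((hg i y h).1 ▸ Metric.mem_ball_self he.pos))
      filter_upwards [(hg i y h).2, h2] with z hz hz2 _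
      exact ⟨hz, hz2⟩
    · exact univ_mem' fun z h' => absurd h' h
  have hcont : Tendsto e (𝓝 0) (𝓝 p) := by
    have := (he.locIso (Metric.mem_ball_self he.pos)).continuousAt
    rwa [ContinuousAt, he.map_zero] at this
  filter_upwards [hcont.eventually (CellTriangulation.eventually_exists_near hS p hU),
    Metric.ball_mem_nhds (0 : Plane) he.pos] with w ⟨i, y, hy, hyp, y', hy', hyU, hyw⟩ hw
  have hk : (i, y) ∈ P := (hP i y).2 ⟨hy, hyp⟩
  have hgw : g i y y' = w := by
    obtain ⟨h1, h2⟩ := hyU hk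
    rw [← dist_eq_zero, ← he.dist_eq _ h2 _ hw, ← h1, hyw, dist_self]
  have hfw : f (e w) = T.height τ i y' := by rw [← hyw, hf i y' hy']
  have hgy' : (g i y).symm w = y' := by rw [← hgw, (g i y).symm_apply_apply]
  refine ⟨⟨_, Finset.mem_image_of_mem _ hk, ?_⟩, fun r hrI => ?_⟩
  · rw [hheight, hfw, hgy']
  · obtain ⟨⟨j, z⟩, hr, rfl⟩ := Finset.mem_image.1 hrI
    rw [hheight, hfw]
    have hgz : ((g i y).trans (g j z).symm) y = z := by
      rw [AffineIsometryEquiv.coe_trans, Function.comp, (hg i y hk).1, ← (hg j z hr).1,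
        (g j z).symm_apply_apply]
    have hov : Overlap S (D.R (T.c i)) (D.φ (T.c i)) (D.R (T.c j)) (D.φ (T.c j))
        ((g i y).trans (g j z).symm) y := by
      refine ⟨D.disc _, D.disc _, hlt i y hk, by rw [hgz]; exact hlt j z hr, ?_⟩
      have h1 : ∀ᶠ x in 𝓝 y, D.φ (T.c j) (((g i y).trans (g j z).symm) x) =
          e (g j z (((g i y).trans (g j z).symm) x)) := by
        have h2 := ((g i y).trans (g j z).symm).continuous.tendsto y
        rw [hgz] at h2
        exact h2.eventually (hg j z hr).2
      filter_upwards [(hg i y hk).2, h1] with x hx hx1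
      rw [hx, hx1, AffineIsometryEquiv.coe_trans, Function.comp, (g j z).apply_symm_apply]
    have := hS.height_le_height hT hτ hov hy (by rw [hgz]; exact ((hP j z).1 hr).1) hy'
    rwa [AffineIsometryEquiv.coe_trans, Function.comp, hgw] at this

end Convexity

/-! ### Adding constants -/

section Shift

variable {X : Type*} [MetricSpace X] {S : Set X}

theorem IsMarkedSurface.eventually_isDelaunayFor (hS : IsMarkedSurface S) :
    ∀ᶠ τ in 𝓝 (0 : S → ℝ), ∃ T : AdaptedTriangulation S, T.RefinesDelaunay ∧ T.IsDelaunayFor τ := by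
  obtain ⟨D⟩ := nonempty_discFamily S
  filter_upwards [hS.eventually_isSmall D] with τ hτ
  obtain ⟨T, hT⟩ := hS.exists_cellTriangulation D (extendZero S τ)
  obtain ⟨f, hf⟩ := hS.exists_extension hT hτ
  refine ⟨T.toAdapted hS, T.refinesDelaunay hS, f, ?_, hS.qConvex_extension hT hτ hf⟩
  have := T.isDistanceLikeExtension hS hf
  simp only [extendZero_coe] at this
  exact this

theorem QConvexOn.add_const {h : ℝ → ℝ} {a b : ℝ} (hh : QConvexOn h a b) (t : ℝ) :
    QConvexOn (fun x => h x + t) a b := by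
  obtain ⟨hc, ⟨D, hD⟩, hj⟩ := hh
  refine ⟨hc.add continuousOn_const, ⟨D, fun u v hau huv hvb hn =>
    (hD u v hau huv hvb hn).add contDiffOn_const⟩, fun s hs => ?_⟩
  rw [funext fun x => deriv_add_const (f := h) (x := x) t]
  exact hj s hs

theorem AdaptedTriangulation.IsDelaunayFor.add_const {T : AdaptedTriangulation S} {τ : S → ℝ}
    (h : T.IsDelaunayFor τ) (t : ℝ) : T.IsDelaunayFor fun s => τ s + t := by
  obtain ⟨f, ⟨hfS, hfT⟩, hq⟩ := h
  refine ⟨fun x => f x + t, ⟨fun s => congrArg (· + t) (hfS s), fun i => ?_⟩,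
    fun c a b hab hc => (hq c a b hab hc).add_const t⟩
  obtain ⟨ω, t₀, h⟩ := hfT i
  exact ⟨ω, t₀ + t, fun x hx => (congrArg (· + t) (h x hx)).trans (by ring)⟩

theorem IsMarkedSurface.eventually_isDelaunayFor_const (hS : IsMarkedSurface S) (t : ℝ) :
    ∀ᶠ τ in 𝓝 (fun _ : S => t),
      ∃ T : AdaptedTriangulation S, T.RefinesDelaunay ∧ T.IsDelaunayFor τ := by
  have htend : Tendsto (fun (τ : S → ℝ) s => τ s - t) (𝓝 fun _ => t) (𝓝 0) := by
    have : Continuous fun (τ : S → ℝ) s => τ s - t := by fun_prop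
    convert this.tendsto fun _ => t using 2
    ext s
    simp
  filter_upwards [htend.eventually hS.eventually_isDelaunayFor] with τ ⟨T, hT, hτ⟩
  refine ⟨T, hT, ?_⟩
  simpa using hτ.add_const t

end Shift

end FlatCone

end

theorem mainTheorem11 {X : Type*} [MetricSpace X] (S : Set X)
    (hS : FlatCone.IsMarkedSurface S) :
    (fun _ : S => (1 : ℝ)) ∈ interior (FlatCone.admissibleTimes S) ∧
      ∀ t : ℝ, 0 ≤ t → ∀ᶠ τ in 𝓝 (fun _ : S => t), (∀ s, 0 ≤ τ s) →
        ∃ T : FlatCone.AdaptedTriangulation S, T.RefinesDelaunay ∧ T.IsDelaunayFor τ := by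
  refine ⟨mem_interior_iff_mem_nhds.2 ?_, fun t _ =>
    (hS.eventually_isDelaunayFor_const t).mono fun τ h _ => h⟩
  have hfin : Finite S := hS.finite.to_subtype
  have hpos : ∀ᶠ τ in 𝓝 (fun _ : S => (1 : ℝ)), ∀ s, 0 ≤ τ s := eventually_all.2 fun s =>
    (((continuous_apply s).tendsto fun _ => (1 : ℝ)).eventually_const_lt one_pos).mono
      fun _ h => h.le
  filter_upwards [hpos, hS.eventually_isDelaunayFor_const 1] with τ h ⟨T, _, hT⟩
  exact ⟨h, T, hT⟩
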